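/- Let $M$ be a compact Riemannian manifold (without boundary) with normalized Riemannian volume $\mathrm{Leb}$, let $f:M\to M$ be a $C^2$ local diffeomorphism, let $T$ be a metric space, let $\Phi:T\to C^2(M,M)$, $t\mapsto f_t$, be continuous for the $C^2$ topology with $f_{t^*}=f$ for some $t^*\in T$, and let $(\theta_\epsilon)_{\epsilon>0}$ be Borel probability measures on $T$, each $\theta_\epsilon$ with small $\epsilon$ being carried by its support (which is automatic if $T$ is separable), with $\operatorname{supp}(\theta_\epsilon)\to\{t^*\}$ as $\epsilon\to0$. For $\omega=(\omega_0,\omega_1,\dots)\in T^{\mathbb N}$ put $f_\omega^0=\mathrm{Id}$ and $f_\omega^n=f_{\omega_{n-1}}\circ\cdots\circ f_{\omega_0}$. Let $A\subset M$ be a Borel set with $\mathrm{Leb}(A)>0$ such that: (a) $A$ is random invariant for all sufficiently small $\epsilon>0$: for $\mathrm{Leb}$-a.e. $x\in M$, if $x\in A$ then $f_t(x)\in A$ for $\theta_\epsilon$-a.e. $t$, and if $x\notin A$ then $f_t(x)\notin A$ for $\theta_\epsilon$-a.e. $t$; (b) $f$ is topologically transitive in $A$: for all open $U,V\subset M$ that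 meet $A$ there are $n\ge0$ and $x\in U\cap A$ with $f^n(x)\in V\cap A$; (c) $(\Phi,(\theta_\epsilon)_{\epsilon>0})$ is non-uniformly expanding on random orbits on $A$: there is $a_0>0$ such that for all sufficiently small $\epsilon>0$ and $\theta_\epsilon^{\mathbb N}\times(\mathrm{Leb}|A)$-a.e. $(\omega,x)$, $$\liminf_{n\to\infty}\frac1n\sum_{j=0}^{n-1}\log\big\|Df_{\omega_j}(f_\omega^j(x))^{-1}\big\|<-a_0 .$$ Then there is an open ball $\Delta\subset M$ of positive radius, contained in $A$ up to a set of zero Lebesgue measure, such that for all sufficiently small $\epsilon>0$ the random perturbation $(\Phi,\theta_\epsilon)$ induces a random Gibbs–Markov–Young structure in $\Delta$. That is, there are a measurable function $\mathcal R:T^{\mathbb N}\times\Delta\to\{1,2,\dots\}$ and constants $0<\kappa<1$, $K>0$ such that for $\theta_\epsilon^{\mathbb N}$-a.e. $\omega$ there is a countable family $\mathcal P_\omega$ of nonempty, pairwise disjoint open subsets of $\Delta$ with $\mathrm{Leb}(\Delta\setminus\bigcup\mathcal P_\omega)=0$ for which, with $F_\omega(x)=f_\omega^{\mathcal R(\omega,x)}(x)$,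 every $U\in\mathcal P_\omega$ satisfies: $\mathcal R(\omega,\cdot)$ is constant on $U$; $F_\omega|_U$ is a $C^2$ diffeomorphism onto $\Delta$; $\|DF_\omega(x)^{-1}\|<\kappa$ for all $x\in U$; and $$\log\left|\frac{\det DF_\omega(x)}{\det DF_\omega(y)}\right|\le K\,\mathrm{dist}(F_\omega(x),F_\omega(y))\qquad\text{for all }x,y\in U .$$ -/

import Mathlib

open Set Filter MeasureTheory Bundle
open scoped Manifold ContDiff Topology ENNReal

noncomputable section

/-! ### Linear algebra -/

/-- The absolute value of the determinant of a linear map `L : V → W` between Euclidean spaces of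
the same dimension, with respect to orthonormal bases: `√(det (Lᵀ L))`. -/
def absDet {V W : Type*} [NormedAddCommGroup V] [InnerProductSpace ℝ V] [FiniteDimensional ℝ V]
    [NormedAddCommGroup W] [InnerProductSpace ℝ W] (L : V →L[ℝ] W) : ℝ :=
  Real.sqrt (Matrix.gram ℝ (fun i => L (stdOrthonormalBasis ℝ V i))).det

/-! ### The manifold: derivatives, normalized volume, the `C²` topology -/

/-- The derivative `D g(x) : T_x M → T_{g x} M`. -/
abbrev tangentDeriv (d : ℕ) {M : Type*} [EMetricSpace M]
    [ChartedSpace (EuclideanSpace ℝ (Fin d)) M] (g : M → M) (x : M) :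
    TangentSpace (𝓡 d) x →L[ℝ] TangentSpace (𝓡 d) (g x) :=
  mfderiv (𝓡 d) (𝓡 d) g x

/-- The norm `‖D g(x)⁻¹‖` of the inverse of the derivative, with respect to the Riemannian norms
on the tangent spaces; it is only used where `D g(x)` is invertible. -/
def normInvDeriv (d : ℕ) {M : Type*} [EMetricSpace M]
    [ChartedSpace (EuclideanSpace ℝ (Fin d)) M]
    [RiemannianBundle (fun x : M => TangentSpace (𝓡 d) x)] (g : M → M) (x : M) : ℝ :=
  ‖(tangentDeriv d g x).inverse‖

/-- The Jacobian `|det D g(x)|` with respect to the Riemannian metric. -/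
def jacobian (d : ℕ) {M : Type*} [EMetricSpace M]
    [ChartedSpace (EuclideanSpace ℝ (Fin d)) M]
    [RiemannianBundle (fun x : M => TangentSpace (𝓡 d) x)] (g : M → M) (x : M) : ℝ :=
  haveI : FiniteDimensional ℝ (TangentSpace (𝓡 d) x) :=
    inferInstanceAs (FiniteDimensional ℝ (EuclideanSpace ℝ (Fin d)))
  absDet (tangentDeriv d g x)

/-- The volume density `√(det (g_{ij}))` at the point `y` of the target of the chart around `x`,
where `g_{ij} = ⟨∂_i, ∂_j⟩` and `∂_i` is the `i`-th coordinate vector field of the chart. -/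
def chartDensity (d : ℕ) {M : Type*} [EMetricSpace M]
    [ChartedSpace (EuclideanSpace ℝ (Fin d)) M]
    [RiemannianBundle (fun x : M => TangentSpace (𝓡 d) x)] (x : M)
    (y : EuclideanSpace ℝ (Fin d)) : ℝ :=
  Real.sqrt (Matrix.gram ℝ (fun i : Fin d =>
    (mfderiv (𝓡 d) (𝓡 d) (extChartAt (𝓡 d) x).symm y
      (EuclideanSpace.single i (1 : ℝ) : EuclideanSpace ℝ (Fin d)) :
        TangentSpace (𝓡 d) ((extChartAt (𝓡 d) x).symm y)))).det

/-- The Riemannian volume of the domain of the chart around `x`: the measure `√(det g) dy`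
carried over to `M` by the chart (and zero outside of the domain of the chart). -/
def chartVolume (d : ℕ) {M : Type*} [EMetricSpace M] [MeasurableSpace M]
    [ChartedSpace (EuclideanSpace ℝ (Fin d)) M]
    [RiemannianBundle (fun x : M => TangentSpace (𝓡 d) x)] (x : M) : Measure M :=
  ((volume.withDensity fun y => ENNReal.ofReal (chartDensity d x y)).restrict
    (extChartAt (𝓡 d) x).target).map (extChartAt (𝓡 d) x).symm

/-- The Riemannian volume. The measures `chartVolume d x` agree on the overlaps of the charts, so
that their supremum is the measure which is `√(det g) dy` in every chart. -/
def riemannianVolume (d : ℕ) (M : Type*) [EMetricSpace M] [MeasurableSpace M]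
    [ChartedSpace (EuclideanSpace ℝ (Fin d)) M]
    [RiemannianBundle (fun x : M => TangentSpace (𝓡 d) x)] : Measure M :=
  ⨆ x : M, chartVolume d x

/-- Lebesgue measure on `M`: the normalized Riemannian volume. -/
def leb (d : ℕ) (M : Type*) [EMetricSpace M] [MeasurableSpace M]
    [ChartedSpace (EuclideanSpace ℝ (Fin d)) M]
    [RiemannianBundle (fun x : M => TangentSpace (𝓡 d) x)] : Measure M :=
  (riemannianVolume d M univ)⁻¹ • riemannianVolume d M

/-- The subbasic neighbourhood `N²(f; x, y, K, δ)` of `f` in the `C²` topology: the maps `g` with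
`g(K)` inside the domain of the chart around `y`, such that the representatives of `f` and `g` in
the charts around `x` and `y` are `δ`-close on `K` together with their derivatives up to
order 2. -/
def c2Nhd {d : ℕ} {M : Type*} [EMetricSpace M] [ChartedSpace (EuclideanSpace ℝ (Fin d)) M]
    (f : C^2⟮𝓡 d, M; 𝓡 d, M⟯) (x y : M) (K : Set M) (δ : ℝ) :
    Set C^2⟮𝓡 d, M; 𝓡 d, M⟯ :=
  {g | MapsTo g K (extChartAt (𝓡 d) y).source ∧
    ∀ k : ℕ, k ≤ 2 → ∀ z ∈ extChartAt (𝓡 d) x '' K,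
      ‖iteratedFDeriv ℝ k (extChartAt (𝓡 d) y ∘ g ∘ (extChartAt (𝓡 d) x).symm) z -
        iteratedFDeriv ℝ k (extChartAt (𝓡 d) y ∘ f ∘ (extChartAt (𝓡 d) x).symm) z‖ < δ}

/-- The `C²` topology on `C²(M, M)`, generated by the sets `N²(f; x, y, K, δ)` with `K` a compact
subset of the domain of the chart around `x` that `f` maps into the domain of the chart
around `y`. -/
@[reducible] def c2Topology (d : ℕ) (M : Type*) [EMetricSpace M] [ChartedSpace (EuclideanSpace ℝ (Fin d)) M] :
    TopologicalSpace C^2⟮𝓡 d, M; 𝓡 d, M⟯ :=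
  TopologicalSpace.generateFrom
    {S | ∃ (f : C^2⟮𝓡 d, M; 𝓡 d, M⟯) (x y : M) (K : Set M) (δ : ℝ),
      IsCompact K ∧ K ⊆ (extChartAt (𝓡 d) x).source ∧
      MapsTo f K (extChartAt (𝓡 d) y).source ∧ 0 < δ ∧ S = c2Nhd f x y K δ}

/-- `g` maps `U` onto `V` as a `C²` diffeomorphism. -/
def IsC2DiffeoOnto (d : ℕ) {M : Type*} [EMetricSpace M]
    [ChartedSpace (EuclideanSpace ℝ (Fin d)) M] (g : M → M) (U V : Set M) : Prop :=
  BijOn g U V ∧ ContMDiffOn (𝓡 d) (𝓡 d) 2 g U ∧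
    ∃ h : M → M, ContMDiffOn (𝓡 d) (𝓡 d) 2 h V ∧ InvOn h g U V

/-! ### Random perturbations -/

/-- `f` is topologically transitive in `A`: for all nonempty relatively open subsets `U ∩ A` and
`V ∩ A` of `A` some iterate of a point of the first one lies in the second one. -/
def TopTransitiveIn {M : Type*} [TopologicalSpace M] (f : M → M) (A : Set M) : Prop :=
  ∀ U V : Set M, IsOpen U → IsOpen V → (U ∩ A).Nonempty → (V ∩ A).Nonempty →
    ∃ n : ℕ, ∃ x ∈ U ∩ A, f^[n] x ∈ V ∩ A

/-- The random iterates `f_w^n = f_{w_{n-1}} ∘ ⋯ ∘ f_{w_0}` of the maps `f_t = Φ t`. -/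
def randIter {T M : Type*} (Φ : T → M → M) (w : ℕ → T) : ℕ → M → M
  | 0 => id
  | n + 1 => Φ (w n) ∘ randIter Φ w n

/-- The supports of `θ_ε` converge to `{t₀}` as `ε → 0`. That `θ_ε` is carried by its support is
automatic if `T` is separable. -/
def SupportsTendTo {T : Type*} [TopologicalSpace T] [MeasurableSpace T]
    (θ : ℝ → Measure T) (t₀ : T) : Prop :=
  ∀ U ∈ 𝓝 t₀, ∀ᶠ ε in 𝓝[>] (0 : ℝ), (θ ε).support ⊆ U ∧ θ ε (θ ε).supportᶜ = 0

/-- `A` is random invariant for the random perturbation `(Φ, θ)`, with respect to the reference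
measure `m`. -/
def RandomInvariant {T M : Type*} [MeasurableSpace T] [MeasurableSpace M] (Φ : T → M → M)
    (θ : Measure T) (m : Measure M) (A : Set M) : Prop :=
  ∀ᵐ x ∂m, (x ∈ A → ∀ᵐ t ∂θ, Φ t x ∈ A) ∧ (x ∉ A → ∀ᵐ t ∂θ, Φ t x ∉ A)

section GMY

variable {T : Type*} [MeasurableSpace T] {M : Type*} [EMetricSpace M] [MeasurableSpace M]

/-- The family `(Φ, (θ_ε))` is non-uniformly expanding on random orbits on `A`. The lower limit is
taken in the extended real line. -/
def NUERO (d : ℕ) [ChartedSpace (EuclideanSpace ℝ (Fin d)) M]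
    [RiemannianBundle (fun x : M => TangentSpace (𝓡 d) x)] (Φ : T → M → M)
    (θ : ℝ → Measure T) [∀ ε, IsProbabilityMeasure (θ ε)] (A : Set M) : Prop :=
  ∃ a₀ : ℝ, 0 < a₀ ∧ ∀ᶠ ε in 𝓝[>] (0 : ℝ),
    ∀ᵐ p ∂((Measure.infinitePi fun _ : ℕ => θ ε).prod ((leb d M).restrict A)),
      liminf (fun n : ℕ => (((1 / (n : ℝ)) * ∑ j ∈ Finset.range n,
        Real.log (normInvDeriv d (Φ (p.1 j)) (randIter Φ p.1 j p.2)) : ℝ) : EReal)) atTop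
        < ((-a₀ : ℝ) : EReal)

/-- The random perturbation `(Φ, θ)` induces a random Gibbs-Markov-Young structure in `Δ`. The
induced map is `F_w(x) = f_w^{R(w,x)}(x)`; only the values of the inducing time `R` on `Δ` matter. -/
def InducesRandomGMY (d : ℕ) [ChartedSpace (EuclideanSpace ℝ (Fin d)) M]
    [RiemannianBundle (fun x : M => TangentSpace (𝓡 d) x)] (Φ : T → M → M)
    (θ : Measure T) [IsProbabilityMeasure θ] (Δ : Set M) : Prop :=
  ∃ R : (ℕ → T) → M → ℕ,
    Measurable (fun p : (ℕ → T) × Δ => R p.1 p.2) ∧ (∀ w, ∀ x ∈ Δ, 1 ≤ R w x) ∧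
    ∃ κ K : ℝ, 0 < κ ∧ κ < 1 ∧ 0 < K ∧
      ∀ᵐ w ∂(Measure.infinitePi fun _ : ℕ => θ),
        ∃ P : Set (Set M), P.Countable ∧ P.PairwiseDisjoint id ∧
          leb d M (Δ \ ⋃₀ P) = 0 ∧
          ∀ U ∈ P, IsOpen U ∧ U.Nonempty ∧ U ⊆ Δ ∧
            (∀ x ∈ U, ∀ y ∈ U, R w x = R w y) ∧
            IsC2DiffeoOnto d (fun x => randIter Φ w (R w x) x) U Δ ∧
            (∀ x ∈ U, normInvDeriv d (fun x => randIter Φ w (R w x) x) x < κ) ∧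
            ∀ x ∈ U, ∀ y ∈ U,
              Real.log (jacobian d (fun x => randIter Φ w (R w x) x) x /
                  jacobian d (fun x => randIter Φ w (R w x) x) y) ≤
                K * (edist (randIter Φ w (R w x) x) (randIter Φ w (R w y) y)).toReal

end GMY

end

/-! The dynamics is separated from the geometry. `LocalControl` records what is needed of the maps
`F t` with `t` near the unperturbed parameter: inverse branches on balls of one radius `ρ` that
contract like `lam t x`, up to a factor `exp η`, and a Jacobian `J t` whose logarithm is locally
Lipschitz. `exists_localControl` proves this for a family that is continuous for the `C²` topology
at a local diffeomorphism; there `lam` is the norm of the inverse derivative, and the bound on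
second derivatives makes the logarithm of the Jacobian Lipschitz.

Non-uniform expansion gives almost every random orbit in `A` infinitely many hyperbolic times `n`
(`frequently_hypTime`): times for which the product of the `lam` over any final stretch of length
`k` is less than `exp (-2ηk)`. Such a time yields an inverse branch of the `n`-th iterate on a ball
of fixed size which contracts backwards like `exp (-η)` per step, with distortion bounded
independently of `n`.

The covering argument (`ae_mem_of_greedy`) needs no estimate on how often hyperbolic times occur.
Hyperbolic preimages of sets of measure bounded below are selected greedily, earlier times first,
each one disjoint from those already selected. The dynamical ball around a selected preimage has
measure at most a constant times that of the preimage, so these measures have a finite sum and, by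
Borel-Cantelli, almost every point lies in only finitely many of these balls. On the other hand,
each hyperbolic time `n` of a point `x` produces a candidate, which meets a selected preimage of no
later time; `x` then lies in the dynamical ball of that preimage and at distance of order `exp
(-ηn)` from the preimage itself. One selected preimage therefore serves infinitely many `n`, so that
`x` lies in its closure, and the boundaries are null.

The covering is used twice. First, applied inside an open set that barely exceeds `A`, it gives a
hyperbolic preimage in which `A` has relative measure close to one; bounded distortion and forward
invariance carry this to a ball of fixed size, and since finitely many balls suffice, `A` contains a
ball up to a null set (`exists_ball_diff_null`). Secondly, transitivity gives a point `p` of that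
ball which is reached under `f` from each of finitely many small balls covering `A`, in a bounded
number of steps; this persists for small perturbations. At a hyperbolic time the orbit is in one of
these small balls, and following the connecting orbit to a ball `Δ` around `p` turns hyperbolic
preimages into full branches over `Δ` (`exists_induced`). Neither `p` nor the radius of `Δ` depends
on the small noise level. The greedy selection is measurable in the noise sequence, and hence so is
the inducing time. -/

set_option linter.unusedSectionVars false

/-! ### Random iterates -/

section RandIter

variable {T X : Type*}

lemma randIter_add (F : T → X → X) (w : ℕ → T) (n m : ℕ) (x : X) :
    randIter F w (n + m) x = randIter F (fun i => w (n + i)) m (randIter F w n x) := by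
  induction m with
  | zero => rfl
  | succ m ih =>
    change F (w (n + m)) (randIter F w (n + m) x) = _
    rw [ih]; rfl

lemma randIter_succ (F : T → X → X) (w : ℕ → T) (n : ℕ) (x : X) :
    randIter F w (n + 1) x = F (w n) (randIter F w n x) := rfl

lemma continuous_randIter [TopologicalSpace X] {F : T → X → X} {w : ℕ → T}
    (h : ∀ i, Continuous (F (w i))) (n : ℕ) : Continuous (randIter F w n) := by
  induction n with
  | zero => exact continuous_id
  | succ n ih => exact (h n).comp ih

lemma measurable_randIter [MeasurableSpace T] [MeasurableSpace X] {F : T → X → X}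
    (hF : Measurable (Function.uncurry F)) (n : ℕ) :
    Measurable (fun p : (ℕ → T) × X => randIter F p.1 n p.2) := by
  induction n with
  | zero => exact measurable_snd
  | succ n ih =>
    exact hF.comp (((measurable_pi_apply n).comp measurable_fst).prodMk ih)

end RandIter

/-! ### Families of locally expanding maps -/

/-- Uniform local control of the maps `F t`, `t ∈ N`: `lam t x` bounds the expansion of the inverse
branch of `F t` at `x` and `J t` is the Jacobian of `F t` with respect to `μ`. -/
structure LocalControl {T X : Type*} [MetricSpace X] [MeasurableSpace X] (μ : Measure X)
    (F : T → X → X) (lam J : T → X → ℝ) (N : Set T) (η ρ Λ Jm L : ℝ) : Prop where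
  η_pos : 0 < η
  ρ_pos : 0 < ρ
  L_nonneg : 0 ≤ L
  one_le_Λ : 1 ≤ Λ
  one_le_Jm : 1 ≤ Jm
  cont : ∀ t ∈ N, Continuous (F t)
  lam_pos : ∀ t ∈ N, ∀ x, 0 < lam t x
  lam_le : ∀ t ∈ N, ∀ x, lam t x ≤ Λ
  lam_cont : ∀ t ∈ N, Continuous (lam t)
  lam_near : ∀ t ∈ N, ∀ x y, dist x y < ρ → lam t y ≤ Real.exp η * lam t x
  J_pos : ∀ t ∈ N, ∀ x, 0 < J t x
  J_le : ∀ t ∈ N, ∀ x, J t x ≤ Jm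
  J_meas : ∀ t ∈ N, Measurable (J t)
  logJ_lip : ∀ t ∈ N, ∀ x y, dist x y < ρ →
    |Real.log (J t x) - Real.log (J t y)| ≤ L * dist x y
  image : ∀ t ∈ N, ∀ E, MeasurableSet E → InjOn (F t) E →
    μ (F t '' E) = ∫⁻ x in E, ENNReal.ofReal (J t x) ∂μ
  -- In this field and in the last one, the factor `Real.exp η` pays for evaluating the contraction
  -- rate at the centre `x` instead of along the path that joins the points.
  surj : ∀ t ∈ N, ∀ x y, dist y (F t x) < ρ →
    ∃ u, F t u = y ∧ dist u x ≤ Real.exp η * lam t x * dist y (F t x)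
  expand : ∀ t ∈ N, ∀ x u u', dist u x < ρ → dist u' x < ρ →
    dist (F t u) (F t x) < ρ → dist (F t u') (F t x) < ρ →
    dist u u' ≤ Real.exp η * lam t x * dist (F t u) (F t u')

namespace LocalControl

variable {T X : Type*} [MetricSpace X] [MeasurableSpace X] {μ : Measure X}
  {F : T → X → X} {lam J : T → X → ℝ} {N : Set T} {η ρ Λ Jm L : ℝ}

lemma mono (h : LocalControl μ F lam J N η ρ Λ Jm L) {N' : Set T} (hN : N' ⊆ N) :
    LocalControl μ F lam J N' η ρ Λ Jm L :=
  ⟨h.η_pos, h.ρ_pos, h.L_nonneg, h.one_le_Λ, h.one_le_Jm,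
    fun t ht => h.cont t (hN ht), fun t ht => h.lam_pos t (hN ht),
    fun t ht => h.lam_le t (hN ht), fun t ht => h.lam_cont t (hN ht),
    fun t ht => h.lam_near t (hN ht), fun t ht => h.J_pos t (hN ht), fun t ht => h.J_le t (hN ht),
    fun t ht => h.J_meas t (hN ht), fun t ht => h.logJ_lip t (hN ht),
    fun t ht => h.image t (hN ht), fun t ht => h.surj t (hN ht), fun t ht => h.expand t (hN ht)⟩

variable {w : ℕ → T}

lemma continuous_iter (h : LocalControl μ F lam J N η ρ Λ Jm L) (hw : ∀ i, w i ∈ N) (n : ℕ) :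
    Continuous (randIter F w n) :=
  continuous_randIter (fun i => h.cont _ (hw i)) n

lemma prod_nonneg (h : LocalControl μ F lam J N η ρ Λ Jm L) (hw : ∀ i, w i ∈ N) (x : X)
    (s : Finset ℕ) : 0 ≤ ∏ j ∈ s, (Real.exp η * lam (w j) (randIter F w j x)) :=
  Finset.prod_nonneg fun j _ => mul_nonneg (Real.exp_pos _).le (h.lam_pos _ (hw j) _).le

/-- Inverse branches along an orbit. -/
lemma exists_branch (h : LocalControl μ F lam J N η ρ Λ Jm L) (hw : ∀ i, w i ∈ N) (x : X) (n : ℕ) :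
    ∀ y, (∀ i ≤ n, (∏ j ∈ Finset.Ico i n, (Real.exp η * lam (w j) (randIter F w j x))) *
        dist y (randIter F w n x) < ρ) →
      ∃ u, randIter F w n u = y ∧ ∀ i ≤ n, dist (randIter F w i u) (randIter F w i x) ≤
        (∏ j ∈ Finset.Ico i n, (Real.exp η * lam (w j) (randIter F w j x))) *
        dist y (randIter F w n x) := by
  induction n with
  | zero =>
    intro y hy
    refine ⟨y, rfl, fun i hi => ?_⟩
    obtain rfl : i = 0 := by omega
    simp [randIter]
  | succ n ih =>
    intro y hy
    have h1 := hy (n + 1) le_rfl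
    simp only [Finset.Ico_self, Finset.prod_empty, one_mul] at h1
    obtain ⟨v, hv, hvd⟩ := h.surj (w n) (hw n) (randIter F w n x) y h1
    -- The one-step preimage `v` of `y` inherits the smallness condition for `n`. The condition is
    -- needed for every `i`, because an intermediate product may exceed the full one.
    have key : ∀ i ≤ n, (∏ j ∈ Finset.Ico i n, (Real.exp η * lam (w j) (randIter F w j x))) *
        dist v (randIter F w n x) ≤
        (∏ j ∈ Finset.Ico i (n + 1), (Real.exp η * lam (w j) (randIter F w j x))) *
        dist y (randIter F w (n + 1) x) := by
      intro i hi
      rw [Finset.prod_Ico_succ_top hi, mul_assoc]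
      exact mul_le_mul_of_nonneg_left hvd (h.prod_nonneg hw x _)
    obtain ⟨u, hu, hud⟩ := ih v fun i hi => (key i hi).trans_lt (hy i (by omega))
    refine ⟨u, by rw [randIter_succ, hu, hv], fun i hi => ?_⟩
    rcases Nat.lt_or_ge n i with hni | hni
    · obtain rfl : i = n + 1 := by omega
      simp [randIter_succ, hu, hv]
    · exact (hud i hni).trans (key i hni)

/-- Chaining `expand` backwards from time `n` needs only that both orbits stay close to that of `x`,
not that any product is small. With equal endpoints it gives injectivity on dynamical balls. -/
lemma dist_iter_le (h : LocalControl μ F lam J N η ρ Λ Jm L) (hw : ∀ i, w i ∈ N) {x u u' : X}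
    {n : ℕ} (hu : ∀ i ≤ n, dist (randIter F w i u) (randIter F w i x) < ρ)
    (hu' : ∀ i ≤ n, dist (randIter F w i u') (randIter F w i x) < ρ) :
    ∀ i ≤ n, dist (randIter F w i u) (randIter F w i u') ≤
      (∏ j ∈ Finset.Ico i n, (Real.exp η * lam (w j) (randIter F w j x))) *
        dist (randIter F w n u) (randIter F w n u') := by
  induction n with
  | zero =>
    intro i hi
    obtain rfl : i = 0 := by omega
    simp
  | succ n ih =>
    intro i hi
    rcases Nat.lt_or_ge n i with hni | hni
    · obtain rfl : i = n + 1 := by omega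
      simp
    · refine (ih (fun i hi => hu i (by omega)) (fun i hi => hu' i (by omega)) i hni).trans ?_
      rw [Finset.prod_Ico_succ_top hni, mul_assoc]
      refine mul_le_mul_of_nonneg_left ?_ (h.prod_nonneg hw x _)
      exact h.expand (w n) (hw n) _ _ _ (hu n (by omega)) (hu' n (by omega))
        (hu (n + 1) le_rfl) (hu' (n + 1) le_rfl)

lemma injOn_dynBall (h : LocalControl μ F lam J N η ρ Λ Jm L) (hw : ∀ i, w i ∈ N) (x : X) (n : ℕ) :
    InjOn (randIter F w n) {u | ∀ i ≤ n, dist (randIter F w i u) (randIter F w i x) < ρ} := by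
  intro u hu u' hu' he
  have := h.dist_iter_le hw hu hu' 0 (Nat.zero_le _)
  rw [he, dist_self, mul_zero] at this
  exact dist_le_zero.1 this

lemma isOpen_dynBall (h : LocalControl μ F lam J N η ρ Λ Jm L) (hw : ∀ i, w i ∈ N) (x : X) (n : ℕ)
    (s : ℝ) : IsOpen {u | ∀ i ≤ n, dist (randIter F w i u) (randIter F w i x) < s} := by
  have : {u | ∀ i ≤ n, dist (randIter F w i u) (randIter F w i x) < s} =
      ⋂ i ∈ Finset.range (n + 1), {u | dist (randIter F w i u) (randIter F w i x) < s} := by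
    ext u; simp
  rw [this]
  refine isOpen_biInter_finset fun i _ => ?_
  exact isOpen_lt ((h.continuous_iter hw i).dist continuous_const) continuous_const

section Measure

variable [BorelSpace X] [CompactSpace X]

/-- The image of a set under an iterate has comparable measure as long as the Jacobians vary
little. -/
lemma measure_image_iter (h : LocalControl μ F lam J N η ρ Λ Jm L) (hw : ∀ i, w i ∈ N) {E : Set X}
    (hE : MeasurableSet E) (c C : ℕ → ℝ) (hc : ∀ i, 0 ≤ c i) (hC : ∀ i, 0 ≤ C i) (n : ℕ)
    (hinj : InjOn (randIter F w n) E)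
    (hlow : ∀ i < n, ∀ u ∈ E, c i ≤ J (w i) (randIter F w i u))
    (hup : ∀ i < n, ∀ u ∈ E, J (w i) (randIter F w i u) ≤ C i) :
    ENNReal.ofReal (∏ i ∈ Finset.range n, c i) * μ E ≤ μ (randIter F w n '' E) ∧
    μ (randIter F w n '' E) ≤ ENNReal.ofReal (∏ i ∈ Finset.range n, C i) * μ E := by
  induction n with
  | zero => simp [randIter]
  | succ n ih =>
    have hcomp : randIter F w (n + 1) '' E = F (w n) '' (randIter F w n '' E) := by
      rw [← image_comp]; rfl
    have hinj' : InjOn (randIter F w n) E := fun u hu v hv he =>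
      hinj hu hv (by rw [randIter_succ, randIter_succ, he])
    have hinj2 : InjOn (F (w n)) (randIter F w n '' E) := by
      rintro _ ⟨u, hu, rfl⟩ _ ⟨v, hv, rfl⟩ he
      rw [hinj hu hv he]
    have hmeas : MeasurableSet (randIter F w n '' E) :=
      hE.image_of_continuousOn_injOn (h.continuous_iter hw n).continuousOn hinj'
    obtain ⟨ih1, ih2⟩ := ih hinj' (fun i hi => hlow i (by omega)) (fun i hi => hup i (by omega))
    rw [hcomp, h.image _ (hw n) _ hmeas hinj2, Finset.prod_range_succ, Finset.prod_range_succ,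
      mul_comm _ (c n), mul_comm _ (C n), ENNReal.ofReal_mul (hc n), ENNReal.ofReal_mul (hC n),
      mul_assoc, mul_assoc]
    constructor
    · calc _ ≤ ENNReal.ofReal (c n) * μ (randIter F w n '' E) := by gcongr
        _ = ∫⁻ x in randIter F w n '' E, ENNReal.ofReal (c n) ∂μ := by simp
        _ ≤ _ := setLIntegral_mono' hmeas (by
          rintro _ ⟨u, hu, rfl⟩
          exact ENNReal.ofReal_le_ofReal (hlow n (by omega) u hu))
    · calc _ ≤ ∫⁻ x in randIter F w n '' E, ENNReal.ofReal (C n) ∂μ := setLIntegral_mono' hmeas (by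
          rintro _ ⟨u, hu, rfl⟩
          exact ENNReal.ofReal_le_ofReal (hup n (by omega) u hu))
        _ = ENNReal.ofReal (C n) * μ (randIter F w n '' E) := by simp
        _ ≤ _ := by gcongr

/-- At step `i` the Jacobian along an orbit from `E` differs from the one along the orbit of `x` by
a factor at most `exp (L * dd i)`. The product of these factors is bounded by `exp S`, and
injectivity comes for free because `E` lies in a dynamical ball. -/
lemma distortion (h : LocalControl μ F lam J N η ρ Λ Jm L) (hw : ∀ i, w i ∈ N) {E : Set X}
    (hE : MeasurableSet E) (x : X) (n : ℕ) (dd : ℕ → ℝ) (hdd : ∀ i ≤ n, dd i < ρ)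
    (hd : ∀ u ∈ E, ∀ i ≤ n, dist (randIter F w i u) (randIter F w i x) ≤ dd i) {S : ℝ}
    (hS : ∑ i ∈ Finset.range n, L * dd i ≤ S) :
    ENNReal.ofReal (Real.exp (-S) * ∏ i ∈ Finset.range n, J (w i) (randIter F w i x)) * μ E ≤
      μ (randIter F w n '' E) ∧
    μ (randIter F w n '' E) ≤
      ENNReal.ofReal (Real.exp S * ∏ i ∈ Finset.range n, J (w i) (randIter F w i x)) * μ E := by
  have hJ : ∀ i, 0 < J (w i) (randIter F w i x) := fun i => h.J_pos _ (hw i) _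
  have hP : 0 < ∏ i ∈ Finset.range n, J (w i) (randIter F w i x) :=
    Finset.prod_pos fun i _ => hJ i
  have hb : ∀ i ≤ n, ∀ u ∈ E, |Real.log (J (w i) (randIter F w i u)) -
      Real.log (J (w i) (randIter F w i x))| ≤ L * dd i := fun i hi u hu =>
    (h.logJ_lip _ (hw i) _ _ ((hd u hu i hi).trans_lt (hdd i hi))).trans
      (mul_le_mul_of_nonneg_left (hd u hu i hi) h.L_nonneg)
  have hinj : InjOn (randIter F w n) E := (h.injOn_dynBall hw x n).mono
    fun u hu i hi => (hd u hu i hi).trans_lt (hdd i hi)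
  obtain ⟨h1, h2⟩ := h.measure_image_iter hw hE
    (fun i => Real.exp (-(L * dd i)) * J (w i) (randIter F w i x))
    (fun i => Real.exp (L * dd i) * J (w i) (randIter F w i x))
    (fun i => mul_nonneg (Real.exp_pos _).le (hJ i).le)
    (fun i => mul_nonneg (Real.exp_pos _).le (hJ i).le) n hinj
    (fun i hi u hu => by
      have := (abs_le.1 (hb i hi.le u hu)).1
      rw [← Real.log_le_log_iff (mul_pos (Real.exp_pos _) (hJ i)) (h.J_pos _ (hw i) _),
        Real.log_mul (Real.exp_pos _).ne' (hJ i).ne', Real.log_exp]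
      linarith)
    (fun i hi u hu => by
      have := (abs_le.1 (hb i hi.le u hu)).2
      rw [← Real.log_le_log_iff (h.J_pos _ (hw i) _) (mul_pos (Real.exp_pos _) (hJ i)),
        Real.log_mul (Real.exp_pos _).ne' (hJ i).ne', Real.log_exp]
      linarith)
  rw [Finset.prod_mul_distrib, ← Real.exp_sum] at h1 h2
  constructor
  · refine le_trans ?_ h1
    gcongr
    rw [Finset.sum_neg_distrib]
    linarith
  · refine h2.trans ?_
    gcongr

/-- On a small neighbourhood the map is injective, so the integral of the positive Jacobian over the
local part of the preimage is the measure of a subset of `Z`, which is zero. -/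
lemma measure_preimage_null (h : LocalControl μ F lam J N η ρ Λ Jm L) {t : T} (ht : t ∈ N)
    {Z : Set X} (hZ : MeasurableSet Z) (hZ0 : μ Z = 0) : μ (F t ⁻¹' Z) = 0 := by
  refine measure_null_of_locally_null _ fun x _ => ?_
  set B : Set X := {u | dist u x < ρ} ∩ {u | dist (F t u) (F t x) < ρ}
  have hB : IsOpen B := (isOpen_lt (continuous_id.dist continuous_const) continuous_const).inter
    (isOpen_lt ((h.cont t ht).dist continuous_const) continuous_const)
  have hxB : x ∈ B := by simp [B, h.ρ_pos]
  have hinj : InjOn (F t) (F t ⁻¹' Z ∩ B) := by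
    intro u hu v hv he
    have := h.expand t ht x u v hu.2.1 hv.2.1 hu.2.2 hv.2.2
    rw [he, dist_self, mul_zero] at this
    exact dist_le_zero.1 this
  have hE : MeasurableSet (F t ⁻¹' Z ∩ B) :=
    ((h.cont t ht).measurable hZ).inter hB.measurableSet
  refine ⟨F t ⁻¹' Z ∩ B, inter_mem_nhdsWithin _ (hB.mem_nhds hxB), ?_⟩
  have h0 : μ (F t '' (F t ⁻¹' Z ∩ B)) = 0 :=
    measure_mono_null (by rintro _ ⟨u, hu, rfl⟩; exact hu.1) hZ0
  rw [h.image t ht _ hE hinj, lintegral_eq_zero_iff (by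
    exact (h.J_meas t ht).ennreal_ofReal)] at h0
  have : ∀ᵐ x ∂(μ.restrict (F t ⁻¹' Z ∩ B)), False := by
    filter_upwards [h0] with x hx
    have := h.J_pos t ht x
    simp at hx
    linarith
  simpa using this

lemma measure_preimage_iter_null (h : LocalControl μ F lam J N η ρ Λ Jm L) (hw : ∀ i, w i ∈ N) (n : ℕ) :
    ∀ {Z : Set X}, MeasurableSet Z → μ Z = 0 → μ (randIter F w n ⁻¹' Z) = 0 := by
  induction n with
  | zero => intro Z _ h0; exact h0
  | succ n ih =>
    intro Z hZ h0
    exact ih ((h.cont _ (hw n)).measurable hZ) (h.measure_preimage_null (hw n) hZ h0)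

end Measure

end LocalControl

/-! ### Hyperbolic times -/

/-- `n` is a hyperbolic time for the random orbit of `x`. -/
def HypTime {T X : Type*} (F : T → X → X) (lam : T → X → ℝ) (η : ℝ) (w : ℕ → T) (n : ℕ)
    (x : X) : Prop :=
  ∀ i < n, ∏ j ∈ Finset.Ico i n, lam (w j) (randIter F w j x) < Real.exp (-(2 * η * ((n : ℝ) - i)))

/-- The first time at which `S` drops below a lower bound of its values up to `N` is a strict record
after `N`. -/
lemma frequently_record_of_unbounded {S : ℕ → ℝ} (hS : ∀ b, ∃ n, S n < b) :
    ∃ᶠ n in atTop, ∀ i < n, S n < S i := by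
  rw [frequently_atTop]
  intro N
  obtain ⟨b, hb⟩ : ∃ b, ∀ i ≤ N, b ≤ S i := by
    obtain ⟨b, hb⟩ := ((Finset.range (N + 1)).image S).bddBelow
    exact ⟨b, fun i hi => hb (by simpa using ⟨i, by omega, rfl⟩)⟩
  classical
  have hex := hS b
  refine ⟨Nat.find hex, ?_, fun i hi => ?_⟩
  · by_contra hlt
    exact absurd (Nat.find_spec hex) (not_lt.2 (hb _ (by omega)))
  · exact (Nat.find_spec hex).trans_le (not_lt.1 (Nat.find_min hex hi))

/-- An average below `-4η` makes the sums `S n` of `log lam + 2η` less than `-2ηn`, so they are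
unbounded below. A strict record `n` satisfies `S n < S i` for all `i < n`, which is the
hyperbolicity condition in logarithmic form. Infinitely many times suffice here; no positive
frequency, as in Pliss' lemma, is required. -/
lemma frequently_hypTime {T X : Type*} {F : T → X → X} {lam : T → X → ℝ} {η a : ℝ} {w : ℕ → T}
    {x : X} (hη : 0 < η) (ha : a = 4 * η)
    (hpos : ∀ j, 0 < lam (w j) (randIter F w j x))
    (hfreq : ∃ᶠ n : ℕ in atTop,
      (1 / (n : ℝ)) * ∑ j ∈ Finset.range n, Real.log (lam (w j) (randIter F w j x)) < -a) :
    ∃ᶠ n in atTop, HypTime F lam η w n x := by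
  set S : ℕ → ℝ := fun n =>
    ∑ j ∈ Finset.range n, (Real.log (lam (w j) (randIter F w j x)) + 2 * η) with hSdef
  have hS : ∀ b, ∃ n, S n < b := by
    intro b
    obtain ⟨n, hn, hlt⟩ := (frequently_atTop.1 hfreq) (max 1 ⌈(-b) / (2 * η)⌉₊)
    have hn1 : 1 ≤ n := le_trans (le_max_left _ _) hn
    have hn0 : (0 : ℝ) < n := by exact_mod_cast hn1
    have hnb : (-b) / (2 * η) ≤ n :=
      (Nat.le_ceil _).trans (by exact_mod_cast le_trans (le_max_right _ _) hn)
    rw [div_le_iff₀ (by positivity)] at hnb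
    refine ⟨n, ?_⟩
    rw [one_div, inv_mul_lt_iff₀ hn0] at hlt
    simp only [hSdef, Finset.sum_add_distrib, Finset.sum_const, Finset.card_range, nsmul_eq_mul]
    subst ha
    linarith
  refine (frequently_record_of_unbounded hS).mono fun n hn i hi => ?_
  have h1 := hn i hi
  have h2 : S n - S i = ∑ j ∈ Finset.Ico i n,
      (Real.log (lam (w j) (randIter F w j x)) + 2 * η) := (Finset.sum_Ico_eq_sub _ hi.le).symm
  have h3 : ∑ j ∈ Finset.Ico i n, Real.log (lam (w j) (randIter F w j x)) <
      -(2 * η * ((n : ℝ) - i)) := by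
    rw [Finset.sum_add_distrib, Finset.sum_const, Nat.card_Ico, nsmul_eq_mul,
      Nat.cast_sub hi.le] at h2
    linarith
  rw [← Real.log_prod (fun j _ => (hpos j).ne')] at h3
  rwa [← Real.log_lt_iff_lt_exp (Finset.prod_pos fun j _ => hpos j)]

lemma sum_pow_reflect_le {σ : ℝ} (h0 : 0 ≤ σ) (h1 : σ < 1) (n : ℕ) :
    ∑ i ∈ Finset.range n, σ ^ (n - i) ≤ 1 / (1 - σ) := by
  have h2 : ∑ i ∈ Finset.range n, σ ^ (n - i) = ∑ i ∈ Finset.range n, σ ^ (i + 1) := by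
    rw [← Finset.sum_range_reflect]
    refine Finset.sum_congr rfl fun i hi => ?_
    rw [Finset.mem_range] at hi
    congr 1; omega
  rw [h2]
  calc _ ≤ ∑ i ∈ Finset.range n, σ ^ i := Finset.sum_le_sum fun i _ =>
        pow_le_pow_of_le_one h0 h1.le (Nat.le_succ i)
    _ ≤ ∑' i, σ ^ i := (summable_geometric_of_lt_one h0 h1).sum_le_tsum _ (fun i _ => by positivity)
    _ = 1 / (1 - σ) := by rw [tsum_geometric_of_lt_one h0 h1, one_div]

/-! ### Greedy selection -/

/-- Greedy choice, along a well-order, of a family of essentially disjoint sections. -/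
noncomputable def greedyChoice {Ω X ι : Type*} [MeasurableSpace X] [LinearOrder ι]
    [WellFoundedLT ι] (μ : Measure X) (C : ι → Set (Ω × X)) : ι → Set Ω :=
  WellFounded.fix (wellFounded_lt (α := ι)) fun i ih =>
    {w | ∀ i' (h : i' < i), w ∈ ih i' h → μ (Prod.mk w ⁻¹' (C i' ∩ C i)) = 0}

section Greedy

variable {Ω X ι : Type*} [MeasurableSpace X] [LinearOrder ι] [WellFoundedLT ι]

lemma mem_greedyChoice {μ : Measure X} {C : ι → Set (Ω × X)} {i : ι} {w : Ω} :
    w ∈ greedyChoice μ C i ↔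
      ∀ i' < i, w ∈ greedyChoice μ C i' → μ (Prod.mk w ⁻¹' (C i' ∩ C i)) = 0 := by
  unfold greedyChoice
  rw [WellFounded.fix_eq]
  rfl

/-- This is why the selection asks for null and not for empty intersections: the measure of the
section of a measurable set depends measurably on `w`, whereas nonemptiness of a section is a
projection. -/
lemma measurableSet_greedyChoice [MeasurableSpace Ω] [Countable ι] {μ : Measure X} [SFinite μ]
    {C : ι → Set (Ω × X)} (hC : ∀ i, MeasurableSet (C i)) (i : ι) :
    MeasurableSet (greedyChoice μ C i) := by
  induction i using WellFoundedLT.induction with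
  | ind i ih =>
    have : greedyChoice μ C i = ⋂ i', ⋂ (_ : i' < i),
        ((greedyChoice μ C i')ᶜ ∪ {w | μ (Prod.mk w ⁻¹' (C i' ∩ C i)) = 0}) := by
      ext w
      rw [mem_greedyChoice]
      simp only [mem_iInter, mem_union, mem_compl_iff, mem_ofPred_eq]
      exact forall_congr' fun i' => forall_congr' fun _ => by tauto
    rw [this]
    refine MeasurableSet.iInter fun i' => MeasurableSet.iInter fun hi' => (ih i' hi').compl.union ?_
    exact measurable_measure_prodMk_left ((hC i').inter (hC i)) (measurableSet_singleton 0)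

/-- Nothing is lost by working with null intersections: the sections are open and nonempty open sets
have positive measure. -/
lemma disjoint_of_mem_greedyChoice {μ : Measure X} {C : ι → Set (Ω × X)} [TopologicalSpace X]
    [μ.IsOpenPosMeasure] {w : Ω} (hopen : ∀ i, IsOpen (Prod.mk w ⁻¹' C i)) {i j : ι} (hij : i ≠ j)
    (hi : w ∈ greedyChoice μ C i) (hj : w ∈ greedyChoice μ C j) :
    Disjoint (Prod.mk w ⁻¹' C i) (Prod.mk w ⁻¹' C j) := by
  wlog hlt : i < j generalizing i j
  · exact (this hij.symm hj hi (lt_of_le_of_ne (not_lt.1 hlt) hij.symm)).symm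
  have := mem_greedyChoice.1 hj i hlt hi
  rw [preimage_inter, ((hopen i).inter (hopen j)).measure_eq_zero_iff μ] at this
  exact disjoint_iff_inter_eq_empty.2 this

/-- Maximality of the selection. The bound `i' ≤ i` matters: with the time as leading coordinate of
the index, the selected candidate has no later time. -/
lemma exists_le_mem_greedyChoice {μ : Measure X} {C : ι → Set (Ω × X)} {w : Ω} {i : ι}
    (hne : (Prod.mk w ⁻¹' C i).Nonempty) :
    ∃ i' ≤ i, w ∈ greedyChoice μ C i' ∧ ((Prod.mk w ⁻¹' C i') ∩ (Prod.mk w ⁻¹' C i)).Nonempty := by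
  by_cases hi : w ∈ greedyChoice μ C i
  · exact ⟨i, le_rfl, hi, by rwa [inter_self]⟩
  · rw [mem_greedyChoice] at hi
    push Not at hi
    obtain ⟨i', hlt, hmem, h0⟩ := hi
    refine ⟨i', hlt.le, hmem, ?_⟩
    rw [← preimage_inter]
    exact nonempty_of_measure_ne_zero h0

end Greedy

/-! ### Covering by hyperbolic preimages -/

/-- The part of the preimage of `W` under the `n`-th random iterate which follows the orbit
of `q`. -/
def shadowPreimage {T X : Type*} [MetricSpace X] (F : T → X → X) (ρ : ℝ) (w : ℕ → T) (n : ℕ)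
    (q : X) (W : Set X) : Set X :=
  {u | (∀ i < n, dist (randIter F w i u) (randIter F w i q) < ρ) ∧ randIter F w n u ∈ W}

namespace LocalControl

variable {T X : Type*} [MetricSpace X] [MeasurableSpace X] {μ : Measure X}
  {F : T → X → X} {lam J : T → X → ℝ} {N : Set T} {η ρ Λ Jm L : ℝ} {w : ℕ → T}

/-- The definition of a hyperbolic time provides the rate `2η`; the factors `exp η` from the inverse
branches use up one half of it. -/
lemma prod_le_of_hypTime {n : ℕ} {x : X}
    (hn : HypTime F lam η w n x) {i : ℕ} (hi : i ≤ n) :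
    ∏ j ∈ Finset.Ico i n, (Real.exp η * lam (w j) (randIter F w j x)) ≤
      Real.exp (-η) ^ (n - i) := by
  rcases hi.eq_or_lt with rfl | hlt
  · simp
  rw [Finset.prod_mul_distrib, Finset.prod_const, Nat.card_Ico]
  calc _ ≤ Real.exp η ^ (n - i) * Real.exp (-(2 * η * ((n : ℝ) - i))) := by
        gcongr; exact (hn i hlt).le
    _ = Real.exp (-η) ^ (n - i) := by
      rw [← Real.exp_nat_mul, ← Real.exp_nat_mul, ← Real.exp_add, Nat.cast_sub hi]
      congr 1; ring

lemma exp_neg_lt_one (h : LocalControl μ F lam J N η ρ Λ Jm L) : Real.exp (-η) < 1 :=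
  Real.exp_lt_one_iff.2 (by linarith [h.η_pos])

lemma dist_le_of_hypTime (h : LocalControl μ F lam J N η ρ Λ Jm L) (hw : ∀ i, w i ∈ N) {n : ℕ}
    {x u u' : X} (hn : HypTime F lam η w n x)
    (hu : ∀ i ≤ n, dist (randIter F w i u) (randIter F w i x) < ρ)
    (hu' : ∀ i ≤ n, dist (randIter F w i u') (randIter F w i x) < ρ) {i : ℕ} (hi : i ≤ n) :
    dist (randIter F w i u) (randIter F w i u') ≤
      Real.exp (-η) ^ (n - i) * dist (randIter F w n u) (randIter F w n u') :=
  (h.dist_iter_le hw hu hu' i hi).trans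
    (mul_le_mul_of_nonneg_right (prod_le_of_hypTime hn hi) dist_nonneg)

lemma self_close (h : LocalControl μ F lam J N η ρ Λ Jm L) (n : ℕ) (q : X) :
    ∀ i ≤ n, dist (randIter F w i q) (randIter F w i q) < ρ := fun i _ => by
  rw [dist_self]; exact h.ρ_pos

section Shadow

variable {n : ℕ} {q : X} {W : Set X} {s : ℝ}

lemma shadow_close (hs : s ≤ ρ)
    (hW : W ⊆ Metric.ball (randIter F w n q) s) {u : X} (hu : u ∈ shadowPreimage F ρ w n q W) :
    ∀ i ≤ n, dist (randIter F w i u) (randIter F w i q) < ρ := fun i hi => by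
  rcases hi.eq_or_lt with rfl | hlt
  · exact (Metric.mem_ball.1 (hW hu.2)).trans_le hs
  · exact hu.1 i hlt

lemma shadow_dist (h : LocalControl μ F lam J N η ρ Λ Jm L) (hw : ∀ i, w i ∈ N)
    (hn : HypTime F lam η w n q) (hs : s ≤ ρ)
    (hW : W ⊆ Metric.ball (randIter F w n q) s) {u : X} (hu : u ∈ shadowPreimage F ρ w n q W)
    {i : ℕ} (hi : i ≤ n) :
    dist (randIter F w i u) (randIter F w i q) ≤ Real.exp (-η) ^ (n - i) * s :=
  (h.dist_le_of_hypTime hw hn (shadow_close hs hW hu) (h.self_close n q) hi).trans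
    (mul_le_mul_of_nonneg_left (Metric.mem_ball.1 (hW hu.2)).le (by positivity))

/-- At a hyperbolic time all products along the orbit are at most one, so the inverse branch through
`q` is defined on all of `W`. -/
lemma shadow_image (h : LocalControl μ F lam J N η ρ Λ Jm L) (hw : ∀ i, w i ∈ N)
    (hn : HypTime F lam η w n q) (hs : s ≤ ρ) (hW : W ⊆ Metric.ball (randIter F w n q) s) :
    randIter F w n '' shadowPreimage F ρ w n q W = W := by
  refine Subset.antisymm (by rintro _ ⟨u, hu, rfl⟩; exact hu.2) fun y hy => ?_
  have hb : ∀ i ≤ n, (∏ j ∈ Finset.Ico i n, (Real.exp η * lam (w j) (randIter F w j q))) *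
      dist y (randIter F w n q) < ρ := fun i hi => by
    refine lt_of_le_of_lt ?_ ((Metric.mem_ball.1 (hW hy)).trans_le hs)
    refine mul_le_of_le_one_left dist_nonneg ((prod_le_of_hypTime hn hi).trans ?_)
    exact pow_le_one₀ (Real.exp_pos _).le h.exp_neg_lt_one.le
  obtain ⟨u, hu, hud⟩ := h.exists_branch hw q n y hb
  exact ⟨u, ⟨fun i hi => (hud i hi.le).trans_lt (hb i hi.le), by rwa [hu]⟩, hu⟩

lemma shadow_injOn (h : LocalControl μ F lam J N η ρ Λ Jm L) (hw : ∀ i, w i ∈ N)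
    (hs : s ≤ ρ) (hW : W ⊆ Metric.ball (randIter F w n q) s) :
    InjOn (randIter F w n) (shadowPreimage F ρ w n q W) :=
  (h.injOn_dynBall hw q n).mono fun _ hu => shadow_close hs hW hu

lemma isOpen_shadow (h : LocalControl μ F lam J N η ρ Λ Jm L) (hw : ∀ i, w i ∈ N)
    (hW : IsOpen W) : IsOpen (shadowPreimage F ρ w n q W) := by
  have : shadowPreimage F ρ w n q W =
      (⋂ i ∈ Finset.range n, {u | dist (randIter F w i u) (randIter F w i q) < ρ}) ∩
        randIter F w n ⁻¹' W := by
    ext u; simp [shadowPreimage]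
  rw [this]
  refine (isOpen_biInter_finset fun i _ => ?_).inter (hW.preimage (h.continuous_iter hw n))
  exact isOpen_lt ((h.continuous_iter hw i).dist continuous_const) continuous_const

variable [BorelSpace X] [CompactSpace X]

/-- The strict inequality `s < ρ` keeps limit points inside the `ρ`-neighbourhood of the orbit, so a
boundary point must be mapped to the boundary of `W`; preimages of null sets are null. -/
lemma measure_closure_shadow (h : LocalControl μ F lam J N η ρ Λ Jm L) (hw : ∀ i, w i ∈ N)
    (hn : HypTime F lam η w n q) (hs : s < ρ) (hs0 : 0 ≤ s) (hWo : IsOpen W)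
    (hW : W ⊆ Metric.ball (randIter F w n q) s) (hfr : μ (frontier W) = 0) :
    μ (closure (shadowPreimage F ρ w n q W) \ shadowPreimage F ρ w n q W) = 0 := by
  refine measure_mono_null ?_
    (h.measure_preimage_iter_null hw n isClosed_frontier.measurableSet hfr)
  rintro u ⟨hu, hu'⟩
  have hclose : ∀ i < n, dist (randIter F w i u) (randIter F w i q) < ρ := fun i hi => by
    have hc : IsClosed {v | dist (randIter F w i v) (randIter F w i q) ≤ s} :=
      isClosed_le ((h.continuous_iter hw i).dist continuous_const) continuous_const
    have : u ∈ {v | dist (randIter F w i v) (randIter F w i q) ≤ s} := by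
      refine (closure_minimal (fun v hv => ?_) hc) hu
      refine (h.shadow_dist hw hn hs.le hW hv hi.le).trans (mul_le_of_le_one_left hs0 ?_)
      exact pow_le_one₀ (Real.exp_pos _).le h.exp_neg_lt_one.le
    exact lt_of_le_of_lt this hs
  have h1 : randIter F w n u ∈ closure W :=
    map_mem_closure (h.continuous_iter hw n) hu fun v hv => hv.2
  rw [mem_preimage, hWo.frontier_eq]
  exact ⟨h1, fun hmem => hu' ⟨hclose, hmem⟩⟩

end Shadow

/-- The bound for the distortion at hyperbolic times. -/
lemma sum_le_of_hypTime (h : LocalControl μ F lam J N η ρ Λ Jm L) {s : ℝ} (hs : 0 ≤ s) (n : ℕ) :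
    ∑ i ∈ Finset.range n, L * (Real.exp (-η) ^ (n - i) * s) ≤ L * s / (1 - Real.exp (-η)) := by
  have h1 := sum_pow_reflect_le (Real.exp_pos (-η)).le h.exp_neg_lt_one n
  calc _ = L * s * ∑ i ∈ Finset.range n, Real.exp (-η) ^ (n - i) := by
        rw [Finset.mul_sum]; exact Finset.sum_congr rfl fun i _ => by ring
    _ ≤ L * s * (1 / (1 - Real.exp (-η))) :=
        mul_le_mul_of_nonneg_left h1 (mul_nonneg h.L_nonneg hs)
    _ = _ := by ring

section Covering

variable [BorelSpace X] [CompactSpace X] [IsFiniteMeasure μ]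

/-- Both sets follow the orbit of `q`, so their measures are distorted by the same product of
Jacobians, up to `exp (±S)`. The image of the dynamical ball has measure at most `μ univ`, that of
the hyperbolic preimage is `W`, of measure at least `c`; the product cancels. -/
lemma measure_dynBall_le (h : LocalControl μ F lam J N η ρ Λ Jm L) (hw : ∀ i, w i ∈ N)
    {n : ℕ} {q : X} {W : Set X} {s : ℝ} (hs : s ≤ ρ / 2) (hn : HypTime F lam η w n q)
    (hWo : IsOpen W) (hW : W ⊆ Metric.ball (randIter F w n q) s) {c : ℝ≥0∞} (hc : c ≤ μ W) :
    μ {u | ∀ i ≤ n, dist (randIter F w i u) (randIter F w i q) < ρ / 2} * c ≤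
      ENNReal.ofReal (Real.exp (2 * (L * (ρ / 2) / (1 - Real.exp (-η))))) * μ univ *
        μ (shadowPreimage F ρ w n q W) := by
  have hρ := h.ρ_pos
  set S := L * (ρ / 2) / (1 - Real.exp (-η))
  set V := {u | ∀ i ≤ n, dist (randIter F w i u) (randIter F w i q) < ρ / 2}
  set P := ∏ i ∈ Finset.range n, J (w i) (randIter F w i q)
  have hP : 0 < P := Finset.prod_pos fun i _ => h.J_pos _ (hw i) _
  have hS : ∑ i ∈ Finset.range n, L * (Real.exp (-η) ^ (n - i) * (ρ / 2)) ≤ S :=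
    h.sum_le_of_hypTime (by positivity) n
  have hdd : ∀ i ≤ n, Real.exp (-η) ^ (n - i) * (ρ / 2) < ρ := fun i _ => by
    have : Real.exp (-η) ^ (n - i) ≤ 1 := pow_le_one₀ (Real.exp_pos _).le h.exp_neg_lt_one.le
    nlinarith
  have h1 := (h.distortion hw (h.isOpen_dynBall hw q n (ρ / 2)).measurableSet q n _ hdd
    (fun u hu i hi => (h.dist_le_of_hypTime hw hn (fun j hj => (hu j hj).trans (by linarith))
      (h.self_close n q) hi).trans (mul_le_mul_of_nonneg_left (hu n le_rfl).le (by positivity)))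
    hS).1
  have h2 := (h.distortion hw (h.isOpen_shadow (n := n) (q := q) hw hWo).measurableSet q n _ hdd
    (fun u hu i hi => (h.shadow_dist hw hn (by linarith) hW hu hi).trans
      (mul_le_mul_of_nonneg_left hs (by positivity))) hS).2
  rw [h.shadow_image hw hn (by linarith) hW] at h2
  have h3 : ENNReal.ofReal (Real.exp (-S) * P) * (μ V * c) ≤ ENNReal.ofReal (Real.exp (-S) * P) *
      (ENNReal.ofReal (Real.exp (2 * S)) * μ univ * μ (shadowPreimage F ρ w n q W)) := by
    calc _ = (ENNReal.ofReal (Real.exp (-S) * P) * μ V) * c := by ring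
      _ ≤ μ univ * (ENNReal.ofReal (Real.exp S * P) * μ (shadowPreimage F ρ w n q W)) := by
        gcongr
        · exact h1.trans (measure_mono (subset_univ _))
        · exact hc.trans h2
      _ = _ := by
        have : Real.exp S * P = Real.exp (-S) * P * Real.exp (2 * S) := by
          have : Real.exp S = Real.exp (-S) * Real.exp (2 * S) := by
            rw [← Real.exp_add]; congr 1; ring
          rw [this]; ring
        rw [this, ENNReal.ofReal_mul (by positivity)]
        ring
  exact (ENNReal.mul_le_mul_iff_right (by simpa using by positivity) ENNReal.ofReal_ne_top).1 h3

/-- A disjoint family of hyperbolic preimages which meets all later ones covers almost every point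
with infinitely many hyperbolic times. -/
theorem ae_mem_of_greedy (h : LocalControl μ F lam J N η ρ Λ Jm L) (hw : ∀ i, w i ∈ N)
    {δ : ℝ} (hδ0 : 0 < δ) (hδ : 12 * δ ≤ ρ) {ι : Type*} [Countable ι] {τ : ι → ℕ} {q : ι → X}
    {W : ι → Set X} {S : Set ι} {c : ℝ≥0∞} (hc : c ≠ 0)
    (hhyp : ∀ i ∈ S, HypTime F lam η w (τ i) (q i)) (hWo : ∀ i ∈ S, IsOpen (W i))
    (hW : ∀ i ∈ S, W i ⊆ Metric.ball (randIter F w (τ i) (q i)) (2 * δ))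
    (hWc : ∀ i ∈ S, c ≤ μ (W i)) (hfr : ∀ i ∈ S, μ (frontier (W i)) = 0)
    (hdisj : S.PairwiseDisjoint fun i => shadowPreimage F ρ w (τ i) (q i) (W i))
    {A : Set X}
    (hA : ∀ᵐ x ∂μ, x ∈ A → ∃ᶠ n in atTop, ∃ q' W', HypTime F lam η w n q' ∧
      W' ⊆ Metric.ball (randIter F w n q') (2 * δ) ∧
      (∀ l ≤ n, dist (randIter F w l x) (randIter F w l q') < δ) ∧
      ∃ i ∈ S, τ i ≤ n ∧ (shadowPreimage F ρ w (τ i) (q i) (W i) ∩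
        shadowPreimage F ρ w n q' W').Nonempty) :
    ∀ᵐ x ∂μ, x ∈ A → ∃ i ∈ S, x ∈ shadowPreimage F ρ w (τ i) (q i) (W i) := by
  set U : ι → Set X := fun i => shadowPreimage F ρ w (τ i) (q i) (W i) with hU
  set V : S → Set X := fun i =>
    {u | ∀ l ≤ τ i, dist (randIter F w l u) (randIter F w l (q i)) < ρ / 2} with hV
  have hUo : ∀ i ∈ S, IsOpen (U i) := fun i hi => h.isOpen_shadow hw (hWo i hi)
  -- Input for Borel-Cantelli: the dynamical balls `V i` overlap, but each is controlled by `U i`,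
  -- and the `U i` are disjoint in a space of finite measure.
  have hsum : ∑' i : S, μ (V i) ≠ ⊤ := by
    have hcle : ∀ i : S, μ (V i) ≤ ENNReal.ofReal
        (Real.exp (2 * (L * (ρ / 2) / (1 - Real.exp (-η))))) * μ univ / c * μ (U i) := fun i => by
      have hctop : c ≠ ⊤ := ((hWc i i.2).trans_lt (measure_lt_top _ _)).ne
      have := h.measure_dynBall_le hw (by linarith) (hhyp i i.2) (hWo i i.2) (hW i i.2)
        (hWc i i.2)
      rw [← ENNReal.le_div_iff_mul_le (Or.inl hc) (Or.inl hctop)] at this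
      refine this.trans_eq ?_
      simp only [div_eq_mul_inv, hU]
      ring
    refine ne_top_of_le_ne_top ?_ (ENNReal.tsum_le_tsum hcle)
    rw [ENNReal.tsum_mul_left]
    refine ENNReal.mul_ne_top (ENNReal.div_ne_top (ENNReal.mul_ne_top ENNReal.ofReal_ne_top
      (measure_ne_top _ _)) hc) ?_
    have hpd : Pairwise (Function.onFun Disjoint fun i : S => U i) := fun i j hij =>
      hdisj i.2 j.2 (by simpa [Subtype.ext_iff] using hij)
    rw [← measure_iUnion hpd (fun i => (hUo i i.2).measurableSet)]
    exact measure_ne_top _ _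
  have hbd : ∀ᵐ x ∂μ, ∀ i : S, x ∉ closure (U i) \ U i := by
    rw [ae_all_iff]
    intro i
    exact measure_eq_zero_iff_ae_notMem.1 (h.measure_closure_shadow hw (hhyp i i.2) (by linarith)
      (by linarith) (hWo i i.2) (hW i i.2) (hfr i i.2))
  filter_upwards [hA, ae_finite_setOfPred_mem hsum, hbd] with x hx hfin hb hxA
  -- A common point `u` of the two preimages follows `x` up to time `n` within `3δ` and follows `q
  -- i` up to time `τ i ≤ n` within `2δ`. Hence `x` follows `q i` within `5δ < ρ / 2`, which puts it
  -- in `V i`, while `u` is exponentially close to `x` at time zero.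
  have key : ∃ᶠ n in atTop, ∃ i ∈ {i : S | x ∈ V i},
      ∃ u ∈ U i, dist u x ≤ Real.exp (-η) ^ n * (3 * δ) := by
    refine (hx hxA).mono ?_
    rintro n ⟨q', W', hn, hW', hxq, i, hi, hin, u, hu, hu'⟩
    have hclose : ∀ l ≤ n, dist (randIter F w l u) (randIter F w l x) ≤
        Real.exp (-η) ^ (n - l) * (3 * δ) := fun l hl => by
      have h1 := h.shadow_dist hw hn (by linarith) hW' hu' hl
      have h2 := h.dist_le_of_hypTime hw hn (fun j hj => (hxq j hj).trans (by linarith))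
        (h.self_close n q') hl
      have h3 := mul_le_mul_of_nonneg_left (hxq n le_rfl).le
        (pow_nonneg (Real.exp_pos (-η)).le (n - l))
      have h4 := dist_triangle_right (randIter F w l u) (randIter F w l x) (randIter F w l q')
      linarith
    refine ⟨⟨i, hi⟩, fun l hl => ?_, u, hu, by simpa [randIter] using hclose 0 (Nat.zero_le _)⟩
    have h1 := hclose l (hl.trans hin)
    have h2 := h.shadow_dist hw (hhyp i hi) (by linarith) (hW i hi) hu hl
    have h3 : Real.exp (-η) ^ (n - l) ≤ 1 := pow_le_one₀ (Real.exp_pos _).le h.exp_neg_lt_one.le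
    have h4 : Real.exp (-η) ^ (τ i - l) ≤ 1 := pow_le_one₀ (Real.exp_pos _).le h.exp_neg_lt_one.le
    have h5 := dist_triangle_left (randIter F w l x) (randIter F w l (q i)) (randIter F w l u)
    have h6 : Real.exp (-η) ^ (n - l) * (3 * δ) ≤ 3 * δ := mul_le_of_le_one_left (by linarith) h3
    have h7 : Real.exp (-η) ^ (τ i - l) * (2 * δ) ≤ 2 * δ := mul_le_of_le_one_left (by linarith) h4
    rw [dist_comm (randIter F w l u)] at h1
    rw [dist_comm (randIter F w l u) (randIter F w l x)] at h5
    linarith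
  -- Pigeonhole: only finitely many `V i` contain `x`, so a single `i` occurs for infinitely many
  -- `n`.
  obtain ⟨i, hi⟩ : ∃ i : S, ∃ᶠ n in atTop,
      ∃ u ∈ U i, dist u x ≤ Real.exp (-η) ^ n * (3 * δ) := by
    by_contra hcon
    push Not at hcon
    refine key ?_
    have hev : ∀ i ∈ {i : S | x ∈ V i}, ∀ᶠ n in atTop,
        ¬ ∃ u ∈ U i, dist u x ≤ Real.exp (-η) ^ n * (3 * δ) := fun i _ => by
      simpa using hcon i
    filter_upwards [(eventually_all_finite hfin).2 hev] with n hn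
    rintro ⟨i, hi, hu⟩
    exact hn i hi hu
  have hcl : x ∈ closure (U i) := by
    rw [Metric.mem_closure_iff]
    intro e he
    have ht : Tendsto (fun n : ℕ => Real.exp (-η) ^ n * (3 * δ)) atTop (𝓝 0) := by
      simpa using (tendsto_pow_atTop_nhds_zero_of_lt_one (Real.exp_pos _).le
        h.exp_neg_lt_one).mul_const (3 * δ)
    obtain ⟨n, ⟨u, hu, hux⟩, hn⟩ := (hi.and_eventually (ht.eventually_lt_const he)).exists
    exact ⟨u, hu, by rw [dist_comm]; exact hux.trans_lt hn⟩
  exact ⟨i, i.2, by_contra fun hn => hb i ⟨hcl, hn⟩⟩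

end Covering

end LocalControl

/-- The candidates, indexed by `i`, for the domains of full branches: hyperbolic preimages, at the
hyperbolic time `τ i` of the point `q i`, of the set `W w (τ i) (k i)`. -/
def candidate {T X ι κ : Type*} [MetricSpace X] (F : T → X → X) (lam : T → X → ℝ) (N : Set T)
    (η ρ δ : ℝ) (O : Set X) (n₀ : ℕ) (τ : ι → ℕ) (q : ι → X) (k : ι → κ) (B : κ → Set X)
    (W : (ℕ → T) → ℕ → κ → Set X) (i : ι) : Set ((ℕ → T) × X) :=
  {p | ((∀ l, p.1 l ∈ N) ∧ n₀ ≤ τ i ∧ Metric.closedBall (q i) (2 * δ * Real.exp (-η) ^ τ i) ⊆ O ∧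
    HypTime F lam η p.1 (τ i) (q i) ∧ randIter F p.1 (τ i) (q i) ∈ B (k i)) ∧
    p.2 ∈ shadowPreimage F ρ p.1 (τ i) (q i) (W p.1 (τ i) (k i))}

namespace LocalControl

variable {T X : Type*} [MetricSpace X] [MeasurableSpace X] {μ : Measure X}
  {F : T → X → X} {lam J : T → X → ℝ} {N : Set T} {η ρ Λ Jm L : ℝ} {w : ℕ → T}
  {ι κ : Type*} {δ : ℝ} {O : Set X} {n₀ : ℕ}
  {τ : ι → ℕ} {q : ι → X} {k : ι → κ} {B : κ → Set X} {W : (ℕ → T) → ℕ → κ → Set X}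

lemma isOpen_hypTime (h : LocalControl μ F lam J N η ρ Λ Jm L) (hw : ∀ i, w i ∈ N) (n : ℕ) :
    IsOpen {x | HypTime F lam η w n x} := by
  have : {x | HypTime F lam η w n x} = ⋂ i ∈ Finset.range n,
      {x | ∏ j ∈ Finset.Ico i n, lam (w j) (randIter F w j x) <
        Real.exp (-(2 * η * ((n : ℝ) - i)))} := by
    ext x; simp [HypTime]
  rw [this]
  refine isOpen_biInter_finset fun i _ => isOpen_lt ?_ continuous_const
  exact continuous_finsetProd _ fun j _ =>
    (h.lam_cont _ (hw j)).comp (h.continuous_iter hw j)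

lemma isOpen_candidate_section (h : LocalControl μ F lam J N η ρ Λ Jm L)
    (hWo : ∀ w, (∀ l, w l ∈ N) → ∀ n j, IsOpen (W w n j)) (w : ℕ → T) (i : ι) :
    IsOpen (Prod.mk w ⁻¹' candidate F lam N η ρ δ O n₀ τ q k B W i) := by
  by_cases hadm : (∀ l, w l ∈ N) ∧ n₀ ≤ τ i ∧
      Metric.closedBall (q i) (2 * δ * Real.exp (-η) ^ τ i) ⊆ O ∧
      HypTime F lam η w (τ i) (q i) ∧ randIter F w (τ i) (q i) ∈ B (k i)
  · have : Prod.mk w ⁻¹' candidate F lam N η ρ δ O n₀ τ q k B W i =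
        shadowPreimage F ρ w (τ i) (q i) (W w (τ i) (k i)) := by
      ext x; simp only [candidate, mem_preimage, mem_ofPred_eq, and_iff_right hadm]
    rw [this]
    exact h.isOpen_shadow hadm.1 (hWo w hadm.1 _ _)
  · have : Prod.mk w ⁻¹' candidate F lam N η ρ δ O n₀ τ q k B W i = ∅ := by
      ext x; simp only [candidate, mem_preimage, mem_ofPred_eq, mem_empty_iff_false, iff_false]
      exact fun hx => hadm hx.1
    rw [this]
    exact isOpen_empty

variable [BorelSpace X] [CompactSpace X] [IsFiniteMeasure μ]
  [LinearOrder ι] [WellFoundedLT ι] [Countable ι]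

/-- The greedily chosen candidates cover almost every point with infinitely many hyperbolic
times. -/
theorem ae_mem_candidate [μ.IsOpenPosMeasure] (h : LocalControl μ F lam J N η ρ Λ Jm L)
    (hδ0 : 0 < δ) (hδ : 12 * δ ≤ ρ) (hO : IsOpen O) (hτ : Monotone τ)
    (hq : ∀ n j x, ∀ e > 0, ∃ i, τ i = n ∧ k i = j ∧ dist (q i) x < e)
    (hBo : ∀ j, IsOpen (B j)) (hBd : ∀ j, ∀ x ∈ B j, ∀ y ∈ B j, dist x y < 2 * δ)
    (hWo : ∀ w, (∀ l, w l ∈ N) → ∀ n j, IsOpen (W w n j))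
    (hw : ∀ i, w i ∈ N) (hWB : ∀ n j, W w n j ⊆ B j) {c : ℝ≥0∞}
    (hc : c ≠ 0) (hWc : ∀ n j, c ≤ μ (W w n j)) (hfr : ∀ n j, μ (frontier (W w n j)) = 0)
    {A : Set X} (hA : ∀ᵐ x ∂μ, x ∈ A → x ∈ O ∧
      ∃ᶠ n in atTop, HypTime F lam η w n x ∧ ∃ j, randIter F w n x ∈ B j) :
    ∀ᵐ x ∂μ, x ∈ A → ∃ i,
      w ∈ greedyChoice μ (candidate F lam N η ρ δ O n₀ τ q k B W) i ∧
      (w, x) ∈ candidate F lam N η ρ δ O n₀ τ q k B W i := by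
  set C := candidate F lam N η ρ δ O n₀ τ q k B W with hC
  set S : Set ι := {i | w ∈ greedyChoice μ C i ∧ (Prod.mk w ⁻¹' C i).Nonempty} with hS
  have hsec : ∀ i, (Prod.mk w ⁻¹' C i).Nonempty →
      Prod.mk w ⁻¹' C i = shadowPreimage F ρ w (τ i) (q i) (W w (τ i) (k i)) := by
    rintro i ⟨x, hx⟩
    ext y
    exact ⟨fun hy => hy.2, fun hy => ⟨hx.1, hy⟩⟩
  have hball : ∀ i, (Prod.mk w ⁻¹' C i).Nonempty →
      W w (τ i) (k i) ⊆ Metric.ball (randIter F w (τ i) (q i)) (2 * δ) := by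
    rintro i ⟨x, hx⟩ y hy
    exact hBd _ _ (hWB _ _ hy) _ hx.1.2.2.2.2
  have main := h.ae_mem_of_greedy (S := S) (τ := τ) (q := q) (W := fun i => W w (τ i) (k i))
    (c := c) (A := A) hw hδ0 hδ hc (fun i hi => by obtain ⟨x, hx⟩ := hi.2; exact hx.1.2.2.2.1)
    (fun i _ => hWo w hw _ _) (fun i hi => hball i hi.2) (fun i _ => hWc _ _) (fun i _ => hfr _ _)
    (fun i hi j hj hij => by
      have := disjoint_of_mem_greedyChoice (fun i => h.isOpen_candidate_section hWo w i) hij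
        hi.1 hj.1
      rwa [hsec i hi.2, hsec j hj.2] at this) ?_
  · filter_upwards [main] with x hx hxA
    obtain ⟨i, hi, hxi⟩ := hx hxA
    refine ⟨i, hi.1, ?_⟩
    rw [← hsec i hi.2] at hxi
    exact hxi
  filter_upwards [hA] with x hx hxA
  obtain ⟨hxO, hfreq⟩ := hx hxA
  -- The radius `3δ` leaves room for replacing `x` by a point `q i` at distance less than `δ * exp
  -- (-η) ^ n`, around which a ball with factor `2δ` is required.
  have hsmall : ∀ᶠ n in atTop, Metric.closedBall x (3 * δ * Real.exp (-η) ^ n) ⊆ O := by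
    obtain ⟨e, he, heO⟩ := Metric.isOpen_iff.1 hO x hxO
    have ht : Tendsto (fun n : ℕ => 3 * δ * Real.exp (-η) ^ n) atTop (𝓝 0) := by
      simpa using (tendsto_pow_atTop_nhds_zero_of_lt_one (Real.exp_pos _).le
        h.exp_neg_lt_one).const_mul (3 * δ)
    filter_upwards [ht.eventually_lt_const he] with n hn
    exact (Metric.closedBall_subset_ball hn).trans heO
  refine (hfreq.and_eventually (hsmall.and (eventually_ge_atTop n₀))).mono ?_
  rintro n ⟨⟨hn, j, hj⟩, hO', hn₀⟩
  -- All requirements on the centre of a candidate are open conditions, so they pass from `x` to a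
  -- nearby member of the countable dense family.
  have hnhds : {y | HypTime F lam η w n y} ∩ (randIter F w n ⁻¹' B j) ∩
      {y | ∀ l ≤ n, dist (randIter F w l y) (randIter F w l x) < δ} ∈ 𝓝 x := by
    refine (((h.isOpen_hypTime hw n).inter ((hBo j).preimage (h.continuous_iter hw n))).inter
      (h.isOpen_dynBall hw x n δ)).mem_nhds ⟨⟨hn, hj⟩, fun l _ => ?_⟩
    rw [dist_self]; exact hδ0
  obtain ⟨e, he, hsub⟩ := Metric.mem_nhds_iff.1 hnhds
  obtain ⟨i, rfl, rfl, hi⟩ := hq n j x (min e (δ * Real.exp (-η) ^ n)) (by positivity)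
  obtain ⟨⟨h1, h2⟩, h3⟩ := hsub (hi.trans_le (min_le_left _ _))
  have hadm : (∀ l, w l ∈ N) ∧ n₀ ≤ τ i ∧
      Metric.closedBall (q i) (2 * δ * Real.exp (-η) ^ τ i) ⊆ O ∧
      HypTime F lam η w (τ i) (q i) ∧ randIter F w (τ i) (q i) ∈ B (k i) := by
    refine ⟨hw, hn₀, fun y hy => hO' ?_, h1, h2⟩
    have h4 := hi.trans_le (min_le_right _ _)
    have h5 := dist_triangle y (q i) x
    rw [Metric.mem_closedBall] at hy ⊢
    linarith
  have hb : W w (τ i) (k i) ⊆ Metric.ball (randIter F w (τ i) (q i)) (2 * δ) := fun y hy =>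
    hBd _ _ (hWB _ _ hy) _ h2
  have hne : (Prod.mk w ⁻¹' C i).Nonempty := by
    have : (W w (τ i) (k i)).Nonempty :=
      nonempty_of_measure_ne_zero (ne_of_gt (hc.bot_lt.trans_le (hWc _ _)))
    rw [← h.shadow_image hw h1 (by linarith) hb] at this
    obtain ⟨u, hu⟩ := this.of_image
    exact ⟨u, hadm, hu⟩
  obtain ⟨i', hi', hmem, hinter⟩ := exists_le_mem_greedyChoice (μ := μ) hne
  refine ⟨q i, W w (τ i) (k i), h1, hb, fun l hl => by rw [dist_comm]; exact h3 l hl, i',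
    ⟨hmem, hinter.left⟩, hτ hi', ?_⟩
  rwa [hsec i hne, hsec i' hinter.left] at hinter

end LocalControl

/-! ### Well-ordered countable index set and finite covers by balls with null boundary -/

section Index

/-- The lexicographic order puts the time first, so all the infinitely many candidates of one time
precede those of later times. The order type is larger than that of `ℕ`, which is why the greedy
selection is defined by well-founded recursion. -/
lemma exists_lex_index {X : Type*} [MetricSpace X] [CompactSpace X] [Nonempty X] (m : ℕ) :
    ∃ q : ℕ ×ₗ ℕ ×ₗ Fin m → X,
      ∀ (n : ℕ) (j : Fin m) (x : X), ∀ e > 0, ∃ i : ℕ ×ₗ ℕ ×ₗ Fin m,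
        (ofLex i).1 = n ∧ (ofLex (ofLex i).2).2 = j ∧ dist (q i) x < e := by
  refine ⟨fun i => TopologicalSpace.denseSeq X (ofLex (ofLex i).2).1, fun n j x e he => ?_⟩
  obtain ⟨y, hy, l, rfl⟩ :=
    Metric.dense_iff.1 (TopologicalSpace.denseRange_denseSeq X) x e he
  exact ⟨toLex (n, toLex (l, j)), rfl, rfl, hy⟩

lemma monotone_lex_fst (m : ℕ) : Monotone fun i : ℕ ×ₗ ℕ ×ₗ Fin m => (ofLex i).1 :=
  fun i j hij => by
    rcases Prod.Lex.le_iff.1 hij with h | h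
    · exact h.le
    · exact h.1.le

instance countable_lex_index (m : ℕ) : Countable (ℕ ×ₗ ℕ ×ₗ Fin m) :=
  inferInstanceAs (Countable (ℕ × ℕ × Fin m))

end Index

lemma exists_finite_ball_cover {X : Type*} [MetricSpace X] [CompactSpace X] [MeasurableSpace X]
    [BorelSpace X] (μ : Measure X) [IsFiniteMeasure μ] {δ : ℝ} (hδ : 0 < δ) :
    ∃ (m : ℕ) (b : Fin m → X) (s : Fin m → ℝ), (∀ j, 0 < s j ∧ s j < δ) ∧
      (∀ x, ∃ j, x ∈ Metric.ball (b j) (s j)) ∧ ∀ j, μ (frontier (Metric.ball (b j) (s j))) = 0 := by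
  -- Spheres of different radii around a point are disjoint, so only countably many of them can
  -- carry mass.
  have hex : ∀ x : X, ∃ r ∈ Ioo 0 δ, μ (frontier (Metric.ball x r)) = 0 := fun x => by
    simpa only [Metric.thickening_singleton] using exists_null_frontier_thickening μ {x} hδ
  choose r hr hfr using hex
  obtain ⟨t, ht⟩ := CompactSpace.elim_nhds_subcover (fun x => Metric.ball x (r x))
    fun x => Metric.ball_mem_nhds x (hr x).1
  refine ⟨t.card, fun j => t.equivFin.symm j, fun j => r (t.equivFin.symm j), fun j => hr _,
    fun x => ?_, fun j => hfr _⟩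
  have hx : x ∈ (⊤ : Set X) := mem_univ x
  rw [← ht, mem_iUnion₂] at hx
  obtain ⟨y, hy, hxy⟩ := hx
  exact ⟨t.equivFin ⟨y, hy⟩, by simpa using hxy⟩

namespace LocalControl

variable {T X : Type*} [MetricSpace X] [MeasurableSpace X] {μ : Measure X}
  {F : T → X → X} {lam J : T → X → ℝ} {N : Set T} {η ρ Λ Jm L : ℝ} {w : ℕ → T}

/-- A forward invariant set of positive measure whose points have infinitely many hyperbolic times
contains a ball up to a null set. -/
theorem exists_ball_diff_null [BorelSpace X] [CompactSpace X] [IsFiniteMeasure μ]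
    [μ.IsOpenPosMeasure] (h : LocalControl μ F lam J N η ρ Λ Jm L) (hw : ∀ i, w i ∈ N)
    {A : Set X} (hAm : MeasurableSet A) (hA0 : μ A ≠ 0)
    (hinv : ∀ᵐ x ∂μ, x ∈ A → ∀ n, randIter F w n x ∈ A)
    (hhyp : ∀ᵐ x ∂μ, x ∈ A → ∃ᶠ n in atTop, HypTime F lam η w n x) :
    ∃ (b : X) (s : ℝ), 0 < s ∧ μ (Metric.ball b s \ A) = 0 := by
  have hρ := h.ρ_pos
  set δ := ρ / 12 with hδ
  have hδ0 : 0 < δ := by positivity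
  obtain ⟨m, b, s, hs, hcov, hfr⟩ := exists_finite_ball_cover μ hδ0
  by_contra hcon
  push Not at hcon
  obtain ⟨x₀, hx₀⟩ : A.Nonempty := nonempty_of_measure_ne_zero hA0
  have : Nonempty X := ⟨x₀⟩
  obtain ⟨j₀, -⟩ := hcov x₀
  -- If no ball were contained in `A` up to a null set, the finitely many balls of the cover would
  -- all miss `A` by at least a fixed amount `e`.
  set e : ℝ≥0∞ := Finset.univ.inf fun j => μ (Metric.ball (b j) (s j) \ A) with he
  have he0 : 0 < e := by
    rw [he, Finset.lt_inf_iff (by simp)]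
    exact fun j _ => pos_iff_ne_zero.2 (hcon _ _ (hs j).1)
  set S := L * (ρ / 2) / (1 - Real.exp (-η)) with hS
  obtain ⟨θ, hθ0, hθ⟩ : ∃ θ : ℝ≥0∞, θ ≠ 0 ∧
      θ * (ENNReal.ofReal (Real.exp (2 * S)) * μ univ) < e := by
    have h1 : ENNReal.ofReal (Real.exp (2 * S)) * μ univ ≠ ⊤ :=
      ENNReal.mul_ne_top ENNReal.ofReal_ne_top (measure_ne_top _ _)
    obtain ⟨θ, hθ, h2⟩ := ENNReal.exists_pos_mul_lt h1 he0.ne'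
    exact ⟨θ, hθ.ne', h2⟩
  -- Outer regularity, together with the covering of `A` by preimages inside `O`, plays the role of
  -- a Lebesgue density theorem for hyperbolic preimages.
  obtain ⟨O, hAO, hO, hμO⟩ := A.exists_isOpen_le_add μ (ε := θ * μ A) (mul_ne_zero hθ0 hA0)
  have hOA : μ (O \ A) ≤ θ * μ A := by
    rw [measure_sdiff hAO hAm.nullMeasurableSet (measure_ne_top _ _)]
    exact tsub_le_iff_left.2 hμO
  obtain ⟨q, hq⟩ := exists_lex_index (X := X) m
  set B : Fin m → Set X := fun j => Metric.ball (b j) (s j) with hB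
  set W : (ℕ → T) → ℕ → Fin m → Set X := fun _ _ j => B j with hW
  set τ : ℕ ×ₗ ℕ ×ₗ Fin m → ℕ := fun i => (ofLex i).1 with hτ
  set k : ℕ ×ₗ ℕ ×ₗ Fin m → Fin m := fun i => (ofLex (ofLex i).2).2 with hk
  have hBd : ∀ j, ∀ x ∈ B j, ∀ y ∈ B j, dist x y < 2 * δ := fun j x hx y hy => by
    have := dist_triangle_right x y (b j)
    have h1 := Metric.mem_ball.1 hx
    have h2 := Metric.mem_ball.1 hy
    have h3 := (hs j).2
    linarith
  set c : ℝ≥0∞ := Finset.univ.inf fun j => μ (B j) with hc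
  have hc0 : c ≠ 0 := by
    refine ne_of_gt ?_
    rw [hc, Finset.lt_inf_iff (by simp)]
    exact fun j _ => Metric.measure_ball_pos μ _ (hs j).1
  have hcover := h.ae_mem_candidate (n₀ := 0) (B := B) (W := W) (A := A) (O := O) (c := c) hδ0
    (by linarith) hO (monotone_lex_fst m) hq (fun j => Metric.isOpen_ball) hBd
    (fun _ _ _ _ => Metric.isOpen_ball) hw (fun _ _ => Subset.rfl) hc0
    (fun _ j => Finset.inf_le (Finset.mem_univ j)) (fun _ j => hfr j) (by
      filter_upwards [hhyp] with x hx hxA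
      exact ⟨hAO hxA, (hx hxA).mono fun n hn => ⟨hn, hcov _⟩⟩)
  set C := candidate F lam N η ρ δ O 0 τ q k B W with hC
  set I : Set (ℕ ×ₗ ℕ ×ₗ Fin m) := {i | w ∈ greedyChoice μ C i} with hI
  set U : I → Set X := fun i => Prod.mk w ⁻¹' C i with hU
  have hopen : ∀ i, IsOpen (Prod.mk w ⁻¹' C i) := fun i =>
    h.isOpen_candidate_section (fun _ _ _ _ => Metric.isOpen_ball) w i
  have hdisj : Pairwise (Function.onFun Disjoint U) := fun i j hij =>
    disjoint_of_mem_greedyChoice hopen (by simpa [Subtype.ext_iff] using hij) i.2 j.2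
  have hUm : ∀ i, MeasurableSet (U i) := fun i => (hopen i).measurableSet
  have hμA : μ A ≤ ∑' i, μ (U i) := by
    rw [← measure_iUnion hdisj hUm]
    refine measure_mono_ae ?_
    filter_upwards [hcover] with x hx hxA
    obtain ⟨i, hi, hxi⟩ := hx hxA
    exact mem_iUnion.2 ⟨⟨i, hi⟩, hxi⟩
  have hsub : ∀ i x, x ∈ U i → x ∈ shadowPreimage F ρ w (τ i) (q i) (B (k i)) ∧
      Metric.closedBall (q i) (2 * δ * Real.exp (-η) ^ τ i) ⊆ O ∧
      HypTime F lam η w (τ i) (q i) ∧ randIter F w (τ i) (q i) ∈ B (k i) :=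
    fun i x hx => ⟨hx.2, hx.1.2.2⟩
  have hball : ∀ i x, x ∈ U i → B (k i) ⊆ Metric.ball (randIter F w (τ i) (q i)) (2 * δ) :=
    fun i x hx y hy => hBd _ _ hy _ (hsub i x hx).2.2.2
  have hUO : ∀ i, U i ⊆ O := fun i x hx => by
    obtain ⟨h1, h2, h3, h4⟩ := hsub i x hx
    refine h2 ?_
    have := h.shadow_dist hw h3 (by linarith) (hball i x hx) h1 (Nat.zero_le _)
    rw [Metric.mem_closedBall, mul_comm]
    simpa [randIter] using this
  -- Otherwise summing over the disjoint sets `U i`, which cover `A` and lie in `O`, would make `μ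
  -- (O \ A)` larger than `θ * μ A`. The sum is strict because at least one `U i` is nonempty.
  obtain ⟨i, hne, hi⟩ : ∃ i, (U i).Nonempty ∧ μ (U i \ A) ≤ θ * μ (U i) := by
    by_contra hno
    push Not at hno
    have hle : ∀ i, θ * μ (U i) ≤ μ (U i \ A) := fun i => by
      rcases (U i).eq_empty_or_nonempty with h0 | h0
      · simp [h0]
      · exact (hno i h0).le
    obtain ⟨i, hi⟩ : ∃ i, (U i).Nonempty := by
      by_contra hem
      push Not at hem
      simp [hem, hA0] at hμA
    have hfin : ∑' i, μ (U i \ A) ≤ θ * μ A := by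
      rw [← measure_iUnion (fun i j hij => (hdisj hij).mono sdiff_subset sdiff_subset)
        fun i => (hUm i).diff hAm]
      refine (measure_mono (iUnion_subset fun i => ?_)).trans hOA
      exact sdiff_subset_sdiff_left (hUO i)
    have hlt := ENNReal.tsum_lt_tsum (f := fun i => θ * μ (U i)) (g := fun i => μ (U i \ A))
      (ne_top_of_le_ne_top (measure_ne_top μ (O \ A)) ?_) hle (hno i hi)
    · rw [ENNReal.tsum_mul_left] at hlt
      exact absurd (hlt.trans_le hfin) (not_lt.2 (by gcongr))
    · refine (ENNReal.tsum_le_tsum hle).trans ?_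
      rw [← measure_iUnion (fun i j hij => (hdisj hij).mono sdiff_subset sdiff_subset)
        fun i => (hUm i).diff hAm]
      exact measure_mono (iUnion_subset fun i => sdiff_subset_sdiff_left (hUO i))
  obtain ⟨x₁, hx₁⟩ := hne
  obtain ⟨-, -, hn, hqB⟩ := hsub i x₁ hx₁
  have hUeq : U i = shadowPreimage F ρ w (τ i) (q i) (B (k i)) := by
    ext y
    exact ⟨fun hy => hy.2, fun hy => ⟨hx₁.1, hy⟩⟩
  set n := τ i with hndef
  have himg : randIter F w n '' U i = B (k i) := by
    rw [hUeq]; exact h.shadow_image hw hn (by linarith) (hball i x₁ hx₁)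
  set P := ∏ l ∈ Finset.range n, J (w l) (randIter F w l (q i)) with hP
  have hP0 : 0 < P := Finset.prod_pos fun l _ => h.J_pos _ (hw l) _
  have hdist : ∀ E ⊆ U i, MeasurableSet E →
      ENNReal.ofReal (Real.exp (-S) * P) * μ E ≤ μ (randIter F w n '' E) ∧
      μ (randIter F w n '' E) ≤ ENNReal.ofReal (Real.exp S * P) * μ E := fun E hE hEm => by
    refine h.distortion hw hEm (q i) n (fun l => Real.exp (-η) ^ (n - l) * (ρ / 2)) ?_ ?_
      (h.sum_le_of_hypTime (by positivity) n)
    · intro l _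
      have : Real.exp (-η) ^ (n - l) ≤ 1 := pow_le_one₀ (Real.exp_pos _).le h.exp_neg_lt_one.le
      change Real.exp (-η) ^ (n - l) * (ρ / 2) < ρ
      nlinarith
    · intro u hu l hl
      have hu' := hE hu
      rw [hUeq] at hu'
      refine (h.shadow_dist hw hn (by linarith) (hball i x₁ hx₁) hu' hl).trans ?_
      exact mul_le_mul_of_nonneg_left (by linarith) (by positivity)
  set Z : Set X := {x | x ∈ A ∧ randIter F w n x ∉ A} with hZ
  have hZm : MeasurableSet Z :=
    hAm.inter ((h.continuous_iter hw n).measurable hAm.compl)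
  have hZ0 : μ Z = 0 := by
    rw [measure_eq_zero_iff_ae_notMem]
    filter_upwards [hinv] with x hx hxZ
    exact hxZ.2 (hx hxZ.1 n)
  -- Forward invariance: a point of the full image outside `A` comes from outside `A`, apart from
  -- the image of the null set `Z` of exceptional points.
  have hsplit : B (k i) \ A ⊆ randIter F w n '' (U i \ A) ∪ randIter F w n '' (U i ∩ Z) := by
    rintro y ⟨hy, hyA⟩
    rw [← himg] at hy
    obtain ⟨u, hu, rfl⟩ := hy
    by_cases huA : u ∈ A
    · exact Or.inr ⟨u, ⟨hu, huA, hyA⟩, rfl⟩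
    · exact Or.inl ⟨u, ⟨hu, huA⟩, rfl⟩
  have hnull : μ (randIter F w n '' (U i ∩ Z)) = 0 := by
    have := (hdist (U i ∩ Z) inter_subset_left ((hUm i).inter hZm)).2
    rw [measure_mono_null inter_subset_right hZ0, mul_zero] at this
    exact le_antisymm this zero_le
  have hfinal : μ (B (k i) \ A) ≤ θ * (ENNReal.ofReal (Real.exp (2 * S)) * μ univ) := by
    calc μ (B (k i) \ A) ≤ μ (randIter F w n '' (U i \ A)) + μ (randIter F w n '' (U i ∩ Z)) :=
          (measure_mono hsplit).trans (measure_union_le _ _)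
      _ ≤ ENNReal.ofReal (Real.exp S * P) * μ (U i \ A) := by
          rw [hnull, add_zero]
          exact (hdist _ sdiff_subset ((hUm i).diff hAm)).2
      _ ≤ ENNReal.ofReal (Real.exp S * P) * (θ * μ (U i)) := by gcongr
      _ = θ * (ENNReal.ofReal (Real.exp (2 * S)) *
            (ENNReal.ofReal (Real.exp (-S) * P) * μ (U i))) := by
          have : Real.exp S * P = Real.exp (2 * S) * (Real.exp (-S) * P) := by
            have : Real.exp S = Real.exp (2 * S) * Real.exp (-S) := by
              rw [← Real.exp_add]; congr 1; ring
            rw [this]; ring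
          rw [this, ENNReal.ofReal_mul (by positivity)]
          ring
      _ ≤ θ * (ENNReal.ofReal (Real.exp (2 * S)) * μ univ) := by
          gcongr
          exact (hdist _ Subset.rfl (hUm i)).1.trans (measure_mono (subset_univ _))
  exact absurd (hfinal.trans_lt hθ) (not_lt.2 (Finset.inf_le (Finset.mem_univ (k i))))

end LocalControl

/-! ### Full branches over a ball -/

lemma measurableSet_hypTime {T X : Type*} [MeasurableSpace T] [MeasurableSpace X]
    {F : T → X → X} {lam : T → X → ℝ} (hF : Measurable (Function.uncurry F))
    (hlam : Measurable (Function.uncurry lam)) (η : ℝ) (n : ℕ) :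
    MeasurableSet {p : (ℕ → T) × X | HypTime F lam η p.1 n p.2} := by
  have : {p : (ℕ → T) × X | HypTime F lam η p.1 n p.2} = ⋂ i ∈ Finset.range n,
      {p | ∏ j ∈ Finset.Ico i n, lam (p.1 j) (randIter F p.1 j p.2) <
        Real.exp (-(2 * η * ((n : ℝ) - i)))} := by
    ext x; simp [HypTime]
  rw [this]
  refine Finset.measurableSet_biInter _ fun i _ => measurableSet_lt ?_ measurable_const
  refine Finset.measurable_prod _ fun j _ => ?_
  exact hlam.comp (((measurable_pi_apply j).comp measurable_fst).prodMk (measurable_randIter hF j))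

lemma measurableSet_shadow {T X Ω : Type*} [MeasurableSpace T] [MeasurableSpace Ω] [MetricSpace X]
    [MeasurableSpace X] [BorelSpace X] [SecondCountableTopology X] {F : T → X → X}
    (hF : Measurable (Function.uncurry F)) (ρ : ℝ) (n : ℕ) (q : X) {v : Ω → ℕ → T}
    (hv : Measurable v) {g : Ω → X} (hg : Measurable g) {W : Ω → Set X}
    (hW : MeasurableSet {a | randIter F (v a) n (g a) ∈ W a}) :
    MeasurableSet {a | g a ∈ shadowPreimage F ρ (v a) n q (W a)} := by
  have : {a | g a ∈ shadowPreimage F ρ (v a) n q (W a)} =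
      (⋂ i ∈ Finset.range n, {a | dist (randIter F (v a) i (g a)) (randIter F (v a) i q) < ρ}) ∩
        {a | randIter F (v a) n (g a) ∈ W a} := by
    ext a; simp [shadowPreimage]
  rw [this]
  refine (Finset.measurableSet_biInter _ fun i _ => measurableSet_lt ?_ measurable_const).inter hW
  exact ((measurable_randIter hF i).comp (hv.prodMk hg)).dist
    ((measurable_randIter hF i).comp (hv.prodMk measurable_const))

lemma measurableSet_candidate {T X ι κ : Type*} [MeasurableSpace T] [MetricSpace X]
    [MeasurableSpace X] [BorelSpace X] [SecondCountableTopology X] {F : T → X → X}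
    {lam : T → X → ℝ} (hF : Measurable (Function.uncurry F))
    (hlam : Measurable (Function.uncurry lam)) {N : Set T} (hN : MeasurableSet N) {η ρ δ : ℝ}
    {O : Set X} {n₀ : ℕ} {τ : ι → ℕ} {q : ι → X} {k : ι → κ} {B : κ → Set X}
    (hB : ∀ j, MeasurableSet (B j)) {W : (ℕ → T) → ℕ → κ → Set X}
    (hW : ∀ n j, MeasurableSet {p : (ℕ → T) × X | p.2 ∈ W p.1 n j}) (i : ι) :
    MeasurableSet (candidate F lam N η ρ δ O n₀ τ q k B W i) := by
  have hq : Measurable fun p : (ℕ → T) × X => (p.1, q i) := measurable_fst.prodMk measurable_const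
  refine MeasurableSet.inter (MeasurableSet.inter ?_ (MeasurableSet.inter ?_
    (MeasurableSet.inter ?_ (MeasurableSet.inter ?_ ?_)))) ?_
  · change MeasurableSet {p : (ℕ → T) × X | ∀ l, p.1 l ∈ N}
    have : {p : (ℕ → T) × X | ∀ l, p.1 l ∈ N} = ⋂ l, (fun p : (ℕ → T) × X => p.1 l) ⁻¹' N := by
      ext p; simp
    rw [this]
    exact MeasurableSet.iInter fun l => ((measurable_pi_apply l).comp measurable_fst) hN
  · exact MeasurableSet.const _
  · exact MeasurableSet.const _
  · exact hq (measurableSet_hypTime hF hlam η (τ i))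
  · exact ((measurable_randIter hF (τ i)).comp hq) (hB _)
  · refine measurableSet_shadow hF ρ (τ i) (q i) measurable_fst measurable_snd ?_
    exact (measurable_fst.prodMk (measurable_randIter hF (τ i))) (hW (τ i) (k i))

namespace LocalControl

variable {T X : Type*} [MetricSpace X] [MeasurableSpace X] {μ : Measure X}
  {F : T → X → X} {lam J : T → X → ℝ} {N : Set T} {η ρ Λ Jm L : ℝ} {w : ℕ → T}

section Target

variable {m : ℕ} {z p : X} {r s : ℝ}

/-- Along the connecting orbits there is no hyperbolicity. Their length is at most `M`, so the crude
bound by powers of `exp η * Λ` suffices. -/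
lemma prod_le_pow (h : LocalControl μ F lam J N η ρ Λ Jm L) (hw : ∀ i, w i ∈ N) (x : X)
    {i m M : ℕ} (hm : m ≤ M) :
    ∏ j ∈ Finset.Ico i m, (Real.exp η * lam (w j) (randIter F w j x)) ≤ (Real.exp η * Λ) ^ M := by
  have h1 : 1 ≤ Real.exp η * Λ :=
    one_le_mul_of_one_le_of_one_le (Real.one_le_exp h.η_pos.le) h.one_le_Λ
  calc _ ≤ ∏ j ∈ Finset.Ico i m, (Real.exp η * Λ) := Finset.prod_le_prod
        (fun j _ => mul_nonneg (Real.exp_pos _).le (h.lam_pos _ (hw j) _).le)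
        fun j _ => mul_le_mul_of_nonneg_left (h.lam_le _ (hw j) _) (Real.exp_pos _).le
    _ = (Real.exp η * Λ) ^ (m - i) := by simp
    _ ≤ _ := pow_le_pow_right₀ h1 (by omega)

lemma target_dist (h : LocalControl μ F lam J N η ρ Λ Jm L) (hw : ∀ i, w i ∈ N) {M : ℕ}
    (hm : m ≤ M) (hs : s ≤ ρ)
    (hz : ∀ y ∈ Metric.ball p r, (Real.exp η * Λ) ^ M * dist y (randIter F w m z) < s) {u : X}
    (hu : u ∈ shadowPreimage F ρ w m z (Metric.ball p r)) {i : ℕ} (hi : i ≤ m) :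
    dist (randIter F w i u) (randIter F w i z) < s := by
  have h1 : 1 ≤ (Real.exp η * Λ) ^ M := one_le_pow₀
    (one_le_mul_of_one_le_of_one_le (Real.one_le_exp h.η_pos.le) h.one_le_Λ)
  have h2 := hz _ hu.2
  have hclose : ∀ l ≤ m, dist (randIter F w l u) (randIter F w l z) < ρ := fun l hl => by
    rcases hl.eq_or_lt with rfl | hlt
    · exact ((le_mul_of_one_le_left dist_nonneg h1).trans_lt h2).trans_le hs
    · exact hu.1 l hlt
  refine lt_of_le_of_lt ((h.dist_iter_le hw hclose (h.self_close m z) i hi).trans ?_) h2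
  exact mul_le_mul_of_nonneg_right (h.prod_le_pow hw z hm) dist_nonneg

lemma target_injOn (h : LocalControl μ F lam J N η ρ Λ Jm L) (hw : ∀ i, w i ∈ N) {M : ℕ}
    (hm : m ≤ M) (hs : s ≤ ρ)
    (hz : ∀ y ∈ Metric.ball p r, (Real.exp η * Λ) ^ M * dist y (randIter F w m z) < s) :
    InjOn (randIter F w m) (shadowPreimage F ρ w m z (Metric.ball p r)) := by
  refine (h.injOn_dynBall hw z m).mono fun u hu => ?_
  exact fun i hi => (h.target_dist hw hm hs hz hu hi).trans_le hs

lemma target_image (h : LocalControl μ F lam J N η ρ Λ Jm L) (hw : ∀ i, w i ∈ N) {M : ℕ}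
    (hm : m ≤ M) (hs : s ≤ ρ)
    (hz : ∀ y ∈ Metric.ball p r, (Real.exp η * Λ) ^ M * dist y (randIter F w m z) < s) :
    randIter F w m '' shadowPreimage F ρ w m z (Metric.ball p r) = Metric.ball p r := by
  refine Subset.antisymm (by rintro _ ⟨u, hu, rfl⟩; exact hu.2) fun y hy => ?_
  have hb : ∀ i ≤ m, (∏ j ∈ Finset.Ico i m, (Real.exp η * lam (w j) (randIter F w j z))) *
      dist y (randIter F w m z) < ρ := fun i _ =>
    ((mul_le_mul_of_nonneg_right (h.prod_le_pow hw z hm) dist_nonneg).trans_lt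
      (hz y hy)).trans_le hs
  obtain ⟨u, hu, hud⟩ := h.exists_branch hw z m y hb
  exact ⟨u, ⟨fun i hi => (hud i hi.le).trans_lt (hb i hi.le), by rwa [hu]⟩, hu⟩

lemma target_frontier [BorelSpace X] [CompactSpace X]
    (h : LocalControl μ F lam J N η ρ Λ Jm L) (hw : ∀ i, w i ∈ N) {M : ℕ}
    (hm : m ≤ M) (hs : s < ρ)
    (hz : ∀ y ∈ Metric.ball p r, (Real.exp η * Λ) ^ M * dist y (randIter F w m z) < s)
    (hfr : μ (frontier (Metric.ball p r)) = 0) :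
    μ (frontier (shadowPreimage F ρ w m z (Metric.ball p r))) = 0 := by
  refine measure_mono_null ?_
    (h.measure_preimage_iter_null hw m isClosed_frontier.measurableSet hfr)
  rw [(h.isOpen_shadow hw Metric.isOpen_ball).frontier_eq]
  rintro u ⟨hu, hu'⟩
  have hclose : ∀ i < m, dist (randIter F w i u) (randIter F w i z) < ρ := fun i hi => by
    have hc : IsClosed {v | dist (randIter F w i v) (randIter F w i z) ≤ s} :=
      isClosed_le ((h.continuous_iter hw i).dist continuous_const) continuous_const
    have : u ∈ {v | dist (randIter F w i v) (randIter F w i z) ≤ s} :=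
      (closure_minimal (fun v hv => (h.target_dist hw hm hs.le hz hv hi.le).le) hc) hu
    exact lt_of_le_of_lt this hs
  have h1 : randIter F w m u ∈ closure (Metric.ball p r) :=
    map_mem_closure (h.continuous_iter hw m) hu fun v hv => hv.2
  rw [mem_preimage, Metric.isOpen_ball.frontier_eq]
  exact ⟨h1, fun hmem => hu' ⟨hclose, hmem⟩⟩

/-- This supplies the lower bound `c`, uniform in the time and in the noise, for the sets whose
hyperbolic preimages enter the covering. -/
lemma target_measure [BorelSpace X] [CompactSpace X]
    (h : LocalControl μ F lam J N η ρ Λ Jm L) (hw : ∀ i, w i ∈ N) {M : ℕ}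
    (hm : m ≤ M) (hs : s ≤ ρ)
    (hz : ∀ y ∈ Metric.ball p r, (Real.exp η * Λ) ^ M * dist y (randIter F w m z) < s) :
    μ (Metric.ball p r) / ENNReal.ofReal (Jm ^ M) ≤
      μ (shadowPreimage F ρ w m z (Metric.ball p r)) := by
  have h1 := (h.measure_image_iter hw
    (h.isOpen_shadow (n := m) (q := z) hw (Metric.isOpen_ball (x := p) (ε := r))).measurableSet
    (fun _ => 0) (fun _ => Jm) (fun _ => le_rfl) (fun _ => zero_le_one.trans h.one_le_Jm) m
    (h.target_injOn hw hm hs hz)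
    (fun i _ u _ => (h.J_pos _ (hw i) _).le) (fun i _ u _ => h.J_le _ (hw i) _)).2
  rw [h.target_image hw hm hs hz] at h1
  refine ENNReal.div_le_of_le_mul' (h1.trans ?_)
  gcongr
  simpa using pow_le_pow_right₀ h.one_le_Jm hm

end Target

/-- The random induced map: measurable choice of the inducing time and full branches with
contraction and bounded distortion. -/
theorem exists_induced [MeasurableSpace T] [BorelSpace X] [CompactSpace X] [IsFiniteMeasure μ]
    [μ.IsOpenPosMeasure] (h : LocalControl μ F lam J N η ρ Λ Jm L)
    (hF : Measurable (Function.uncurry F)) (hlam : Measurable (Function.uncurry lam))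
    (hN : MeasurableSet N) {δ : ℝ} (hδ0 : 0 < δ) (hδ : 12 * δ ≤ ρ)
    {p : X} {r : ℝ} (hr : 0 < r) (hfr : μ (frontier (Metric.ball p r)) = 0)
    {m M : ℕ} {b z : Fin m → X} {t : Fin m → ℕ} {s : ℝ} (hs : 2 * s < ρ) (ht : ∀ j, t j ≤ M)
    (hzb : ∀ j, Metric.ball (z j) s ⊆ Metric.ball (b j) δ)
    (hz : ∀ w, (∀ i, w i ∈ N) → ∀ j, ∀ y ∈ Metric.ball p r,
      (Real.exp η * Λ) ^ M * dist y (randIter F w (t j) (z j)) < s)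
    {P : Measure (ℕ → T)}
    (hP : ∀ᵐ w ∂P, (∀ i, w i ∈ N) ∧ ∀ᵐ x ∂μ, x ∈ Metric.ball p r →
      ∃ᶠ n in atTop, HypTime F lam η w n x ∧ ∃ j, randIter F w n x ∈ Metric.ball (b j) δ) :
    ∃ R : (ℕ → T) → X → ℕ, Measurable (fun a : (ℕ → T) × X => R a.1 a.2) ∧
      (∀ w x, 1 ≤ R w x) ∧ ∃ κ K : ℝ, 0 < κ ∧ κ < 1 ∧ 0 < K ∧
      ∀ᵐ w ∂P, (∀ i, w i ∈ N) ∧ ∃ Q : Set (Set X), Q.Countable ∧ Q.PairwiseDisjoint id ∧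
        μ (Metric.ball p r \ ⋃₀ Q) = 0 ∧
        ∀ U ∈ Q, IsOpen U ∧ U.Nonempty ∧ U ⊆ Metric.ball p r ∧ ∃ n, (∀ x ∈ U, R w x = n) ∧
          BijOn (randIter F w n) U (Metric.ball p r) ∧
          (∀ x ∈ U, ∏ i ∈ Finset.range n, lam (w i) (randIter F w i x) < κ) ∧
          ∀ x ∈ U, ∀ y ∈ U, ∑ i ∈ Finset.range n, (Real.log (J (w i) (randIter F w i x)) -
            Real.log (J (w i) (randIter F w i y))) ≤
              K * dist (randIter F w n x) (randIter F w n y) := by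
  classical
  have hρ := h.ρ_pos
  have : Nonempty X := ⟨p⟩
  have hΛ1 := h.one_le_Λ
  set Θ := (Real.exp η * Λ) ^ M with hΘ
  have hΘ1 : 1 ≤ Θ := one_le_pow₀
    (one_le_mul_of_one_le_of_one_le (Real.one_le_exp h.η_pos.le) h.one_le_Λ)
  have hσ1 := h.exp_neg_lt_one
  have hσ0 := Real.exp_pos (-η)
  -- Waiting for at least `n₀` steps makes the contraction at the hyperbolic time beat the possible
  -- loss `Λ ^ M` on the connecting orbit; this gives `κ = 1 / 2`.
  obtain ⟨n₀, hn₀1, hn₀⟩ : ∃ n₀ : ℕ, 1 ≤ n₀ ∧ Real.exp (-η) ^ n₀ * Λ ^ M < 1 / 2 := by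
    have ht : Tendsto (fun n : ℕ => Real.exp (-η) ^ n * Λ ^ M) atTop (𝓝 0) := by
      simpa using (tendsto_pow_atTop_nhds_zero_of_lt_one hσ0.le hσ1).mul_const (Λ ^ M)
    obtain ⟨n, h1, h2⟩ := ((eventually_ge_atTop 1).and
      (ht.eventually_lt_const (by norm_num : (0 : ℝ) < 1 / 2))).exists
    exact ⟨n, h1, h2⟩
  obtain ⟨q, hq⟩ := exists_lex_index (X := X) m
  set B : Fin m → Set X := fun j => Metric.ball (b j) δ with hB
  -- The connecting orbit starts at time `n`, so it is driven by the shifted noise sequence; the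
  -- target set therefore depends on `w` and `n`.
  set W : (ℕ → T) → ℕ → Fin m → Set X := fun w n j =>
    shadowPreimage F ρ (fun i => w (n + i)) (t j) (z j) (Metric.ball p r) with hW
  set τ : ℕ ×ₗ ℕ ×ₗ Fin m → ℕ := fun i => (ofLex i).1 with hτ
  set k : ℕ ×ₗ ℕ ×ₗ Fin m → Fin m := fun i => (ofLex (ofLex i).2).2 with hk
  have hBd : ∀ j, ∀ x ∈ B j, ∀ y ∈ B j, dist x y < 2 * δ := fun j x hx y hy => by
    have := dist_triangle_right x y (b j)
    have h1 := Metric.mem_ball.1 hx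
    have h2 := Metric.mem_ball.1 hy
    linarith
  have hs0 : ∀ w : ℕ → T, (∀ i, w i ∈ N) → Fin m → 0 < s := fun w hw j =>
    (mul_nonneg (zero_le_one.trans hΘ1) dist_nonneg).trans_lt
      (hz w hw j p (Metric.mem_ball_self hr))
  have hsρ : ∀ w : ℕ → T, (∀ i, w i ∈ N) → Fin m → s < ρ := fun w hw j => by
    have := hs0 w hw j; linarith
  have hWo : ∀ w : ℕ → T, (∀ l, w l ∈ N) → ∀ n j, IsOpen (W w n j) := fun w hw n j =>
    h.isOpen_shadow (fun i => hw (n + i)) Metric.isOpen_ball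
  have hWB : ∀ w : ℕ → T, (∀ l, w l ∈ N) → ∀ n j, W w n j ⊆ B j := fun w hw n j u hu =>
    hzb j (h.target_dist (fun i => hw (n + i)) (ht j) (hsρ w hw j).le
      (hz _ (fun i => hw (n + i)) j) hu (Nat.zero_le _))
  set C := candidate F lam N η ρ δ (Metric.ball p r) n₀ τ q k B W with hC
  set D := greedyChoice μ C with hD
  have hCm : ∀ i, MeasurableSet (C i) := measurableSet_candidate hF hlam hN
    (fun j => Metric.isOpen_ball.measurableSet) (fun n j => by
      have hsh : Measurable fun a : (ℕ → T) × X => fun i => a.1 (n + i) :=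
        measurable_pi_lambda _ fun i => (measurable_pi_apply (n + i)).comp measurable_fst
      exact measurableSet_shadow hF ρ (t j) (z j) hsh measurable_snd
        (((measurable_randIter hF (t j)).comp (hsh.prodMk measurable_snd))
          Metric.isOpen_ball.measurableSet))
  have hDm : ∀ i, MeasurableSet (D i) := measurableSet_greedyChoice hCm
  have hopen : ∀ w i, IsOpen (Prod.mk w ⁻¹' C i) := fun w i =>
    h.isOpen_candidate_section hWo w i
  have hdisj : ∀ w i j, i ≠ j → w ∈ D i → w ∈ D j →
      Disjoint (Prod.mk w ⁻¹' C i) (Prod.mk w ⁻¹' C j) := fun w i j hij hi hj =>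
    disjoint_of_mem_greedyChoice (hopen w) hij hi hj
  set E : ℕ ×ₗ ℕ ×ₗ Fin m → Set ((ℕ → T) × X) := fun i => {a | a.1 ∈ D i ∧ a ∈ C i} with hE
  have hEm : ∀ i, MeasurableSet (E i) := fun i => (measurable_fst (hDm i)).inter (hCm i)
  have huniq : ∀ a i j, a ∈ E i → a ∈ E j → i = j := fun a i j hi hj => by
    by_contra hij
    exact disjoint_left.1 (hdisj a.1 i j hij hi.1 hj.1) hi.2 hj.2
  -- Hyperbolic time plus connecting time. The index is unique by disjointness, so the choice is
  -- harmless for measurability. The value `1` on the uncovered points is a default that keeps `R`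
  -- positive.
  let R : (ℕ → T) → X → ℕ := fun w x =>
    if hx : ∃ i, (w, x) ∈ E i then τ hx.choose + t (k hx.choose) else 1
  have hR : ∀ w x i, (w, x) ∈ E i → R w x = τ i + t (k i) := fun w x i hi => by
    have hx : ∃ i, (w, x) ∈ E i := ⟨i, hi⟩
    have : hx.choose = i := huniq _ _ _ hx.choose_spec hi
    simp only [R, dif_pos hx, this]
  have hR' : ∀ w x, (¬ ∃ i, (w, x) ∈ E i) → R w x = 1 := fun w x hx => by
    simp only [R, dif_neg hx]
  -- The first summand of the distortion constant is the geometric sum up to the hyperbolic time,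
  -- the second comes from at most `M` connecting steps, and the `1` only makes the constant
  -- positive.
  refine ⟨R, ?_, ?_, 1 / 2, L / (1 - Real.exp (-η)) * Θ + M * (L * Θ) + 1, by norm_num,
    by norm_num, ?_, ?_⟩
  · refine measurable_to_countable' fun v => ?_
    have : (fun a : (ℕ → T) × X => R a.1 a.2) ⁻¹' {v} =
        (⋃ i ∈ {i | τ i + t (k i) = v}, E i) ∪ ((⋃ i, E i)ᶜ ∩ {_a | (1 : ℕ) = v}) := by
      ext ⟨w, x⟩
      simp only [mem_preimage, mem_singleton_iff, mem_union, mem_iUnion, mem_inter_iff,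
        mem_compl_iff, exists_prop]
      by_cases hx : ∃ i, (w, x) ∈ E i
      · obtain ⟨i, hi⟩ := hx
        rw [hR w x i hi]
        constructor
        · exact fun hv => Or.inl ⟨i, hv, hi⟩
        · rintro (⟨j, hj, hxj⟩ | ⟨hno, -⟩)
          · rw [huniq _ _ _ hi hxj]; exact hj
          · exact absurd ⟨i, hi⟩ hno
      · rw [hR' w x hx]
        constructor
        · exact fun hv => Or.inr ⟨hx, hv⟩
        · rintro (⟨j, hj, hxj⟩ | ⟨-, hv⟩)
          · exact absurd ⟨j, hxj⟩ hx
          · exact hv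
    rw [this]
    exact (MeasurableSet.biUnion (to_countable _) fun i _ => hEm i).union
      ((MeasurableSet.iUnion hEm).compl.inter (MeasurableSet.const _))
  · intro w x
    by_cases hx : ∃ i, (w, x) ∈ E i
    · obtain ⟨i, hi⟩ := hx
      rw [hR w x i hi]
      have : n₀ ≤ τ i := hi.2.1.2.1
      omega
    · rw [hR' w x hx]
  · have : 0 < 1 - Real.exp (-η) := by linarith
    have := h.L_nonneg
    positivity
  filter_upwards [hP] with w ⟨hw, hx⟩
  refine ⟨hw, {U | ∃ i, w ∈ D i ∧ U = Prod.mk w ⁻¹' C i ∧ U.Nonempty}, ?_, ?_, ?_, ?_⟩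
  · refine (countable_range fun i => Prod.mk w ⁻¹' C i).mono ?_
    rintro _ ⟨i, -, rfl, -⟩
    exact ⟨i, rfl⟩
  · rintro _ ⟨i, hi, rfl, -⟩ _ ⟨j, hj, rfl, -⟩ hne
    exact hdisj w i j (fun hij => hne (by rw [hij])) hi hj
  -- Taking the ball itself as the open set `O` forces every selected preimage to lie inside it.
  · have hcov := h.ae_mem_candidate (n₀ := n₀) (B := B) (W := W) (A := Metric.ball p r)
      (O := Metric.ball p r) (w := w) (c := μ (Metric.ball p r) / ENNReal.ofReal (Jm ^ M)) hδ0
      hδ Metric.isOpen_ball (monotone_lex_fst m) hq (fun j => Metric.isOpen_ball) hBd hWo hw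
      (hWB w hw)
      (ENNReal.div_pos (Metric.measure_ball_pos μ p hr).ne' ENNReal.ofReal_ne_top).ne'
      (fun n j => h.target_measure (fun i => hw (n + i)) (ht j) (hsρ w hw j).le
        (hz _ (fun i => hw (n + i)) j))
      (fun n j => h.target_frontier (fun i => hw (n + i)) (ht j) (hsρ w hw j)
        (hz _ (fun i => hw (n + i)) j) hfr)
      (by filter_upwards [hx] with x hx hxp using ⟨hxp, hx hxp⟩)
    rw [measure_eq_zero_iff_ae_notMem]
    filter_upwards [hcov] with x hx hxn
    obtain ⟨i, hi, hxi⟩ := hx hxn.1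
    exact hxn.2 ⟨_, ⟨i, hi, rfl, ⟨x, hxi⟩⟩, hxi⟩
  rintro _ ⟨i, hi, rfl, x₀, hx₀⟩
  obtain ⟨⟨-, hn₀i, hsub, hhyp, hqB⟩, -⟩ := id hx₀
  set n := τ i with hn
  set j := k i with hj
  have hUeq : Prod.mk w ⁻¹' C i = shadowPreimage F ρ w n (q i) (W w n j) := by
    ext y
    exact ⟨fun hy => hy.2, fun hy => ⟨hx₀.1, hy⟩⟩
  have hball : W w n j ⊆ Metric.ball (randIter F w n (q i)) (2 * δ) := fun y hy =>
    hBd j _ (hWB w hw n j hy) _ hqB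
  have h2δ : 2 * δ ≤ ρ := by linarith
  set v : ℕ → T := fun l => w (n + l) with hv
  have hvN : ∀ l, v l ∈ N := fun l => hw (n + l)
  have hzv := hz v hvN j
  have hsr := hsρ w hw j
  have hclose : ∀ x ∈ Prod.mk w ⁻¹' C i, ∀ l ≤ n,
      dist (randIter F w l x) (randIter F w l (q i)) < ρ := fun x hx l hl => by
    rw [hUeq] at hx; exact shadow_close h2δ hball hx l hl
  have hclose2 : ∀ x ∈ Prod.mk w ⁻¹' C i, ∀ l ≤ n,
      dist (randIter F w l x) (randIter F w l (q i)) ≤ 2 * δ := fun x hx l hl => by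
    rw [hUeq] at hx
    refine (h.shadow_dist hw hhyp h2δ hball hx hl).trans (mul_le_of_le_one_left (by linarith) ?_)
    exact pow_le_one₀ hσ0.le hσ1.le
  have hmemW : ∀ x ∈ Prod.mk w ⁻¹' C i, randIter F w n x ∈ W w n j := fun x hx => by
    rw [hUeq] at hx; exact hx.2
  have htd : ∀ x ∈ Prod.mk w ⁻¹' C i, ∀ l ≤ t j,
      dist (randIter F v l (randIter F w n x)) (randIter F v l (z j)) < s := fun x hx l hl =>
    h.target_dist hvN (ht j) hsr.le hzv (hmemW x hx) hl
  -- Distances during the connecting stretch are compared with the final distance; this is what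
  -- allows the distortion to be measured by the distance of the images in the ball.
  have hcon : ∀ x ∈ Prod.mk w ⁻¹' C i, ∀ y ∈ Prod.mk w ⁻¹' C i, ∀ l ≤ t j,
      dist (randIter F w (n + l) x) (randIter F w (n + l) y) ≤
        Θ * dist (randIter F w (n + t j) x) (randIter F w (n + t j) y) := fun x hx y hy l hl => by
    simp only [randIter_add]
    refine (h.dist_iter_le hvN (fun l hl => (htd x hx l hl).trans hsr)
      (fun l hl => (htd y hy l hl).trans hsr) l hl).trans ?_
    exact mul_le_mul_of_nonneg_right (h.prod_le_pow hvN _ (ht j)) dist_nonneg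
  refine ⟨hopen w i, ⟨x₀, hx₀⟩, ?_, n + t j, fun x hx => hR w x i ⟨hi, hx⟩, ?_, ?_, ?_⟩
  · intro x hx
    rw [hUeq] at hx
    refine hsub ?_
    have := h.shadow_dist hw hhyp h2δ hball hx (Nat.zero_le _)
    rw [Metric.mem_closedBall, mul_comm]
    simpa [randIter] using this
  · have hfun : randIter F w (n + t j) = randIter F v (t j) ∘ randIter F w n := by
      ext x; exact randIter_add F w n (t j) x
    rw [hfun]
    refine BijOn.comp (t := W w n j) ?_ ?_
    · exact ⟨fun y hy => hy.2, h.target_injOn hvN (ht j) hsr.le hzv,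
        (h.target_image hvN (ht j) hsr.le hzv).superset⟩
    · rw [hUeq]
      exact ⟨fun y hy => hy.2, h.shadow_injOn hw h2δ hball,
        (h.shadow_image hw hhyp h2δ hball).superset⟩
  · intro x hx
    rw [Finset.prod_range_add]
    -- `n` is a hyperbolic time of `q i`, not necessarily of `x`. The near-constancy of `lam` on
    -- `ρ`-balls costs `exp η` per step, which the rate `2η` can afford.
    have h1 : ∏ l ∈ Finset.range n, lam (w l) (randIter F w l x) ≤ Real.exp (-η) ^ n := by
      refine le_trans (Finset.prod_le_prod (fun l _ => (h.lam_pos _ (hw l) _).le) fun l hl => ?_)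
        (by simpa using prod_le_of_hypTime hhyp (Nat.zero_le n))
      rw [Finset.mem_range] at hl
      exact h.lam_near _ (hw l) _ _ (by rw [dist_comm]; exact hclose x hx l hl.le)
    have h2 : ∏ l ∈ Finset.range (t j), lam (w (n + l)) (randIter F w (n + l) x) ≤ Λ ^ M := by
      calc _ ≤ ∏ l ∈ Finset.range (t j), Λ := Finset.prod_le_prod
            (fun l _ => (h.lam_pos _ (hw _) _).le) fun l _ => h.lam_le _ (hw _) _
        _ = Λ ^ t j := by simp
        _ ≤ _ := pow_le_pow_right₀ h.one_le_Λ (ht j)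
    calc _ ≤ Real.exp (-η) ^ n * Λ ^ M := mul_le_mul h1 h2
          (Finset.prod_nonneg fun l _ => (h.lam_pos _ (hw _) _).le) (by positivity)
      _ ≤ Real.exp (-η) ^ n₀ * Λ ^ M := by
          gcongr ?_ * _
          exact pow_le_pow_of_le_one hσ0.le hσ1.le hn₀i
      _ < 1 / 2 := hn₀
  · intro x hx y hy
    rw [Finset.sum_range_add]
    set d := dist (randIter F w (n + t j) x) (randIter F w (n + t j) y) with hd
    have hd0 : 0 ≤ d := dist_nonneg
    have hL := h.L_nonneg
    have hbase : dist (randIter F w n x) (randIter F w n y) ≤ Θ * d := by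
      simpa using hcon x hx y hy 0 (Nat.zero_le _)
    have h1 : ∑ l ∈ Finset.range n, (Real.log (J (w l) (randIter F w l x)) -
        Real.log (J (w l) (randIter F w l y))) ≤ L / (1 - Real.exp (-η)) * Θ * d := by
      calc _ ≤ ∑ l ∈ Finset.range n, L * (Real.exp (-η) ^ (n - l) * (Θ * d)) := by
            refine Finset.sum_le_sum fun l hl => ?_
            rw [Finset.mem_range] at hl
            have hxy : dist (randIter F w l x) (randIter F w l y) < ρ := by
              have := dist_triangle_right (randIter F w l x) (randIter F w l y)
                (randIter F w l (q i))
              have := hclose2 x hx l hl.le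
              have := hclose2 y hy l hl.le
              linarith
            refine (le_abs_self _).trans ((h.logJ_lip _ (hw l) _ _ hxy).trans ?_)
            refine mul_le_mul_of_nonneg_left ?_ hL
            refine (h.dist_le_of_hypTime hw hhyp (hclose x hx) (hclose y hy) hl.le).trans ?_
            exact mul_le_mul_of_nonneg_left hbase (by positivity)
        _ ≤ L * (Θ * d) / (1 - Real.exp (-η)) := h.sum_le_of_hypTime (by positivity) n
        _ = _ := by ring
    have h2 : ∑ l ∈ Finset.range (t j), (Real.log (J (w (n + l)) (randIter F w (n + l) x)) -
        Real.log (J (w (n + l)) (randIter F w (n + l) y))) ≤ M * (L * Θ) * d := by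
      calc _ ≤ ∑ l ∈ Finset.range (t j), L * (Θ * d) := by
            refine Finset.sum_le_sum fun l hl => ?_
            rw [Finset.mem_range] at hl
            have hxy : dist (randIter F w (n + l) x) (randIter F w (n + l) y) < ρ := by
              have h3 := htd x hx l hl.le
              have h4 := htd y hy l hl.le
              rw [← randIter_add] at h3 h4
              have := dist_triangle_right (randIter F w (n + l) x) (randIter F w (n + l) y)
                (randIter F v l (z j))
              linarith
            refine (le_abs_self _).trans ((h.logJ_lip _ (hw _) _ _ hxy).trans ?_)
            exact mul_le_mul_of_nonneg_left (hcon x hx y hy l hl.le) hL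
        _ = t j * (L * (Θ * d)) := by simp
        _ ≤ M * (L * (Θ * d)) := by
            gcongr
            exact ht j
        _ = _ := by ring
    nlinarith

end LocalControl

/-! ### From the hypotheses on random orbits to the induced map -/

lemma ae_infinitePi_forall {T : Type*} [MeasurableSpace T] {θ : Measure T}
    [IsProbabilityMeasure θ] {p : T → Prop} (hp : ∀ᵐ t ∂θ, p t) :
    ∀ᵐ w ∂(Measure.infinitePi fun _ : ℕ => θ), ∀ n, p (w n) := by
  rw [ae_all_iff]
  intro n
  exact (measurePreserving_eval_infinitePi (fun _ : ℕ => θ) n).quasiMeasurePreserving.ae hp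

/-- The iterated joint continuity of the family: this lets a connecting orbit of the unperturbed map
persist for all noise sequences with values near `t₀`. -/
lemma exists_nhds_randIter_mem {T X : Type*} [TopologicalSpace T] [TopologicalSpace X]
    {F : T → X → X} (hF : Continuous (Function.uncurry F)) (t₀ : T) (z : X) (n : ℕ) :
    ∀ V ∈ 𝓝 ((F t₀)^[n] z), ∃ N ∈ 𝓝 t₀, ∀ w : ℕ → T, (∀ i, w i ∈ N) → randIter F w n z ∈ V := by
  induction n with
  | zero => exact fun V hV => ⟨univ, univ_mem, fun w _ => mem_of_mem_nhds hV⟩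
  | succ n ih =>
    intro V hV
    rw [Function.iterate_succ_apply'] at hV
    have h1 : Function.uncurry F ⁻¹' V ∈ 𝓝 (t₀, (F t₀)^[n] z) := hF.continuousAt hV
    rw [nhds_prod_eq, mem_prod_iff] at h1
    obtain ⟨N₁, hN₁, V₁, hV₁, hsub⟩ := h1
    obtain ⟨N₂, hN₂, h2⟩ := ih V₁ hV₁
    refine ⟨N₁ ∩ N₂, inter_mem hN₁ hN₂, fun w hw => ?_⟩
    exact hsub (mk_mem_prod (hw n).1 (h2 w fun i => (hw i).2))

namespace LocalControl

variable {T X : Type*} [MetricSpace X] [MeasurableSpace X] {μ : Measure X}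
  {F : T → X → X} {lam J : T → X → ℝ} {N : Set T} {η ρ Λ Jm L : ℝ} {w : ℕ → T}

lemma isOpenMap (h : LocalControl μ F lam J N η ρ Λ Jm L) {t : T} (ht : t ∈ N) :
    IsOpenMap (F t) := by
  rw [isOpenMap_iff_nhds_le]
  intro x V hV
  rw [mem_map] at hV
  obtain ⟨e, he, hsub⟩ := Metric.mem_nhds_iff.1 hV
  have hc : 0 < Real.exp η * lam t x := mul_pos (Real.exp_pos _) (h.lam_pos t ht x)
  refine Metric.mem_nhds_iff.2 ⟨min ρ (e / (Real.exp η * lam t x)),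
    lt_min h.ρ_pos (div_pos he hc), fun y hy => ?_⟩
  rw [Metric.mem_ball, lt_min_iff, lt_div_iff₀ hc] at hy
  obtain ⟨u, rfl, hu⟩ := h.surj t ht x y hy.1
  exact hsub (Metric.mem_ball.2 (hu.trans_lt (by linarith [hy.2])))

variable [MeasurableSpace T] [BorelSpace X] [CompactSpace X] {θ : Measure T}
  [IsProbabilityMeasure θ]

/-- Fubini exchanges the two almost-everywhere quantifiers, so almost every single map preserves `A`
up to a null set. The exceptional sets are pulled back along the orbit, where they remain null. -/
lemma ae_invariant [SFinite μ] (h : LocalControl μ F lam J N η ρ Λ Jm L)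
    (hF : Measurable (Function.uncurry F)) (hN : ∀ᵐ t ∂θ, t ∈ N) {A : Set X}
    (hA : MeasurableSet A) (hinv : ∀ᵐ x ∂μ, x ∈ A → ∀ᵐ t ∂θ, F t x ∈ A) :
    ∀ᵐ w ∂(Measure.infinitePi fun _ : ℕ => θ), ∀ᵐ x ∂μ, x ∈ A → ∀ n, randIter F w n x ∈ A := by
  have hswap : ∀ᵐ t ∂θ, ∀ᵐ x ∂μ, x ∈ A → F t x ∈ A := by
    have hm : MeasurableSet {a : T × X | a.2 ∈ A → F a.1 a.2 ∈ A} := by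
      have : {a : T × X | a.2 ∈ A → F a.1 a.2 ∈ A} =
          (Prod.snd ⁻¹' A)ᶜ ∪ Function.uncurry F ⁻¹' A := by
        ext a; simp [imp_iff_not_or, Function.uncurry]
      rw [this]
      exact (measurable_snd hA).compl.union (hF hA)
    refine (Measure.ae_ae_comm (p := fun t x => x ∈ A → F t x ∈ A) hm).2 ?_
    filter_upwards [hinv] with x hx
    by_cases hxA : x ∈ A
    · filter_upwards [hx hxA] with t ht _ using ht
    · exact Eventually.of_forall fun t hA => absurd hA hxA
  filter_upwards [ae_infinitePi_forall (hN.and hswap)] with w hw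
  have hstep : ∀ n, ∀ᵐ x ∂μ, randIter F w n x ∈ A → randIter F w (n + 1) x ∈ A := fun n => by
    have hZ : μ {y | ¬ (y ∈ A → F (w n) y ∈ A)} = 0 := (hw n).2
    have hZm : MeasurableSet {y | ¬ (y ∈ A → F (w n) y ∈ A)} := by
      have : {y | ¬ (y ∈ A → F (w n) y ∈ A)} = A ∩ (F (w n) ⁻¹' A)ᶜ := by
        ext y; simp
      rw [this]
      exact hA.inter ((h.cont _ (hw n).1).measurable hA).compl
    exact h.measure_preimage_iter_null (fun i => (hw i).1) n hZm hZ
  filter_upwards [ae_all_iff.2 hstep] with x hx hxA n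
  induction n with
  | zero => exact hxA
  | succ n ih => exact hx n ih

lemma ae_frequently_hypTime [SFinite μ] (h : LocalControl μ F lam J N η ρ Λ Jm L)
    (hN : ∀ᵐ t ∂θ, t ∈ N) {A : Set X} (hA : MeasurableSet A)
    (hNU : ∀ᵐ a ∂((Measure.infinitePi fun _ : ℕ => θ).prod (μ.restrict A)),
      (∀ i, a.1 i ∈ N) → ∃ᶠ n : ℕ in atTop, (1 / (n : ℝ)) * ∑ j ∈ Finset.range n,
        Real.log (lam (a.1 j) (randIter F a.1 j a.2)) < -(4 * η)) :
    ∀ᵐ w ∂(Measure.infinitePi fun _ : ℕ => θ), ∀ᵐ x ∂μ, x ∈ A →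
      ∃ᶠ n in atTop, HypTime F lam η w n x := by
  filter_upwards [Measure.ae_ae_of_ae_prod hNU, ae_infinitePi_forall hN] with w hw hwN
  rw [ae_restrict_iff' hA] at hw
  filter_upwards [hw] with x hx hxA
  exact frequently_hypTime h.η_pos rfl (fun j => h.lam_pos _ (hwN j) _) (hx hxA hwN)

/-- The abstract form of the theorem. The ball is found with one noise level and one noise sequence,
and its centre is adjusted with the unperturbed map alone; hence the same ball serves all small
noise levels. The radius is below `1` because the statement is later applied to a distance truncated
at `1`. -/
theorem exists_ball_induced [TopologicalSpace T] [OpensMeasurableSpace T] [IsFiniteMeasure μ]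
    [μ.IsOpenPosMeasure] (h : LocalControl μ F lam J N η ρ Λ Jm L) (hNo : IsOpen N)
    (hFc : Continuous (Function.uncurry F)) (hF : Measurable (Function.uncurry F))
    (hlam : Measurable (Function.uncurry lam))
    {t₀ : T} (ht₀ : t₀ ∈ N) {θ : ℝ → Measure T} [∀ ε, IsProbabilityMeasure (θ ε)]
    (hθ : SupportsTendTo θ t₀) {A : Set X} (hA : MeasurableSet A) (hA0 : μ A ≠ 0)
    (hinv : ∀ᶠ ε in 𝓝[>] (0 : ℝ), ∀ᵐ x ∂μ, x ∈ A → ∀ᵐ t ∂θ ε, F t x ∈ A)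
    (htrans : TopTransitiveIn (F t₀) A)
    (hNU : ∀ᶠ ε in 𝓝[>] (0 : ℝ),
      ∀ᵐ a ∂((Measure.infinitePi fun _ : ℕ => θ ε).prod (μ.restrict A)),
        (∀ i, a.1 i ∈ N) → ∃ᶠ n : ℕ in atTop, (1 / (n : ℝ)) * ∑ j ∈ Finset.range n,
        Real.log (lam (a.1 j) (randIter F a.1 j a.2)) < -(4 * η)) :
    ∃ (p : X) (r : ℝ), 0 < r ∧ r < 1 ∧ μ (Metric.ball p r \ A) = 0 ∧
      ∀ᶠ ε in 𝓝[>] (0 : ℝ),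
        ∃ R : (ℕ → T) → X → ℕ, Measurable (fun a : (ℕ → T) × X => R a.1 a.2) ∧
        (∀ w x, 1 ≤ R w x) ∧ ∃ κ K : ℝ, 0 < κ ∧ κ < 1 ∧ 0 < K ∧
        ∀ᵐ w ∂(Measure.infinitePi fun _ : ℕ => θ ε), (∀ i, w i ∈ N) ∧
          ∃ Q : Set (Set X), Q.Countable ∧ Q.PairwiseDisjoint id ∧
          μ (Metric.ball p r \ ⋃₀ Q) = 0 ∧
          ∀ U ∈ Q, IsOpen U ∧ U.Nonempty ∧ U ⊆ Metric.ball p r ∧ ∃ n, (∀ x ∈ U, R w x = n) ∧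
            BijOn (randIter F w n) U (Metric.ball p r) ∧
            (∀ x ∈ U, ∏ i ∈ Finset.range n, lam (w i) (randIter F w i x) < κ) ∧
            ∀ x ∈ U, ∀ y ∈ U, ∑ i ∈ Finset.range n, (Real.log (J (w i) (randIter F w i x)) -
              Real.log (J (w i) (randIter F w i y))) ≤
                K * dist (randIter F w n x) (randIter F w n y) := by
  classical
  have hρ := h.ρ_pos
  have hsupp : ∀ V ∈ 𝓝 t₀, ∀ᶠ ε in 𝓝[>] (0 : ℝ), ∀ᵐ t ∂θ ε, t ∈ V := fun V hV => by
    filter_upwards [hθ V hV] with ε hε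
    exact measure_mono_null (compl_subset_compl.2 hε.1) hε.2
  have hgood : ∀ᶠ ε in 𝓝[>] (0 : ℝ), (∀ᵐ w ∂(Measure.infinitePi fun _ : ℕ => θ ε), ∀ i, w i ∈ N) ∧
      (∀ᵐ w ∂(Measure.infinitePi fun _ : ℕ => θ ε), ∀ᵐ x ∂μ, x ∈ A →
        ∀ n, randIter F w n x ∈ A) ∧
      ∀ᵐ w ∂(Measure.infinitePi fun _ : ℕ => θ ε), ∀ᵐ x ∂μ, x ∈ A →
        ∃ᶠ n in atTop, HypTime F lam η w n x := by
    filter_upwards [hinv, hNU, hsupp N (hNo.mem_nhds ht₀)] with ε h1 h2 h3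
    exact ⟨ae_infinitePi_forall h3, h.ae_invariant hF h3 hA h1, h.ae_frequently_hypTime h3 hA h2⟩
  obtain ⟨b₀, s₀, hs₀, hball⟩ : ∃ (b : X) (s : ℝ), 0 < s ∧ μ (Metric.ball b s \ A) = 0 := by
    obtain ⟨ε, h1, h2, h3⟩ := hgood.exists
    obtain ⟨w, hw1, hw2, hw3⟩ := (h1.and (h2.and h3)).exists
    exact h.exists_ball_diff_null hw1 hA hA0 hw2 hw3
  -- Transitivity only speaks of open sets that meet `A`; inside the ball every nonempty open set
  -- does, as it has positive measure.
  have hmeet : ∀ V : Set X, IsOpen V → V.Nonempty → V ⊆ Metric.ball b₀ s₀ → (V ∩ A).Nonempty := by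
    intro V hV hne hsub
    by_contra hem
    rw [not_nonempty_iff_eq_empty] at hem
    have h1 : μ V = 0 := measure_mono_null (fun x hx => show x ∈ Metric.ball b₀ s₀ \ A from
      ⟨hsub hx, fun hxA => (hem ▸ (⟨hx, hxA⟩ : x ∈ V ∩ A) : x ∈ (∅ : Set X))⟩) hball
    exact hne.ne_empty ((hV.measure_eq_zero_iff μ).1 h1)
  set δ := ρ / 12 with hδ
  have hδ0 : 0 < δ := by positivity
  obtain ⟨m, b, hbA, hcov⟩ : ∃ (m : ℕ) (b : Fin m → X),
      (∀ j, (Metric.ball (b j) δ ∩ A).Nonempty) ∧ ∀ x ∈ A, ∃ j, x ∈ Metric.ball (b j) δ := by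
    obtain ⟨t, -, htf, ht⟩ := (isCompact_univ (X := X)).finite_cover_balls hδ0
    have hf' : {x ∈ t | (Metric.ball x δ ∩ A).Nonempty}.Finite := htf.subset (sep_subset _ _)
    refine ⟨hf'.toFinset.card, fun j => hf'.toFinset.equivFin.symm j, fun j => ?_, fun x hx => ?_⟩
    · exact (hf'.mem_toFinset.1 (hf'.toFinset.equivFin.symm j).2).2
    · obtain ⟨y, hy, hxy⟩ := mem_iUnion₂.1 (ht (mem_univ x))
      exact ⟨hf'.toFinset.equivFin ⟨y, hf'.mem_toFinset.2 ⟨hy, ⟨x, hxy, hx⟩⟩⟩, by simpa using hxy⟩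
  have hiter : ∀ n, IsOpenMap (F t₀)^[n] := fun n => by
    induction n with
    | zero => exact IsOpenMap.id
    | succ n ih => exact ih.comp (h.isOpenMap ht₀)
  set O : Fin m → Set X := fun j => ⋃ n, (F t₀)^[n] '' Metric.ball (b j) δ with hO
  have hOo : ∀ j, IsOpen (O j) := fun j => isOpen_iUnion fun n => hiter n _ Metric.isOpen_ball
  -- The sets `O j` of points reached from the `j`-th small ball are open, and transitivity lets
  -- each of them meet any nonempty open subset of the ball. Shrinking successively gives a common
  -- point `p` of all of them.
  have hV : ∀ s : Finset (Fin m), ∃ V : Set X, IsOpen V ∧ V.Nonempty ∧ V ⊆ Metric.ball b₀ s₀ ∧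
      ∀ j ∈ s, V ⊆ O j := by
    intro s
    induction s using Finset.induction_on with
    | empty => exact ⟨_, Metric.isOpen_ball, ⟨b₀, Metric.mem_ball_self hs₀⟩, Subset.rfl, by simp⟩
    | insert j s _ ih =>
      obtain ⟨V, hVo, hVne, hVsub, hVO⟩ := ih
      obtain ⟨n, x, hx, hxV⟩ := htrans _ V Metric.isOpen_ball hVo (hbA j) (hmeet V hVo hVne hVsub)
      refine ⟨V ∩ O j, hVo.inter (hOo j), ⟨_, hxV.1, mem_iUnion.2 ⟨n, x, hx.1, rfl⟩⟩,
        inter_subset_left.trans hVsub, fun j' hj' => ?_⟩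
      rcases Finset.mem_insert.1 hj' with rfl | hj'
      · exact inter_subset_right
      · exact inter_subset_left.trans (hVO j' hj')
  obtain ⟨V, -, ⟨p, hp⟩, hVsub, hVO⟩ := hV Finset.univ
  have hz : ∀ j, ∃ (n : ℕ) (z : X), z ∈ Metric.ball (b j) δ ∧ (F t₀)^[n] z = p := fun j => by
    obtain ⟨n, z, hz, hzp⟩ := mem_iUnion.1 (hVO j (Finset.mem_univ j) hp)
    exact ⟨n, z, hz, hzp⟩
  choose t z hzb hzp using hz
  set M := Finset.univ.sup t with hM
  have ht : ∀ j, t j ≤ M := fun j => Finset.le_sup (Finset.mem_univ j)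
  obtain ⟨s, hs0, hs, hzs⟩ : ∃ s : ℝ, 0 < s ∧ 2 * s < ρ ∧
      ∀ j, Metric.ball (z j) s ⊆ Metric.ball (b j) δ := by
    have h1 : ∀ j, ∀ᶠ s in 𝓝[>] (0 : ℝ), Metric.ball (z j) s ⊆ Metric.ball (b j) δ := fun j => by
      obtain ⟨e, he, hsub⟩ := Metric.isOpen_iff.1 Metric.isOpen_ball _ (hzb j)
      filter_upwards [Ioo_mem_nhdsGT he] with s hs
      exact (Metric.ball_subset_ball hs.2.le).trans hsub
    obtain ⟨s, h2, h3⟩ := ((eventually_all.2 h1).and (Ioo_mem_nhdsGT (half_pos hρ))).exists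
    exact ⟨s, h3.1, by linarith [h3.2], h2⟩
  have hΘ1 : 1 ≤ (Real.exp η * Λ) ^ M := one_le_pow₀
    (one_le_mul_of_one_le_of_one_le (Real.one_le_exp h.η_pos.le) h.one_le_Λ)
  set Θ := (Real.exp η * Λ) ^ M with hΘ
  obtain ⟨e, he, hpe⟩ := Metric.isOpen_iff.1 Metric.isOpen_ball p (hVsub hp)
  -- The bound `e` keeps the ball in `A` up to a null set. The perturbed connecting orbit will end
  -- within `r` of `p`, so it is within `2 * r` of any point of the ball, and `Θ * (2 * r) < s` lets
  -- inverse branches return to `z j` within `s`.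
  obtain ⟨r, hr, hfr⟩ : ∃ r ∈ Ioo 0 (min (min e 1) (s / (2 * Θ))),
      μ (frontier (Metric.ball p r)) = 0 := by
    simpa only [Metric.thickening_singleton] using exists_null_frontier_thickening μ {p}
      (show (0 : ℝ) < min (min e 1) (s / (2 * Θ)) by positivity)
  obtain ⟨hr0, hr1⟩ := hr
  rw [lt_min_iff, lt_min_iff, lt_div_iff₀ (by positivity)] at hr1
  have hrA : μ (Metric.ball p r \ A) = 0 := measure_mono_null
    (sdiff_subset_sdiff_left ((Metric.ball_subset_ball hr1.1.1.le).trans hpe)) hball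
  obtain ⟨N₁, hN₁, hNz⟩ : ∃ N₁ ∈ 𝓝 t₀, ∀ w : ℕ → T, (∀ i, w i ∈ N₁) →
      ∀ j, randIter F w (t j) (z j) ∈ Metric.ball p r := by
    have h1 : ∀ j, ∃ N₁ ∈ 𝓝 t₀, ∀ w : ℕ → T, (∀ i, w i ∈ N₁) →
        randIter F w (t j) (z j) ∈ Metric.ball p r := fun j =>
      exists_nhds_randIter_mem hFc t₀ (z j) (t j) _
        (by rw [hzp j]; exact Metric.ball_mem_nhds p hr0)
    choose N₁ hN₁ h2 using h1
    exact ⟨⋂ j, N₁ j, iInter_mem.2 hN₁, fun w hw j => h2 j w fun i => mem_iInter.1 (hw i) j⟩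
  obtain ⟨N₂, hN₂, hN₂o, ht₂⟩ := mem_nhds_iff.1 (inter_mem hN₁ (hNo.mem_nhds ht₀))
  have h' := h.mono (hN₂.trans inter_subset_right)
  refine ⟨p, r, hr0, hr1.1.2, hrA, ?_⟩
  filter_upwards [hgood, hsupp N₂ (hN₂o.mem_nhds ht₂)] with ε hε hε₂
  obtain ⟨R, hRm, hR1, κ, K, hκ0, hκ1, hK, hQ⟩ := h'.exists_induced hF hlam hN₂o.measurableSet
    hδ0 (by linarith) hr0 hfr (b := b) (z := z) (t := t) hs ht hzs (fun w hw j y hy => by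
      have h1 := hNz w (fun i => (hN₂ (hw i)).1) j
      have h2 := dist_triangle_right y (randIter F w (t j) (z j)) p
      rw [Metric.mem_ball] at h1 hy
      calc Θ * dist y (randIter F w (t j) (z j)) < Θ * (2 * r) := by
            gcongr; linarith
        _ ≤ s := by linarith [hr1.2])
    (P := Measure.infinitePi fun _ : ℕ => θ ε) (by
      filter_upwards [hε.2.1, hε.2.2, ae_infinitePi_forall hε₂] with w h1 h2 h3
      refine ⟨h3, ?_⟩
      filter_upwards [h1, h2, measure_eq_zero_iff_ae_notMem.1 hrA] with x hx1 hx2 hx3 hxp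
      have hxA : x ∈ A := by_contra fun hxA => hx3 ⟨hxp, hxA⟩
      exact (hx2 hxA).mono fun n hn => ⟨hn, hcov _ (hx1 hxA n)⟩)
  refine ⟨R, hRm, hR1, κ, K, hκ0, hκ1, hK, ?_⟩
  filter_upwards [hQ] with w hw
  exact ⟨fun i => (hN₂ (hw.1 i)).2, hw.2⟩

end LocalControl

/-! ### Gram determinants -/

section Gram

variable {V W : Type*} [NormedAddCommGroup V] [InnerProductSpace ℝ V]
  [NormedAddCommGroup W] [InnerProductSpace ℝ W]

lemma gram_sum_smul {m n : Type*} [Fintype n] (P : Matrix m n ℝ) (v : n → V) :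
    Matrix.gram ℝ (fun i => ∑ k, P i k • v k) = P * Matrix.gram ℝ v * P.transpose := by
  ext i j
  simp only [Matrix.gram_apply, Matrix.mul_apply, Matrix.transpose_apply, sum_inner, inner_sum,
    real_inner_smul_left, real_inner_smul_right, Finset.sum_mul]
  exact Finset.sum_congr rfl fun k _ => Finset.sum_congr rfl fun l _ => by ring

lemma det_gram_sum_smul {n : Type*} [Fintype n] [DecidableEq n] (P : Matrix n n ℝ) (v : n → V) :
    (Matrix.gram ℝ (fun i => ∑ k, P i k • v k)).det = P.det ^ 2 * (Matrix.gram ℝ v).det := by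
  rw [gram_sum_smul, Matrix.det_mul, Matrix.det_mul, Matrix.det_transpose]
  ring

lemma det_gram_comp_equiv {m n : Type*} [Fintype n] [DecidableEq n] [Fintype m] [DecidableEq m]
    (e : m ≃ n) (v : n → V) : (Matrix.gram ℝ (v ∘ e)).det = (Matrix.gram ℝ v).det :=
  Matrix.det_submatrix_equiv_self e (Matrix.gram ℝ v)

/-- The Gram determinant of the images of `d` vectors under a linear map. -/
lemma sqrt_det_gram_map [FiniteDimensional ℝ V] {d : ℕ} (hd : Module.finrank ℝ V = d)
    (L : V →L[ℝ] W) (v : Fin d → V) :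
    Real.sqrt (Matrix.gram ℝ (fun i => L (v i))).det =
      absDet L * Real.sqrt (Matrix.gram ℝ v).det := by
  set b := (stdOrthonormalBasis ℝ V).reindex (finCongr hd) with hb
  set P : Matrix (Fin d) (Fin d) ℝ := Matrix.of fun i k => inner ℝ (b k) (v i) with hP
  have hv : v = fun i => ∑ k, P i k • b k := by
    ext1 i; exact (b.sum_repr' (v i)).symm
  have hLv : (fun i => L (v i)) = fun i => ∑ k, P i k • L (b k) := by
    ext1 i
    conv_lhs => rw [hv]
    simp [map_sum]
  have h1 : (Matrix.gram ℝ b).det = 1 := by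
    have : Matrix.gram ℝ b = 1 := by
      ext i j
      rw [Matrix.gram_apply, orthonormal_iff_ite.1 b.orthonormal, Matrix.one_apply]
    rw [this, Matrix.det_one]
  have h2 : (Matrix.gram ℝ fun i => L (b i)).det =
      (Matrix.gram ℝ fun i => L (stdOrthonormalBasis ℝ V i)).det := by
    have : (fun i => L (b i)) = (fun i => L (stdOrthonormalBasis ℝ V i)) ∘ (finCongr hd).symm := by
      ext1 i; simp [hb]
    rw [this, det_gram_comp_equiv]
  rw [hLv, det_gram_sum_smul, h2]
  conv_rhs => rw [hv, det_gram_sum_smul, h1]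
  rw [Real.sqrt_mul (sq_nonneg _), mul_one, mul_comm]
  rfl

end Gram

/-! ### The Riemannian metric and derivatives in coordinates

The tangent spaces are identified with the model space, so that the base point may be rewritten. -/

section Coordinates

variable (d : ℕ) {M : Type*} [EMetricSpace M] [ChartedSpace (EuclideanSpace ℝ (Fin d)) M]

/-- The derivative of the inverse of the chart around `x`. -/
noncomputable def chartDeriv (x : M) (y : EuclideanSpace ℝ (Fin d)) :
    EuclideanSpace ℝ (Fin d) →L[ℝ] EuclideanSpace ℝ (Fin d) :=
  mfderiv (𝓡 d) (𝓡 d) (extChartAt (𝓡 d) x).symm y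

/-- The derivative of a map, as an endomorphism of the model space. -/
noncomputable def modelDeriv (g : M → M) (x : M) :
    EuclideanSpace ℝ (Fin d) →L[ℝ] EuclideanSpace ℝ (Fin d) :=
  mfderiv (𝓡 d) (𝓡 d) g x

/-- The representative of a map in the charts around `x` and `y`. -/
noncomputable def chartRep (g : M → M) (x y : M) :
    EuclideanSpace ℝ (Fin d) → EuclideanSpace ℝ (Fin d) :=
  extChartAt (𝓡 d) y ∘ g ∘ (extChartAt (𝓡 d) x).symm

variable [RiemannianBundle (fun x : M => TangentSpace (𝓡 d) x)]

/-- The Riemannian metric as a form on the model space. -/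
noncomputable def riemForm (x : M) (v w : EuclideanSpace ℝ (Fin d)) : ℝ :=
  inner ℝ (show TangentSpace (𝓡 d) x from v) (show TangentSpace (𝓡 d) x from w)

/-- The Riemannian metric in the chart around `x`. -/
noncomputable def chartForm (x : M) (y v w : EuclideanSpace ℝ (Fin d)) : ℝ :=
  riemForm d ((extChartAt (𝓡 d) x).symm y) (chartDeriv d x y v) (chartDeriv d x y w)

variable {d}

lemma riemForm_add_left (x : M) (u v w : EuclideanSpace ℝ (Fin d)) :
    riemForm d x (u + v) w = riemForm d x u w + riemForm d x v w :=
  inner_add_left (𝕜 := ℝ) (E := TangentSpace (𝓡 d) x) u v w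

lemma riemForm_smul_left (x : M) (c : ℝ) (v w : EuclideanSpace ℝ (Fin d)) :
    riemForm d x (c • v) w = c * riemForm d x v w :=
  real_inner_smul_left (F := TangentSpace (𝓡 d) x) v w c

lemma riemForm_comm (x : M) (v w : EuclideanSpace ℝ (Fin d)) :
    riemForm d x v w = riemForm d x w v :=
  real_inner_comm (F := TangentSpace (𝓡 d) x) w v

lemma riemForm_self (x : M) (v : EuclideanSpace ℝ (Fin d)) :
    riemForm d x v v = ‖(show TangentSpace (𝓡 d) x from v)‖ ^ 2 :=
  real_inner_self_eq_norm_sq (F := TangentSpace (𝓡 d) x) v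

lemma riemForm_self_nonneg (x : M) (v : EuclideanSpace ℝ (Fin d)) : 0 ≤ riemForm d x v v := by
  rw [riemForm_self]; positivity

lemma riemForm_self_pos (x : M) {v : EuclideanSpace ℝ (Fin d)} (hv : v ≠ 0) :
    0 < riemForm d x v v :=
  real_inner_self_pos (F := TangentSpace (𝓡 d) x).2 hv

lemma chartDensity_eq (x : M) (y : EuclideanSpace ℝ (Fin d)) :
    chartDensity d x y = Real.sqrt (Matrix.of fun i j => chartForm d x y
      (EuclideanSpace.single i 1) (EuclideanSpace.single j 1)).det := rfl

end Coordinates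

section ChartDeriv

variable {d : ℕ} {M : Type*} [EMetricSpace M] [ChartedSpace (EuclideanSpace ℝ (Fin d)) M]
  [IsManifold (𝓡 d) ∞ M]

lemma mdifferentiableAt_chart_symm {x : M} {y : EuclideanSpace ℝ (Fin d)}
    (hy : y ∈ (extChartAt (𝓡 d) x).target) :
    MDifferentiableAt (𝓡 d) (𝓡 d) (extChartAt (𝓡 d) x).symm y :=
  ((contMDiffOn_extChartAt_symm (n := 1) x).mdifferentiableOn one_ne_zero y hy).mdifferentiableAt
    ((isOpen_extChartAt_target x).mem_nhds hy)

lemma mfderivWithin_chart_symm_eq (x : M) (y : EuclideanSpace ℝ (Fin d)) :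
    mfderivWithin 𝓘(ℝ, EuclideanSpace ℝ (Fin d)) (𝓡 d) (extChartAt (𝓡 d) x).symm (range (𝓡 d)) y =
      mfderiv (𝓡 d) (𝓡 d) (extChartAt (𝓡 d) x).symm y := by
  rw [show range (𝓡 d) = univ by simp, mfderivWithin_univ]

lemma chartDeriv_injective {x : M} {y : EuclideanSpace ℝ (Fin d)}
    (hy : y ∈ (extChartAt (𝓡 d) x).target) : Function.Injective (chartDeriv d x y) := by
  have h := isInvertible_mfderivWithin_extChartAt_symm (I := 𝓡 d) hy
  rw [mfderivWithin_chart_symm_eq] at h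
  exact h.injective

/-- Both sides are the derivative at `z` of `g` composed with the inverse chart, which near `z` also
equals the inverse chart around `y` composed with the representative. -/
lemma modelDeriv_comp_chartDeriv {g : M → M} {x y : M} {z : EuclideanSpace ℝ (Fin d)}
    (hz : z ∈ (extChartAt (𝓡 d) x).target)
    (hg : MDifferentiableAt (𝓡 d) (𝓡 d) g ((extChartAt (𝓡 d) x).symm z))
    (hgz : g ((extChartAt (𝓡 d) x).symm z) ∈ (extChartAt (𝓡 d) y).source) :
    modelDeriv d g ((extChartAt (𝓡 d) x).symm z) ∘L chartDeriv d x z =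
      chartDeriv d y (chartRep d g x y z) ∘L fderiv ℝ (chartRep d g x y) z := by
  have h1 : MDifferentiableAt (𝓡 d) (𝓡 d) (extChartAt (𝓡 d) x).symm z :=
    mdifferentiableAt_chart_symm hz
  have hcomp : MDifferentiableAt (𝓡 d) (𝓡 d) (g ∘ (extChartAt (𝓡 d) x).symm) z := hg.comp z h1
  have hψ : MDifferentiableAt (𝓡 d) (𝓡 d) (extChartAt (𝓡 d) y)
      ((g ∘ (extChartAt (𝓡 d) x).symm) z) :=
    mdifferentiableAt_extChartAt (by simpa using hgz)
  have hrep : MDifferentiableAt (𝓡 d) (𝓡 d) (chartRep d g x y) z := hψ.comp z hcomp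
  have htar : chartRep d g x y z ∈ (extChartAt (𝓡 d) y).target :=
    (extChartAt (𝓡 d) y).map_source hgz
  have hsymm : MDifferentiableAt (𝓡 d) (𝓡 d) (extChartAt (𝓡 d) y).symm (chartRep d g x y z) :=
    mdifferentiableAt_chart_symm htar
  have heq : g ∘ (extChartAt (𝓡 d) x).symm =ᶠ[𝓝 z]
      (extChartAt (𝓡 d) y).symm ∘ chartRep d g x y := by
    have : (g ∘ (extChartAt (𝓡 d) x).symm) ⁻¹' (extChartAt (𝓡 d) y).source ∈ 𝓝 z :=
      hcomp.continuousAt ((isOpen_extChartAt_source y).mem_nhds hgz)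
    filter_upwards [this] with u hu
    exact ((extChartAt (𝓡 d) y).left_inv hu).symm
  have e1 : mfderiv (𝓡 d) (𝓡 d) (g ∘ (extChartAt (𝓡 d) x).symm) z =
      (mfderiv (𝓡 d) (𝓡 d) g ((extChartAt (𝓡 d) x).symm z)).comp
        (mfderiv (𝓡 d) (𝓡 d) (extChartAt (𝓡 d) x).symm z) := mfderiv_comp z hg h1
  have e2 : mfderiv (𝓡 d) (𝓡 d) ((extChartAt (𝓡 d) y).symm ∘ chartRep d g x y) z =
      (mfderiv (𝓡 d) (𝓡 d) (extChartAt (𝓡 d) y).symm (chartRep d g x y z)).comp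
        (mfderiv (𝓡 d) (𝓡 d) (chartRep d g x y) z) := mfderiv_comp z hsymm hrep
  have e3 : mfderiv (𝓡 d) (𝓡 d) (chartRep d g x y) z = fderiv ℝ (chartRep d g x y) z :=
    mfderiv_eq_fderiv
  have e4 := heq.mfderiv_eq (I := 𝓡 d) (I' := 𝓡 d)
  ext1 v
  have f1 := DFunLike.congr_fun e1 v
  have f2 := DFunLike.congr_fun e2 v
  have f4 := DFunLike.congr_fun e4 v
  rw [e3] at f2
  exact f1.symm.trans (f4.trans f2)

end ChartDeriv

section ChartForm

variable {d : ℕ} {M : Type*} [EMetricSpace M] [ChartedSpace (EuclideanSpace ℝ (Fin d)) M]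
  [IsManifold (𝓡 d) ∞ M] [RiemannianBundle (fun x : M => TangentSpace (𝓡 d) x)]

lemma contMDiff_constSection (v : EuclideanSpace ℝ (Fin d)) :
    ContMDiff (𝓡 d) (𝓡 d).tangent ∞ (fun y : EuclideanSpace ℝ (Fin d) =>
      (⟨y, v⟩ : TangentBundle (𝓡 d) (EuclideanSpace ℝ (Fin d)))) := by
  intro y
  rw [contMDiffAt_totalSpace]
  refine ⟨contMDiffAt_id, ?_⟩
  simp only [trivializationAt_model_space_apply]
  exact contMDiffAt_const

/-- Coordinate vector fields are the images of constant sections under the tangent map of the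
inverse chart, and the metric is smooth on sections. Class `C¹` is all that the later Lipschitz
bound for the density requires. -/
lemma contDiffOn_chartForm [IsContMDiffRiemannianBundle (𝓡 d) ∞ (EuclideanSpace ℝ (Fin d))
      (fun x : M => TangentSpace (𝓡 d) x)] (x : M) (v w : EuclideanSpace ℝ (Fin d)) :
    ContDiffOn ℝ 1 (fun y => chartForm d x y v w) (extChartAt (𝓡 d) x).target := by
  have key : ∀ v : EuclideanSpace ℝ (Fin d), ContMDiffOn (𝓡 d) (𝓡 d).tangent 1
      (fun y => (⟨(extChartAt (𝓡 d) x).symm y, chartDeriv d x y v⟩ : TangentBundle (𝓡 d) M))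
      (extChartAt (𝓡 d) x).target := by
    intro v
    have h1 := (contMDiffOn_extChartAt_symm (I := 𝓡 d) (n := 2) x).contMDiffOn_tangentMapWithin
      (m := 1) (by norm_num) (isOpen_extChartAt_target x).uniqueMDiffOn
    have h2 : ContMDiffOn (𝓡 d) (𝓡 d).tangent 1 (fun y : EuclideanSpace ℝ (Fin d) =>
      (⟨y, v⟩ : TangentBundle (𝓡 d) (EuclideanSpace ℝ (Fin d)))) (extChartAt (𝓡 d) x).target :=
      ((contMDiff_constSection v).of_le (by norm_cast)).contMDiffOn
    refine (h1.comp h2 fun y hy => hy).congr fun y hy => ?_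
    simp only [Function.comp, tangentMapWithin]
    rw [mfderivWithin_of_isOpen (isOpen_extChartAt_target x) hy]
    rfl
  have : IsContMDiffRiemannianBundle (𝓡 d) 1 (EuclideanSpace ℝ (Fin d))
      (fun x : M => TangentSpace (𝓡 d) x) :=
    IsContMDiffRiemannianBundle.of_le (n := ∞) (by norm_cast)
  have := ContMDiffOn.inner_bundle (IB := 𝓡 d) (F := EuclideanSpace ℝ (Fin d))
    (E := fun x : M => TangentSpace (𝓡 d) x) (n := 1) (key v) (key w)
  exact contMDiffOn_iff_contDiffOn.1 this

lemma chartForm_add_left (x : M) (y u v w : EuclideanSpace ℝ (Fin d)) :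
    chartForm d x y (u + v) w = chartForm d x y u w + chartForm d x y v w := by
  rw [chartForm, map_add, riemForm_add_left]; rfl

lemma chartForm_smul_left (x : M) (c : ℝ) (y v w : EuclideanSpace ℝ (Fin d)) :
    chartForm d x y (c • v) w = c * chartForm d x y v w := by
  rw [chartForm, map_smul, riemForm_smul_left]; rfl

lemma chartForm_comm (x : M) (y v w : EuclideanSpace ℝ (Fin d)) :
    chartForm d x y v w = chartForm d x y w v := riemForm_comm _ _ _

lemma chartForm_self_nonneg (x : M) (y v : EuclideanSpace ℝ (Fin d)) : 0 ≤ chartForm d x y v v :=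
  riemForm_self_nonneg _ _

lemma chartForm_self_pos {x : M} {y v : EuclideanSpace ℝ (Fin d)}
    (hy : y ∈ (extChartAt (𝓡 d) x).target) (hv : v ≠ 0) : 0 < chartForm d x y v v :=
  riemForm_self_pos _ fun h => hv (chartDeriv_injective hy (by rw [h, map_zero]))

lemma chartForm_sum_left {ι : Type*} (s : Finset ι) (x : M) (y w : EuclideanSpace ℝ (Fin d))
    (a : ι → ℝ) (u : ι → EuclideanSpace ℝ (Fin d)) :
    chartForm d x y (∑ i ∈ s, a i • u i) w = ∑ i ∈ s, a i * chartForm d x y (u i) w := by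
  classical
  induction s using Finset.induction_on with
  | empty => simpa using chartForm_smul_left x 0 y 0 w
  | insert i s hi ih => rw [Finset.sum_insert hi, chartForm_add_left, chartForm_smul_left, ih,
      Finset.sum_insert hi]

lemma sum_smul_single (v : EuclideanSpace ℝ (Fin d)) :
    ∑ i, v i • (EuclideanSpace.single i (1 : ℝ) : EuclideanSpace ℝ (Fin d)) = v := by
  simpa using (EuclideanSpace.basisFun (Fin d) ℝ).sum_repr v

lemma chartForm_eq_sum (x : M) (y v w : EuclideanSpace ℝ (Fin d)) :
    chartForm d x y v w = ∑ i, ∑ j, v i * (w j * chartForm d x y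
      (EuclideanSpace.single i 1) (EuclideanSpace.single j 1)) := by
  conv_lhs => rw [← sum_smul_single v, chartForm_sum_left]
  refine Finset.sum_congr rfl fun i _ => ?_
  rw [chartForm_comm]
  conv_lhs => rw [← sum_smul_single w, chartForm_sum_left]
  rw [Finset.mul_sum]
  exact Finset.sum_congr rfl fun j _ => by rw [chartForm_comm]

lemma chartDensity_eq_gram (x : M) (y : EuclideanSpace ℝ (Fin d)) :
    chartDensity d x y = Real.sqrt (Matrix.gram ℝ (fun i : Fin d =>
      (show TangentSpace (𝓡 d) ((extChartAt (𝓡 d) x).symm y) from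
        chartDeriv d x y (EuclideanSpace.single i 1)))).det := rfl

lemma det_chartForm_pos {x : M} {y : EuclideanSpace ℝ (Fin d)}
    (hy : y ∈ (extChartAt (𝓡 d) x).target) :
    0 < (Matrix.of fun i j : Fin d => chartForm d x y
      (EuclideanSpace.single i 1) (EuclideanSpace.single j 1)).det := by
  have hli : LinearIndependent ℝ (fun i : Fin d =>
      (show TangentSpace (𝓡 d) ((extChartAt (𝓡 d) x).symm y) from
        chartDeriv d x y (EuclideanSpace.single i 1))) := by
    have h1 : LinearIndependent ℝ (fun i : Fin d =>
        (EuclideanSpace.single i (1 : ℝ) : EuclideanSpace ℝ (Fin d))) := by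
      have h := (EuclideanSpace.basisFun (Fin d) ℝ).toBasis.linearIndependent
      rw [show ⇑(EuclideanSpace.basisFun (Fin d) ℝ).toBasis = fun i : Fin d =>
        (EuclideanSpace.single i (1 : ℝ) : EuclideanSpace ℝ (Fin d)) by ext1 i; simp] at h
      exact h
    exact h1.map' (chartDeriv d x y).toLinearMap
      (LinearMap.ker_eq_bot.2 (chartDeriv_injective hy))
  exact (Matrix.posDef_gram_of_linearIndependent hli).det_pos

lemma chartDensity_pos {x : M} {y : EuclideanSpace ℝ (Fin d)}
    (hy : y ∈ (extChartAt (𝓡 d) x).target) : 0 < chartDensity d x y := by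
  rw [chartDensity_eq]
  exact Real.sqrt_pos.2 (det_chartForm_pos hy)

/-- The Jacobian in coordinates. -/
lemma jacobian_mul_chartDensity {g : M → M} {x y : M} {z : EuclideanSpace ℝ (Fin d)}
    (hz : z ∈ (extChartAt (𝓡 d) x).target)
    (hg : MDifferentiableAt (𝓡 d) (𝓡 d) g ((extChartAt (𝓡 d) x).symm z))
    (hgz : g ((extChartAt (𝓡 d) x).symm z) ∈ (extChartAt (𝓡 d) y).source) :
    jacobian d g ((extChartAt (𝓡 d) x).symm z) * chartDensity d x z =
      |(fderiv ℝ (chartRep d g x y) z).det| * chartDensity d y (chartRep d g x y z) := by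
  set b := (extChartAt (𝓡 d) x).symm z with hb
  have : FiniteDimensional ℝ (TangentSpace (𝓡 d) b) :=
    inferInstanceAs (FiniteDimensional ℝ (EuclideanSpace ℝ (Fin d)))
  have hfin : Module.finrank ℝ (TangentSpace (𝓡 d) b) = d :=
    finrank_euclideanSpace_fin (𝕜 := ℝ) (n := d)
  have h1 := sqrt_det_gram_map hfin (tangentDeriv d g b)
    (fun i : Fin d => (show TangentSpace (𝓡 d) b from
        chartDeriv d x z (EuclideanSpace.single i 1)))
  rw [chartDensity_eq_gram]
  refine Eq.trans h1.symm ?_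
  have hsymm : g b = (extChartAt (𝓡 d) y).symm (chartRep d g x y z) :=
    ((extChartAt (𝓡 d) y).left_inv hgz).symm
  set D := fderiv ℝ (chartRep d g x y) z with hD
  set P : Matrix (Fin d) (Fin d) ℝ := Matrix.of fun i k => D (EuclideanSpace.single i 1) k with hP
  have hdet : P.det = D.det := by
    have : P.transpose = LinearMap.toMatrix (EuclideanSpace.basisFun (Fin d) ℝ).toBasis
        (EuclideanSpace.basisFun (Fin d) ℝ).toBasis D.toLinearMap := by
      ext i j
      simp [hP, LinearMap.toMatrix_apply]
    rw [← Matrix.det_transpose, this, LinearMap.det_toMatrix]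
  have hgram : Matrix.gram ℝ (fun i : Fin d => tangentDeriv d g b
      (show TangentSpace (𝓡 d) b from chartDeriv d x z (EuclideanSpace.single i 1))) =
      Matrix.gram ℝ (fun i : Fin d => ∑ k, P i k •
        (show TangentSpace (𝓡 d) ((extChartAt (𝓡 d) y).symm (chartRep d g x y z)) from
        chartDeriv d y (chartRep d g x y z) (EuclideanSpace.single k 1))) := by
    have hv : ∀ i : Fin d, modelDeriv d g b (chartDeriv d x z (EuclideanSpace.single i 1)) =
        ∑ k, P i k • chartDeriv d y (chartRep d g x y z) (EuclideanSpace.single k 1) := by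
      intro i
      have e := DFunLike.congr_fun (modelDeriv_comp_chartDeriv hz hg hgz)
        (EuclideanSpace.single i 1)
      simp only [ContinuousLinearMap.comp_apply] at e
      rw [e, ← hD]
      conv_lhs => rw [← sum_smul_single (D _), map_sum]
      simp [hP]
    ext i j
    -- The points `g b` and the inverse chart of its coordinates are equal but not definitionally
    -- so, and their tangent spaces are different types. Passing to forms on the model space allows
    -- the base point to be rewritten.
    change riemForm d (g b) (modelDeriv d g b (chartDeriv d x z (EuclideanSpace.single i 1)))
      (modelDeriv d g b (chartDeriv d x z (EuclideanSpace.single j 1))) = _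
    rw [hv, hv, hsymm]
    rfl
  rw [hgram, det_gram_sum_smul, Real.sqrt_mul (sq_nonneg _), Real.sqrt_sq_eq_abs, hdet]
  rfl

section Smooth

variable [IsContMDiffRiemannianBundle (𝓡 d) ∞ (EuclideanSpace ℝ (Fin d))
  (fun x : M => TangentSpace (𝓡 d) x)]

lemma contDiffOn_chartDensity (x : M) :
    ContDiffOn ℝ 1 (chartDensity d x) (extChartAt (𝓡 d) x).target := by
  have h : ContDiffOn ℝ 1 (fun y => (Matrix.of fun i j : Fin d => chartForm d x y
      (EuclideanSpace.single i 1) (EuclideanSpace.single j 1)).det)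
      (extChartAt (𝓡 d) x).target := by
    simp only [Matrix.det_apply, Matrix.of_apply]
    exact ContDiffOn.sum fun σ _ => ContDiffOn.const_smul _
      (contDiffOn_prod fun i _ => contDiffOn_chartForm x _ _)
  exact (h.sqrt fun y hy => (det_chartForm_pos hy).ne').congr fun y _ => chartDensity_eq x y

lemma continuousOn_chartForm (x : M) :
    ContinuousOn (fun p : EuclideanSpace ℝ (Fin d) × EuclideanSpace ℝ (Fin d) =>
      chartForm d x p.1 p.2 p.2) ((extChartAt (𝓡 d) x).target ×ˢ univ) := by
  have : (fun p : EuclideanSpace ℝ (Fin d) × EuclideanSpace ℝ (Fin d) =>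
      chartForm d x p.1 p.2 p.2) = fun p => ∑ i, ∑ j, p.2 i * (p.2 j * chartForm d x p.1
      (EuclideanSpace.single i 1) (EuclideanSpace.single j 1)) := by
    ext1 p; exact chartForm_eq_sum _ _ _ _
  rw [this]
  refine continuousOn_finsetSum _ fun i _ => continuousOn_finsetSum _ fun j _ => ?_
  have hc : ContinuousOn (fun p : EuclideanSpace ℝ (Fin d) × EuclideanSpace ℝ (Fin d) =>
      chartForm d x p.1 (EuclideanSpace.single i 1) (EuclideanSpace.single j 1))
      ((extChartAt (𝓡 d) x).target ×ˢ univ) :=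
    (contDiffOn_chartForm x _ _).continuousOn.comp continuousOn_fst fun p hp => hp.1
  exact ContinuousOn.mul (by fun_prop) (ContinuousOn.mul (by fun_prop) hc)

end Smooth

end ChartForm

/-! ### The Jacobian in charts and its continuity -/

section JacobianContinuity

variable {d : ℕ} {M : Type*} [EMetricSpace M] [ChartedSpace (EuclideanSpace ℝ (Fin d)) M]
  [IsManifold (𝓡 d) ∞ M]

lemma contDiffAt_chartRep {n : ℕ∞} {g : M → M} {x y : M} {z : EuclideanSpace ℝ (Fin d)}
    (hz : z ∈ (extChartAt (𝓡 d) x).target)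
    (hg : ContMDiffAt (𝓡 d) (𝓡 d) n g ((extChartAt (𝓡 d) x).symm z))
    (hgz : g ((extChartAt (𝓡 d) x).symm z) ∈ (extChartAt (𝓡 d) y).source) :
    ContDiffAt ℝ n (chartRep d g x y) z := by
  have h1 : ContMDiffAt (𝓡 d) (𝓡 d) n (extChartAt (𝓡 d) x).symm z :=
    ((contMDiffOn_extChartAt_symm x) z hz).contMDiffAt
      ((isOpen_extChartAt_target x).mem_nhds hz)
  have h2 : ContMDiffAt (𝓡 d) (𝓡 d) n (extChartAt (𝓡 d) y)
      ((g ∘ (extChartAt (𝓡 d) x).symm) z) :=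
    contMDiffAt_extChartAt' (by simpa using hgz)
  exact contMDiffAt_iff_contDiffAt.1 (h2.comp z (hg.comp z h1))

variable [RiemannianBundle (fun x : M => TangentSpace (𝓡 d) x)]

lemma jacobian_eq_chart {g : M → M} {x y a : M}
    (ha : a ∈ (extChartAt (𝓡 d) x).source) (hg : MDifferentiableAt (𝓡 d) (𝓡 d) g a)
    (hga : g a ∈ (extChartAt (𝓡 d) y).source) :
    jacobian d g a = |(fderiv ℝ (chartRep d g x y) (extChartAt (𝓡 d) x a)).det| *
      chartDensity d y (extChartAt (𝓡 d) y (g a)) / chartDensity d x (extChartAt (𝓡 d) x a) := by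
  have hz := (extChartAt (𝓡 d) x).map_source ha
  have hs := (extChartAt (𝓡 d) x).left_inv ha
  have h := jacobian_mul_chartDensity (g := g) (y := y) hz (by rwa [hs]) (by rwa [hs])
  have hrep : chartRep d g x y (extChartAt (𝓡 d) x a) = extChartAt (𝓡 d) y (g a) := by
    simp only [chartRep, Function.comp, hs]
  rw [hs, hrep] at h
  rw [eq_div_iff (chartDensity_pos hz).ne', h]

variable [IsContMDiffRiemannianBundle (𝓡 d) ∞ (EuclideanSpace ℝ (Fin d))
  (fun x : M => TangentSpace (𝓡 d) x)]

lemma continuousAt_chartDensity {x : M} {y : EuclideanSpace ℝ (Fin d)}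
    (hy : y ∈ (extChartAt (𝓡 d) x).target) : ContinuousAt (chartDensity d x) y :=
  (contDiffOn_chartDensity x).continuousOn.continuousAt ((isOpen_extChartAt_target x).mem_nhds hy)

lemma continuous_jacobian {g : M → M} (hg : ContMDiff (𝓡 d) (𝓡 d) 1 g) :
    Continuous (jacobian d g) := by
  rw [continuous_iff_continuousAt]
  intro x
  have hx := mem_extChartAt_source (I := 𝓡 d) x
  have hgx := mem_extChartAt_source (I := 𝓡 d) (g x)
  have hev : ∀ᶠ a in 𝓝 x, jacobian d g a =
      |(fderiv ℝ (chartRep d g x (g x)) (extChartAt (𝓡 d) x a)).det| *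
        chartDensity d (g x) (extChartAt (𝓡 d) (g x) (g a)) /
        chartDensity d x (extChartAt (𝓡 d) x a) := by
    filter_upwards [extChartAt_source_mem_nhds (I := 𝓡 d) x, hg.continuous.continuousAt
      (extChartAt_source_mem_nhds (I := 𝓡 d) (g x))] with a ha hga
    exact jacobian_eq_chart ha (hg.mdifferentiable one_ne_zero a) hga
  refine ContinuousAt.congr ?_ (EventuallyEq.symm hev)
  have hφ : ContinuousAt (extChartAt (𝓡 d) x) x := continuousAt_extChartAt x
  have hfd : ContinuousAt (fun a => fderiv ℝ (chartRep d g x (g x)) (extChartAt (𝓡 d) x a)) x := by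
    have hcd : ContDiffAt ℝ 1 (chartRep d g x (g x)) (extChartAt (𝓡 d) x x) :=
      contDiffAt_chartRep (n := 1) ((extChartAt (𝓡 d) x).map_source hx)
        hg.contMDiffAt (by rwa [(extChartAt (𝓡 d) x).left_inv hx])
    exact (hcd.continuousAt_fderiv one_ne_zero).comp hφ
  have h1 : ContinuousAt (fun a => chartDensity d (g x) (extChartAt (𝓡 d) (g x) (g a))) x :=
    ContinuousAt.comp (f := fun a => extChartAt (𝓡 d) (g x) (g a))
      (continuousAt_chartDensity ((extChartAt (𝓡 d) (g x)).map_source hgx))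
      (ContinuousAt.comp (continuousAt_extChartAt (g x)) hg.continuous.continuousAt)
  have h2 : ContinuousAt (fun a => chartDensity d x (extChartAt (𝓡 d) x a)) x :=
    ContinuousAt.comp (f := fun a => extChartAt (𝓡 d) x a)
      (continuousAt_chartDensity ((extChartAt (𝓡 d) x).map_source hx)) hφ
  refine ContinuousAt.div (ContinuousAt.mul ?_ h1) h2
    (chartDensity_pos ((extChartAt (𝓡 d) x).map_source hx)).ne'
  exact (ContinuousLinearMap.continuous_det.continuousAt.comp hfd).abs

end JacobianContinuity

/-! ### The Riemannian volume and its change of variables formula -/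

section Volume

variable {d : ℕ} {M : Type*} [EMetricSpace M] [ChartedSpace (EuclideanSpace ℝ (Fin d)) M]
  [IsManifold (𝓡 d) ∞ M] [RiemannianBundle (fun x : M => TangentSpace (𝓡 d) x)]
  [IsContMDiffRiemannianBundle (𝓡 d) ∞ (EuclideanSpace ℝ (Fin d))
    (fun x : M => TangentSpace (𝓡 d) x)]
  [CompactSpace M] [MeasurableSpace M] [BorelSpace M]

lemma measurableSet_chart_image {x : M} {E : Set M} (hE : MeasurableSet E)
    (hEx : E ⊆ (extChartAt (𝓡 d) x).source) : MeasurableSet (extChartAt (𝓡 d) x '' E) :=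
  hE.image_of_continuousOn_injOn ((continuousOn_extChartAt x).mono hEx)
    ((extChartAt (𝓡 d) x).injOn.mono hEx)

lemma setLIntegral_chartVolume {x : M} {E : Set M} (hE : MeasurableSet E)
    (hEx : E ⊆ (extChartAt (𝓡 d) x).source) {h : M → ℝ≥0∞} (hh : Measurable h) :
    ∫⁻ a in E, h a ∂chartVolume d x = ∫⁻ y in extChartAt (𝓡 d) x '' E,
      ENNReal.ofReal (chartDensity d x y) * h ((extChartAt (𝓡 d) x).symm y) := by
  have hS := measurableSet_chart_image hE hEx
  have hSt : extChartAt (𝓡 d) x '' E ⊆ (extChartAt (𝓡 d) x).target := by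
    rintro _ ⟨a, ha, rfl⟩; exact (extChartAt (𝓡 d) x).map_source (hEx ha)
  have hT : MeasurableSet (extChartAt (𝓡 d) x).target := (isOpen_extChartAt_target x).measurableSet
  have hsymm : ∀ ν : Measure (EuclideanSpace ℝ (Fin d)), AEMeasurable (extChartAt (𝓡 d) x).symm
      (ν.restrict (extChartAt (𝓡 d) x).target) := fun ν =>
    (continuousOn_extChartAt_symm x).aemeasurable hT
  have hsymm' : ∀ ν : Measure (EuclideanSpace ℝ (Fin d)), AEMeasurable (extChartAt (𝓡 d) x).symm
      (ν.restrict (extChartAt (𝓡 d) x '' E)) := fun ν =>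
    (hsymm ν).mono_measure (Measure.restrict_mono hSt le_rfl)
  have hSeq : (extChartAt (𝓡 d) x).symm ⁻¹' E ∩ (extChartAt (𝓡 d) x).target =
      extChartAt (𝓡 d) x '' E := by
    rw [(extChartAt (𝓡 d) x).image_eq_target_inter_inv_preimage hEx, inter_comm]
  rw [chartVolume, Measure.restrict_map_of_aemeasurable (hsymm _) hE, Measure.restrict_restrict' hT,
    hSeq, lintegral_map' hh.aemeasurable (hsymm' _), restrict_withDensity hS,
    lintegral_withDensity_eq_lintegral_mul₀]
  · rfl
  · exact (((contDiffOn_chartDensity x).continuousOn.mono hSt).aemeasurable hS).ennreal_ofReal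
  · exact hh.comp_aemeasurable (hsymm' _)

lemma chartVolume_eq {x : M} {E : Set M} (hE : MeasurableSet E)
    (hEx : E ⊆ (extChartAt (𝓡 d) x).source) :
    chartVolume d x E =
      ∫⁻ y in extChartAt (𝓡 d) x '' E, ENNReal.ofReal (chartDensity d x y) := by
  have := setLIntegral_chartVolume hE hEx (h := fun _ => 1) measurable_const
  simpa using this

lemma chartVolume_compl_source (x : M) :
    chartVolume d x (extChartAt (𝓡 d) x).sourceᶜ = 0 := by
  have hT : MeasurableSet (extChartAt (𝓡 d) x).target := (isOpen_extChartAt_target x).measurableSet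
  rw [chartVolume, Measure.map_apply_of_aemeasurable
    ((continuousOn_extChartAt_symm x).aemeasurable hT)
    (isOpen_extChartAt_source x).measurableSet.compl, Measure.restrict_apply' hT]
  convert measure_empty (μ := volume.withDensity fun y => ENNReal.ofReal (chartDensity d x y))
  ext y
  simp only [mem_inter_iff, mem_preimage, mem_compl_iff, mem_empty_iff_false, iff_false]
  exact fun h => h.1 ((extChartAt (𝓡 d) x).map_target h.2)

lemma chartVolume_inter_source (x : M) (E : Set M) :
    chartVolume d x (E ∩ (extChartAt (𝓡 d) x).source) = chartVolume d x E :=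
  measure_inter_conull (chartVolume_compl_source x)

/-- The Euclidean change of variables formula for the representative, combined with the
transformation rule between the densities in the two charts. -/
lemma chartVolume_image {g : M → M} (hg : ContMDiff (𝓡 d) (𝓡 d) 1 g) {x y : M} {E : Set M}
    (hE : MeasurableSet E) (hEx : E ⊆ (extChartAt (𝓡 d) x).source)
    (hgE : MapsTo g E (extChartAt (𝓡 d) y).source) (hinj : InjOn g E) :
    chartVolume d y (g '' E) = ∫⁻ a in E, ENNReal.ofReal (jacobian d g a) ∂chartVolume d x := by
  have hgE' : MeasurableSet (g '' E) :=
    hE.image_of_continuousOn_injOn hg.continuous.continuousOn hinj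
  have himg : extChartAt (𝓡 d) y '' (g '' E) = chartRep d g x y '' (extChartAt (𝓡 d) x '' E) := by
    rw [image_image, image_image]
    refine image_congr fun a ha => ?_
    simp only [chartRep, Function.comp, (extChartAt (𝓡 d) x).left_inv (hEx ha)]
  have hz : ∀ z ∈ extChartAt (𝓡 d) x '' E, z ∈ (extChartAt (𝓡 d) x).target ∧
      g ((extChartAt (𝓡 d) x).symm z) ∈ (extChartAt (𝓡 d) y).source := by
    rintro _ ⟨a, ha, rfl⟩
    refine ⟨(extChartAt (𝓡 d) x).map_source (hEx ha), ?_⟩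
    rw [(extChartAt (𝓡 d) x).left_inv (hEx ha)]
    exact hgE ha
  have hinj' : InjOn (chartRep d g x y) (extChartAt (𝓡 d) x '' E) := by
    rintro _ ⟨a, ha, rfl⟩ _ ⟨b, hb, rfl⟩ hab
    simp only [chartRep, Function.comp, (extChartAt (𝓡 d) x).left_inv (hEx ha),
      (extChartAt (𝓡 d) x).left_inv (hEx hb)] at hab
    rw [hinj ha hb ((extChartAt (𝓡 d) y).injOn (hgE ha) (hgE hb) hab)]
  rw [chartVolume_eq hgE' (image_subset_iff.2 hgE), himg,
    lintegral_image_eq_lintegral_abs_det_fderiv_mul volume (measurableSet_chart_image hE hEx)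
      (f' := fderiv ℝ (chartRep d g x y)) (fun z hzE => ?_) hinj',
    setLIntegral_chartVolume hE hEx (continuous_jacobian hg).measurable.ennreal_ofReal]
  · refine setLIntegral_congr_fun (measurableSet_chart_image hE hEx) fun z hzE => ?_
    have h := jacobian_mul_chartDensity (hz z hzE).1 (hg.mdifferentiable one_ne_zero _)
      (hz z hzE).2
    rw [← ENNReal.ofReal_mul (abs_nonneg _), ← h, mul_comm,
      ENNReal.ofReal_mul (chartDensity_pos (hz z hzE).1).le]
  · exact ((contDiffAt_chartRep (n := 1) (hz z hzE).1 hg.contMDiffAt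
      (hz z hzE).2).differentiableAt one_ne_zero).hasFDerivAt.hasFDerivWithinAt

lemma jacobian_id (x : M) : jacobian d (id : M → M) x = 1 := by
  have : FiniteDimensional ℝ (TangentSpace (𝓡 d) x) :=
    inferInstanceAs (FiniteDimensional ℝ (EuclideanSpace ℝ (Fin d)))
  have h := sqrt_det_gram_map rfl (ContinuousLinearMap.id ℝ (TangentSpace (𝓡 d) x))
    (stdOrthonormalBasis ℝ (TangentSpace (𝓡 d) x))
  have h1 : Matrix.gram ℝ (stdOrthonormalBasis ℝ (TangentSpace (𝓡 d) x)) = 1 := by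
    ext i j
    rw [Matrix.gram_apply, orthonormal_iff_ite.1 (stdOrthonormalBasis ℝ _).orthonormal,
      Matrix.one_apply]
  simp only [ContinuousLinearMap.id_apply, h1, Matrix.det_one, Real.sqrt_one, mul_one] at h
  rw [jacobian, tangentDeriv, mfderiv_id]
  exact h.symm

/-- Independence of the chart is the change of variables formula for the identity map, whose
Jacobian is one. -/
lemma chartVolume_eq_chartVolume {x y : M} {E : Set M} (hE : MeasurableSet E)
    (hEx : E ⊆ (extChartAt (𝓡 d) x).source) (hEy : E ⊆ (extChartAt (𝓡 d) y).source) :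
    chartVolume d y E = chartVolume d x E := by
  have := chartVolume_image (g := (id : M → M)) contMDiff_id hE hEx hEy (injOn_id E)
  simpa [jacobian_id] using this

variable (d M) in
lemma exists_chart_partition [Nonempty M] : ∃ (c : ℕ → M) (P : ℕ → Set M),
    (∀ i, MeasurableSet (P i)) ∧ Pairwise (Function.onFun Disjoint P) ∧
    (∀ i, P i ⊆ (extChartAt (𝓡 d) (c i)).source) ∧ ⋃ i, P i = univ := by
  obtain ⟨s, hs, hsu⟩ := TopologicalSpace.countable_cover_nhds
    (fun x : M => extChartAt_source_mem_nhds (I := 𝓡 d) x)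
  have hne : s.Nonempty := by
    rw [nonempty_iff_ne_empty]
    rintro rfl
    simp at hsu
    exact empty_ne_univ hsu
  obtain ⟨c, rfl⟩ := hs.exists_eq_range hne
  refine ⟨c, disjointed fun i => (extChartAt (𝓡 d) (c i)).source, fun i =>
    MeasurableSet.disjointed (fun i => (isOpen_extChartAt_source _).measurableSet) i,
    disjoint_disjointed _, fun i => disjointed_subset _ i, ?_⟩
  rw [iUnion_disjointed]
  simpa using hsu

/-- The Riemannian volume is given by the volume density in every chart. -/
lemma riemannianVolume_eq_chartVolume {x : M} {E : Set M} (hE : MeasurableSet E)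
    (hEx : E ⊆ (extChartAt (𝓡 d) x).source) : riemannianVolume d M E = chartVolume d x E := by
  have : Nonempty M := ⟨x⟩
  obtain ⟨c, P, hPm, hPd, hPs, hPu⟩ := exists_chart_partition d M
  have hsplit : ∀ (ν : Measure M) {S : Set M}, MeasurableSet S → ν S = ∑' i, ν (S ∩ P i) := by
    intro ν S hS
    rw [← measure_iUnion (fun i j hij => (hPd hij).mono inter_subset_right inter_subset_right)
      fun i => hS.inter (hPm i), ← inter_iUnion, hPu, inter_univ]
  refine le_antisymm ?_ (Measure.le_iff'.1 (le_iSup (fun x : M => chartVolume d x) x) E)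
  -- The supremum of the chart volumes is bounded by the measure glued along a countable partition
  -- subordinate to charts, because each chart volume agrees with the glued one where its chart is
  -- defined and vanishes elsewhere.
  have hle : riemannianVolume d M ≤ Measure.sum fun i => (chartVolume d (c i)).restrict (P i) := by
    refine iSup_le fun z => Measure.le_iff.2 fun S hS => ?_
    rw [hsplit _ hS, Measure.sum_apply _ hS]
    refine ENNReal.tsum_le_tsum fun i => ?_
    rw [Measure.restrict_apply hS, ← chartVolume_inter_source z (S ∩ P i)]
    have hm : MeasurableSet (S ∩ P i ∩ (extChartAt (𝓡 d) z).source) :=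
      (hS.inter (hPm i)).inter (isOpen_extChartAt_source z).measurableSet
    rw [chartVolume_eq_chartVolume hm (x := c i)
      (inter_subset_left.trans (inter_subset_right.trans (hPs i))) inter_subset_right]
    exact measure_mono inter_subset_left
  refine (Measure.le_iff'.1 hle E).trans_eq ?_
  rw [Measure.sum_apply _ hE, hsplit _ hE]
  refine tsum_congr fun i => ?_
  rw [Measure.restrict_apply hE]
  exact chartVolume_eq_chartVolume (hE.inter (hPm i)) (inter_subset_left.trans hEx)
    (inter_subset_right.trans (hPs i))

lemma riemannianVolume_restrict {x : M} {E : Set M} (hE : MeasurableSet E)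
    (hEx : E ⊆ (extChartAt (𝓡 d) x).source) :
    (riemannianVolume d M).restrict E = (chartVolume d x).restrict E := by
  refine Measure.ext fun S hS => ?_
  rw [Measure.restrict_apply hS, Measure.restrict_apply hS,
    riemannianVolume_eq_chartVolume (hS.inter hE) (inter_subset_right.trans hEx)]

/-- The change of variables formula for the Riemannian volume. -/
lemma riemannianVolume_image {g : M → M} (hg : ContMDiff (𝓡 d) (𝓡 d) 1 g) {E : Set M}
    (hE : MeasurableSet E) (hinj : InjOn g E) :
    riemannianVolume d M (g '' E) =
      ∫⁻ a in E, ENNReal.ofReal (jacobian d g a) ∂riemannianVolume d M := by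
  rcases isEmpty_or_nonempty M with hM | hM
  · simp [Subsingleton.elim E ∅]
  obtain ⟨c, P, hPm, hPd, hPs, hPu⟩ := exists_chart_partition d M
  set S : ℕ × ℕ → Set M := fun p => E ∩ P p.1 ∩ g ⁻¹' P p.2 with hS
  have hSm : ∀ p, MeasurableSet (S p) := fun p =>
    (hE.inter (hPm _)).inter (hg.continuous.measurable (hPm _))
  have hSE : ∀ p, S p ⊆ E := fun p => inter_subset_left.trans inter_subset_left
  have hSd : Pairwise (Function.onFun Disjoint S) := by
    intro p q hpq
    rw [Function.onFun, disjoint_left]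
    rintro a ⟨⟨_, ha1⟩, ha2⟩ ⟨⟨_, hb1⟩, hb2⟩
    refine hpq (Prod.ext ?_ ?_)
    · by_contra h; exact disjoint_left.1 (hPd h) ha1 hb1
    · by_contra h; exact disjoint_left.1 (hPd h) ha2 hb2
  have hSu : ⋃ p, S p = E := by
    refine subset_antisymm (iUnion_subset hSE) fun a ha => ?_
    obtain ⟨i, hi⟩ := mem_iUnion.1 (hPu.ge (mem_univ a))
    obtain ⟨j, hj⟩ := mem_iUnion.1 (hPu.ge (mem_univ (g a)))
    exact mem_iUnion.2 ⟨(i, j), ⟨ha, hi⟩, hj⟩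
  have himm : ∀ p, MeasurableSet (g '' S p) := fun p =>
    (hSm p).image_of_continuousOn_injOn hg.continuous.continuousOn (hinj.mono (hSE p))
  conv_lhs => rw [← hSu, image_iUnion]
  rw [measure_iUnion (fun p q hpq => ?_) himm]
  · conv_rhs => rw [← hSu, lintegral_iUnion hSm hSd]
    refine tsum_congr fun p => ?_
    have h1 : S p ⊆ (extChartAt (𝓡 d) (c p.1)).source :=
      inter_subset_left.trans (inter_subset_right.trans (hPs _))
    have h2 : MapsTo g (S p) (extChartAt (𝓡 d) (c p.2)).source := fun a ha => hPs _ ha.2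
    rw [riemannianVolume_eq_chartVolume (himm p) (image_subset_iff.2 h2),
      chartVolume_image hg (hSm p) h1 h2 (hinj.mono (hSE p)), riemannianVolume_restrict (hSm p) h1]
  · rw [Function.onFun, disjoint_left]
    rintro _ ⟨a, ha, rfl⟩ ⟨b, hb, hab⟩
    have := hinj (hSE _ hb) (hSE _ ha) hab
    subst this
    exact disjoint_left.1 (hSd hpq) ha hb

lemma riemannianVolume_pos {U : Set M} (hU : IsOpen U) (hne : U.Nonempty) :
    0 < riemannianVolume d M U := by
  obtain ⟨x, hx⟩ := hne
  set V := U ∩ (extChartAt (𝓡 d) x).source with hV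
  have hVo : IsOpen V := hU.inter (isOpen_extChartAt_source x)
  have hVs : V ⊆ (extChartAt (𝓡 d) x).source := inter_subset_right
  refine lt_of_lt_of_le ?_ (measure_mono (inter_subset_left : V ⊆ U))
  rw [riemannianVolume_eq_chartVolume hVo.measurableSet hVs, chartVolume_eq hVo.measurableSet hVs]
  have himg : IsOpen (extChartAt (𝓡 d) x '' V) := by
    rw [(extChartAt (𝓡 d) x).image_eq_target_inter_inv_preimage hVs]
    exact (continuousOn_extChartAt_symm x).isOpen_inter_preimage (isOpen_extChartAt_target x) hVo
  have hVt : extChartAt (𝓡 d) x '' V ⊆ (extChartAt (𝓡 d) x).target := by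
    rintro _ ⟨a, ha, rfl⟩; exact (extChartAt (𝓡 d) x).map_source (hVs ha)
  have hae : AEMeasurable (fun y => ENNReal.ofReal (chartDensity d x y))
      (volume.restrict (extChartAt (𝓡 d) x '' V)) :=
    (((contDiffOn_chartDensity x).continuousOn.mono hVt).aemeasurable
      himg.measurableSet).ennreal_ofReal
  have hpos : 0 < volume (extChartAt (𝓡 d) x '' V) :=
    himg.measure_pos volume ⟨_, x, ⟨hx, mem_extChartAt_source x⟩, rfl⟩
  rw [pos_iff_ne_zero, Ne, lintegral_eq_zero_iff' hae]
  intro h0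
  have h1 := (ae_restrict_iff' himg.measurableSet).1 h0
  refine hpos.ne' (measure_mono_null (fun y hy => ?_) h1)
  intro hy'
  have := hy' hy
  simp only [Pi.zero_apply, ENNReal.ofReal_eq_zero] at this
  exact this.not_gt (chartDensity_pos (hVt hy))

lemma leb_image {g : M → M} (hg : ContMDiff (𝓡 d) (𝓡 d) 1 g) {E : Set M}
    (hE : MeasurableSet E) (hinj : InjOn g E) :
    leb d M (g '' E) = ∫⁻ a in E, ENNReal.ofReal (jacobian d g a) ∂leb d M := by
  rw [leb, Measure.restrict_smul, lintegral_smul_measure, Measure.smul_apply,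
    riemannianVolume_image hg hE hinj]

/-- If the total volume were infinite, its inverse would be zero and the normalized measure would
vanish. Positivity of one set thus yields finiteness without a separate compactness argument. -/
lemma riemannianVolume_ne_top_of_leb_pos {A : Set M} (hA : 0 < leb d M A) :
    riemannianVolume d M univ ≠ ⊤ := by
  intro h
  simp [leb, h] at hA

lemma isFiniteMeasure_leb {A : Set M} (hA : 0 < leb d M A) : IsFiniteMeasure (leb d M) := by
  refine ⟨?_⟩
  rw [leb, Measure.smul_apply, smul_eq_mul]
  rcases eq_or_ne (riemannianVolume d M univ) 0 with h | h
  · simp [h]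
  · rw [ENNReal.inv_mul_cancel h (riemannianVolume_ne_top_of_leb_pos hA)]
    exact ENNReal.one_lt_top

lemma isOpenPosMeasure_leb {A : Set M} (hA : 0 < leb d M A) : (leb d M).IsOpenPosMeasure := by
  refine ⟨fun U hU hne => ?_⟩
  rw [leb, Measure.smul_apply, smul_eq_mul]
  exact mul_ne_zero (ENNReal.inv_ne_zero.2 (riemannianVolume_ne_top_of_leb_pos hA))
    (riemannianVolume_pos hU hne).ne'

end Volume

/-! ### Lipschitz estimates along paths -/

section Path

open Manifold

variable {E₁ : Type*} [NormedAddCommGroup E₁] [NormedSpace ℝ E₁] {H₁ : Type*} [TopologicalSpace H₁]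
  {I₁ : ModelWithCorners ℝ E₁ H₁} {M₁ : Type*} [PseudoEMetricSpace M₁] [ChartedSpace H₁ M₁]
  [RiemannianBundle (fun x : M₁ => TangentSpace I₁ x)] [IsRiemannianManifold I₁ M₁]
  {E₂ : Type*} [NormedAddCommGroup E₂] [NormedSpace ℝ E₂] {H₂ : Type*} [TopologicalSpace H₂]
  {I₂ : ModelWithCorners ℝ E₂ H₂} {M₂ : Type*} [PseudoEMetricSpace M₂] [ChartedSpace H₂ M₂]
  [RiemannianBundle (fun x : M₂ => TangentSpace I₂ x)] [IsRiemannianManifold I₂ M₂]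

/-- A map with derivative bounded by `C` on a ball is `C`-Lipschitz on a smaller ball. -/
lemma edist_le_of_mfderiv_le {h : M₁ → M₂} {x₀ : M₁} {R : ℝ≥0∞} {C : ENNReal} (hC : C ≠ ⊤)
    (hh : ∀ y ∈ Metric.eball x₀ (3 * R), ContMDiffAt I₁ I₂ 1 h y)
    (hbound : ∀ y ∈ Metric.eball x₀ (3 * R), ∀ v : TangentSpace I₁ y,
      ‖mfderiv I₁ I₂ h y v‖ₑ ≤ C * ‖v‖ₑ) {x x' : M₁}
    (hx : x ∈ Metric.eball x₀ R) (hx' : x' ∈ Metric.eball x₀ R) :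
    edist (h x) (h x') ≤ C * edist x x' := by
  have hlt : edist x x' < 2 * R := by
    rw [two_mul]
    refine (edist_triangle_right x x' x₀).trans_lt (ENNReal.add_lt_add hx hx')
  -- A path from `x` to `x'` of length less than `r < 2R` starts in the `R`-ball, so it stays in the
  -- `3R`-ball, where the derivative is controlled. Letting `r` decrease to the distance avoids the
  -- existence of minimal geodesics.
  have key : ∀ r ∈ Ioo (edist x x') (2 * R), edist (h x) (h x') ≤ C * r := by
    intro r hr
    have hr1 : riemannianEDist I₁ x x' < r := by
      rw [← IsRiemannianManifold.out (I := I₁)]; exact hr.1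
    obtain ⟨γ, γ0, γ1, hγ, hlen⟩ := exists_lt_of_riemannianEDist_lt hr1
    have hmem : ∀ t ∈ Icc (0 : ℝ) 1, γ t ∈ Metric.eball x₀ (3 * R) := by
      intro t ht
      have h1 : edist x (γ t) ≤ pathELength I₁ γ 0 1 := by
        rw [IsRiemannianManifold.out (I := I₁) x (γ t)]
        refine (riemannianEDist_le_pathELength (hγ.mono (Icc_subset_Icc_right ht.2)) γ0 rfl
          ht.1).trans (pathELength_mono le_rfl ht.2)
      have h2 : edist (γ t) x₀ < 2 * R + R := by
        refine (edist_triangle (γ t) x x₀).trans_lt (ENNReal.add_lt_add ?_ hx)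
        rw [edist_comm]
        exact (h1.trans_lt hlen).trans hr.2
      rw [Metric.mem_eball]
      convert h2 using 1
      ring
    have hcomp : ContMDiffOn 𝓘(ℝ, ℝ) I₂ 1 (h ∘ γ) (Icc 0 1) := fun t ht =>
      (hh _ (hmem t ht)).comp_contMDiffWithinAt t (hγ t ht)
    rw [IsRiemannianManifold.out (I := I₂) (h x) (h x')]
    refine (riemannianEDist_le_pathELength hcomp (by simp [γ0]) (by simp [γ1])
      zero_le_one).trans ?_
    refine le_trans ?_ (mul_le_mul_right hlen.le C)
    rw [pathELength_eq_lintegral_mfderivWithin_Icc, pathELength_eq_lintegral_mfderivWithin_Icc,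
      ← lintegral_const_mul' _ _ hC]
    refine setLIntegral_mono' measurableSet_Icc fun t ht => ?_
    have hu : UniqueMDiffWithinAt 𝓘(ℝ, ℝ) (Icc (0 : ℝ) 1) t :=
      (uniqueDiffOn_Icc zero_lt_one t ht).uniqueMDiffWithinAt
    rw [mfderiv_comp_mfderivWithin t ((hh _ (hmem t ht)).mdifferentiableAt one_ne_zero)
      ((hγ t ht).mdifferentiableWithinAt one_ne_zero) hu]
    exact hbound _ (hmem t ht) _
  have : (𝓝[>] (edist x x')).NeBot := nhdsGT_neBot_of_exists_gt ⟨_, hlt⟩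
  refine ge_of_tendsto (x := 𝓝[>] (edist x x')) (f := fun r => C * r) ?_ ?_
  · exact (ENNReal.Tendsto.const_mul tendsto_id (Or.inr hC)).mono_left nhdsWithin_le_nhds
  · filter_upwards [Ioo_mem_nhdsGT hlt] with r hr using key r hr

end Path

lemma exists_eball_subset {M : Type*} [PseudoEMetricSpace M] {x : M} {s : Set M} (hs : s ∈ 𝓝 x) :
    ∃ r : ℝ, 0 < r ∧ Metric.eball x (ENNReal.ofReal r) ⊆ s := by
  obtain ⟨ε, hε, h⟩ := EMetric.mem_nhds_iff.1 hs
  obtain ⟨r, hr0, hr⟩ := ENNReal.lt_iff_exists_nnreal_btwn.1 hε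
  refine ⟨r, by exact_mod_cast hr0, (Metric.eball_subset_eball ?_).trans h⟩
  simpa using hr.le

section ChartLipschitz

variable {d : ℕ} {M : Type*} [EMetricSpace M] [ChartedSpace (EuclideanSpace ℝ (Fin d)) M]
  [IsManifold (𝓡 d) ∞ M] [RiemannianBundle (fun x : M => TangentSpace (𝓡 d) x)]
  [IsContMDiffRiemannianBundle (𝓡 d) ∞ (EuclideanSpace ℝ (Fin d))
    (fun x : M => TangentSpace (𝓡 d) x)] [IsRiemannianManifold (𝓡 d) M]

lemma exists_lipschitz_extChartAt (x : M) : ∃ C : ℝ≥0∞, C ≠ ⊤ ∧ ∃ r : ℝ, 0 < r ∧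
    ∀ u ∈ Metric.eball x (ENNReal.ofReal r), ∀ u' ∈ Metric.eball x (ENNReal.ofReal r),
      edist (extChartAt (𝓡 d) x u) (extChartAt (𝓡 d) x u') ≤ C * edist u u' := by
  have hcont : IsContinuousRiemannianBundle (EuclideanSpace ℝ (Fin d))
      (fun x : M => TangentSpace (𝓡 d) x) := by
    obtain ⟨g, hg, hgi⟩ := IsContMDiffRiemannianBundle.exists_contMDiff (IB := 𝓡 d) (n := ∞)
      (F := EuclideanSpace ℝ (Fin d)) (E := fun x : M => TangentSpace (𝓡 d) x)
    exact ⟨g, hg.continuous, hgi⟩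
  obtain ⟨C, -, hC⟩ := eventually_enorm_mfderiv_extChartAt_lt (𝓡 d) x
  obtain ⟨r, hr, hrs⟩ := exists_eball_subset (inter_mem hC (extChartAt_source_mem_nhds (I := 𝓡 d) x))
  refine ⟨C, ENNReal.coe_ne_top, r / 3, by positivity, fun u hu u' hu' => ?_⟩
  have h3 : 3 * ENNReal.ofReal (r / 3) = ENNReal.ofReal r := by
    rw [← ENNReal.ofReal_ofNat, ← ENNReal.ofReal_mul (by norm_num)]
    congr 1; ring
  refine edist_le_of_mfderiv_le (I₁ := 𝓡 d) (I₂ := 𝓡 d) ENNReal.coe_ne_top (fun y hy => ?_)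
    (fun y hy v => ?_) hu hu'
  · rw [h3] at hy
    exact contMDiffAt_extChartAt' (by simpa using (hrs hy).2)
  · rw [h3] at hy
    have h1 : ‖(show TangentSpace (𝓡 d) y →L[ℝ] EuclideanSpace ℝ (Fin d) from
        mfderiv (𝓡 d) (𝓡 d) (extChartAt (𝓡 d) x) y)‖ₑ < C := (hrs hy).1
    rw [enorm_tangentSpace_vectorSpace]
    exact (ContinuousLinearMap.le_opENorm (show TangentSpace (𝓡 d) y →L[ℝ]
      EuclideanSpace ℝ (Fin d) from mfderiv (𝓡 d) (𝓡 d) (extChartAt (𝓡 d) x) y) v).trans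
      (mul_le_mul_left h1.le _)

end ChartLipschitz

/-! ### Families of maps that are continuous for the `C²` topology -/

section IteratedDerivatives

variable {E F : Type*} [NormedAddCommGroup E] [NormedSpace ℝ E] [NormedAddCommGroup F]
  [NormedSpace ℝ F]

lemma norm_fderiv_sub_le_iteratedFDeriv (f g : E → F) (z : E) :
    ‖fderiv ℝ f z - fderiv ℝ g z‖ ≤ ‖iteratedFDeriv ℝ 1 f z - iteratedFDeriv ℝ 1 g z‖ := by
  refine ContinuousLinearMap.opNorm_le_bound _ (norm_nonneg _) fun v => ?_
  have h := (iteratedFDeriv ℝ 1 f z - iteratedFDeriv ℝ 1 g z).le_opNorm (fun _ => v)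
  simpa [iteratedFDeriv_one_apply] using h

lemma norm_fderiv_fderiv_sub_le_iteratedFDeriv (f g : E → F) (z : E) :
    ‖fderiv ℝ (fderiv ℝ f) z - fderiv ℝ (fderiv ℝ g) z‖ ≤
      ‖iteratedFDeriv ℝ 2 f z - iteratedFDeriv ℝ 2 g z‖ := by
  refine ContinuousLinearMap.opNorm_le_bound _ (norm_nonneg _) fun v => ?_
  refine ContinuousLinearMap.opNorm_le_bound _ (by positivity) fun w => ?_
  have h := (iteratedFDeriv ℝ 2 f z - iteratedFDeriv ℝ 2 g z).le_opNorm ![v, w]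
  simpa [iteratedFDeriv_two_apply, Fin.prod_univ_two, mul_assoc] using h

end IteratedDerivatives

section C2Family

variable {d : ℕ} {M : Type*} [EMetricSpace M] [ChartedSpace (EuclideanSpace ℝ (Fin d)) M]
  [IsManifold (𝓡 d) ∞ M] [CompactSpace M] {T : Type*} [TopologicalSpace T]
  {Φ : T → C^2⟮𝓡 d, M; 𝓡 d, M⟯}

lemma eventually_mem_c2Nhd (hΦ : Continuous[inferInstance, c2Topology d M] Φ) (t₀ : T) {x y : M}
    {K : Set M} (hK : IsCompact K) (hKx : K ⊆ (extChartAt (𝓡 d) x).source)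
    (hKy : MapsTo (Φ t₀) K (extChartAt (𝓡 d) y).source) {δ : ℝ} (hδ : 0 < δ) :
    ∀ᶠ t in 𝓝 t₀, Φ t ∈ c2Nhd (Φ t₀) x y K δ := by
  let _ := c2Topology d M
  have ho : IsOpen (c2Nhd (Φ t₀) x y K δ) :=
    TopologicalSpace.isOpen_generateFrom_of_mem ⟨Φ t₀, x, y, K, δ, hK, hKx, hKy, hδ, rfl⟩
  refine hΦ.continuousAt (ho.mem_nhds ⟨hKy, fun k _ z _ => ?_⟩)
  simpa using hδ

/-- A compact neighbourhood of `x` inside the chart and mapped by `Φ t₀` into the second chart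
defines a subbasic neighbourhood; continuity of the family makes the estimates uniform on it. The
joint continuity statements below follow from this. -/
lemma eventually_chartRep_close (hΦ : Continuous[inferInstance, c2Topology d M] Φ) (t₀ : T)
    (x : M) {δ : ℝ} (hδ : 0 < δ) :
    ∀ᶠ p : T × EuclideanSpace ℝ (Fin d) in 𝓝 (t₀, extChartAt (𝓡 d) x x),
      p.2 ∈ (extChartAt (𝓡 d) x).target ∧
      Φ p.1 ((extChartAt (𝓡 d) x).symm p.2) ∈ (extChartAt (𝓡 d) (Φ t₀ x)).source ∧
      ‖chartRep d (Φ p.1) x (Φ t₀ x) p.2 - chartRep d (Φ t₀) x (Φ t₀ x) p.2‖ < δ ∧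
      ‖fderiv ℝ (chartRep d (Φ p.1) x (Φ t₀ x)) p.2 -
        fderiv ℝ (chartRep d (Φ t₀) x (Φ t₀ x)) p.2‖ < δ ∧
      ‖fderiv ℝ (fderiv ℝ (chartRep d (Φ p.1) x (Φ t₀ x))) p.2 -
        fderiv ℝ (fderiv ℝ (chartRep d (Φ t₀) x (Φ t₀ x))) p.2‖ < δ := by
  have hs : (extChartAt (𝓡 d) x).source ∩ Φ t₀ ⁻¹' (extChartAt (𝓡 d) (Φ t₀ x)).source ∈ 𝓝 x :=
    inter_mem (extChartAt_source_mem_nhds x)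
      ((Φ t₀).contMDiff.continuous.continuousAt (extChartAt_source_mem_nhds _))
  obtain ⟨K, hK, hKs, hKc⟩ := local_compact_nhds hs
  have h1 := eventually_mem_c2Nhd hΦ t₀ (x := x) (y := Φ t₀ x) hKc
    (fun a ha => (hKs ha).1) (fun a ha => (hKs ha).2) hδ
  have h2 : ∀ᶠ z in 𝓝 (extChartAt (𝓡 d) x x), z ∈ (extChartAt (𝓡 d) x).target ∧
      (extChartAt (𝓡 d) x).symm z ∈ K :=
    Filter.Eventually.and (extChartAt_target_mem_nhds x)
      ((continuousAt_extChartAt_symm x) (by simpa using hK))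
  rw [nhds_prod_eq]
  filter_upwards [h1.prod_mk h2] with p hp
  obtain ⟨⟨hp1, hp2⟩, hp3, hp4⟩ := hp
  have hz : p.2 ∈ extChartAt (𝓡 d) x '' K :=
    ⟨_, hp4, (extChartAt (𝓡 d) x).right_inv hp3⟩
  refine ⟨hp3, hp1 hp4, ?_, ?_, ?_⟩
  · have := hp2 0 (by norm_num) _ hz
    have h0 := (iteratedFDeriv ℝ 0 (chartRep d (Φ p.1) x (Φ t₀ x)) p.2 -
      iteratedFDeriv ℝ 0 (chartRep d (Φ t₀) x (Φ t₀ x)) p.2).le_opNorm (fun _ => 0)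
    simp only [sub_apply, iteratedFDeriv_zero_apply, norm_zero,
      Finset.univ_eq_empty, Finset.prod_empty, mul_one] at h0
    exact h0.trans_lt this
  · exact (norm_fderiv_sub_le_iteratedFDeriv _ _ _).trans_lt (hp2 1 (by norm_num) _ hz)
  · exact (norm_fderiv_fderiv_sub_le_iteratedFDeriv _ _ _).trans_lt (hp2 2 (by norm_num) _ hz)

lemma contDiffAt_chartRep_self (g : C^2⟮𝓡 d, M; 𝓡 d, M⟯) (x : M) :
    ContDiffAt ℝ 2 (chartRep d g x (g x)) (extChartAt (𝓡 d) x x) := by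
  have hx : (extChartAt (𝓡 d) x).symm (extChartAt (𝓡 d) x x) = x := extChartAt_to_inv x
  exact contDiffAt_chartRep (n := 2) (mem_extChartAt_target x) g.contMDiff.contMDiffAt
    (by rw [hx]; exact mem_extChartAt_source _)

lemma continuousAt_of_close {X Y F : Type*} [TopologicalSpace X] [TopologicalSpace Y]
    [NormedAddCommGroup F] {h : X → Y → F} {x₀ : X} {y₀ : Y} (hc : ContinuousAt (h x₀) y₀)
    (hclose : ∀ δ > 0, ∀ᶠ p : X × Y in 𝓝 (x₀, y₀), ‖h p.1 p.2 - h x₀ p.2‖ < δ) :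
    ContinuousAt (fun p : X × Y => h p.1 p.2) (x₀, y₀) := by
  rw [ContinuousAt, Metric.tendsto_nhds]
  intro ε hε
  have h1 : ∀ᶠ p : X × Y in 𝓝 (x₀, y₀), dist (h x₀ p.2) (h x₀ y₀) < ε / 2 :=
    (ContinuousAt.comp (f := fun p : X × Y => p.2) (x := (x₀, y₀)) hc continuousAt_snd)
      (Metric.ball_mem_nhds _ (half_pos hε))
  filter_upwards [h1, hclose _ (half_pos hε)] with p hp1 hp2
  rw [← dist_eq_norm] at hp2
  linarith [dist_triangle (h p.1 p.2) (h x₀ p.2) (h x₀ y₀)]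

lemma continuousAt_chartRep (hΦ : Continuous[inferInstance, c2Topology d M] Φ) (t₀ : T) (x : M) :
    ContinuousAt (fun p : T × EuclideanSpace ℝ (Fin d) => chartRep d (Φ p.1) x (Φ t₀ x) p.2)
      (t₀, extChartAt (𝓡 d) x x) :=
  continuousAt_of_close (h := fun t z => chartRep d (Φ t) x (Φ t₀ x) z)
    (contDiffAt_chartRep_self (Φ t₀) x).continuousAt fun _ hδ =>
    (eventually_chartRep_close hΦ t₀ x hδ).mono fun _ hp => hp.2.2.1

lemma continuousAt_fderiv_chartRep (hΦ : Continuous[inferInstance, c2Topology d M] Φ) (t₀ : T)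
    (x : M) : ContinuousAt (fun p : T × EuclideanSpace ℝ (Fin d) =>
      fderiv ℝ (chartRep d (Φ p.1) x (Φ t₀ x)) p.2) (t₀, extChartAt (𝓡 d) x x) :=
  continuousAt_of_close (h := fun t z => fderiv ℝ (chartRep d (Φ t) x (Φ t₀ x)) z)
    ((contDiffAt_chartRep_self (Φ t₀) x).continuousAt_fderiv two_ne_zero) fun _ hδ =>
    (eventually_chartRep_close hΦ t₀ x hδ).mono fun _ hp => hp.2.2.2.1

lemma eventually_norm_le_of_close {X Y F : Type*} [TopologicalSpace X] [TopologicalSpace Y]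
    [NormedAddCommGroup F] {h : X → Y → F} {x₀ : X} {y₀ : Y} (hc : ContinuousAt (h x₀) y₀)
    (hclose : ∀ δ > 0, ∀ᶠ p : X × Y in 𝓝 (x₀, y₀), ‖h p.1 p.2 - h x₀ p.2‖ < δ) :
    ∃ C, ∀ᶠ p : X × Y in 𝓝 (x₀, y₀), ‖h p.1 p.2‖ ≤ C :=
  ⟨‖h x₀ y₀‖ + 1, ((continuousAt_of_close hc hclose).norm.eventually_lt_const
    (lt_add_one _)).mono fun _ hp => hp.le⟩

lemma eventually_norm_fderiv_fderiv_chartRep_le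
    (hΦ : Continuous[inferInstance, c2Topology d M] Φ) (t₀ : T) (x : M) :
    ∃ C, ∀ᶠ p : T × EuclideanSpace ℝ (Fin d) in 𝓝 (t₀, extChartAt (𝓡 d) x x),
      ‖fderiv ℝ (fderiv ℝ (chartRep d (Φ p.1) x (Φ t₀ x))) p.2‖ ≤ C :=
  eventually_norm_le_of_close
    (h := fun t z => fderiv ℝ (fderiv ℝ (chartRep d (Φ t) x (Φ t₀ x))) z)
    (((contDiffAt_chartRep_self (Φ t₀) x).fderiv_right (m := 1)
      (by norm_num)).continuousAt_fderiv one_ne_zero) fun _ hδ =>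
    (eventually_chartRep_close hΦ t₀ x hδ).mono fun _ hp => hp.2.2.2.2

lemma eventually_mem_charts (hΦ : Continuous[inferInstance, c2Topology d M] Φ) (t₀ : T) (x : M) :
    ∀ᶠ p : T × M in 𝓝 (t₀, x), p.2 ∈ (extChartAt (𝓡 d) x).source ∧
      Φ p.1 p.2 ∈ (extChartAt (𝓡 d) (Φ t₀ x)).source := by
  have hφ : ContinuousAt (fun p : T × M => (p.1, extChartAt (𝓡 d) x p.2)) (t₀, x) :=
    continuousAt_fst.prodMk (ContinuousAt.comp (f := Prod.snd) (continuousAt_extChartAt x)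
      continuousAt_snd)
  filter_upwards [hφ.eventually (eventually_chartRep_close hΦ t₀ x one_pos),
    continuousAt_snd (p := (t₀, x)) (extChartAt_source_mem_nhds (I := 𝓡 d) x)] with p hp hp2
  refine ⟨hp2, ?_⟩
  have := hp.2.1
  rwa [(extChartAt (𝓡 d) x).left_inv hp2] at this

lemma continuous_eval_of_c2 (hΦ : Continuous[inferInstance, c2Topology d M] Φ) :
    Continuous (fun p : T × M => Φ p.1 p.2) := by
  rw [continuous_iff_continuousAt]
  rintro ⟨t₀, x⟩
  have hφ : ContinuousAt (fun p : T × M => (p.1, extChartAt (𝓡 d) x p.2)) (t₀, x) :=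
    continuousAt_fst.prodMk (ContinuousAt.comp (f := Prod.snd) (continuousAt_extChartAt x)
      continuousAt_snd)
  have h1 : ContinuousAt (fun p : T × M =>
      chartRep d (Φ p.1) x (Φ t₀ x) (extChartAt (𝓡 d) x p.2)) (t₀, x) :=
    ContinuousAt.comp (f := fun p : T × M => (p.1, extChartAt (𝓡 d) x p.2))
      (g := fun p : T × EuclideanSpace ℝ (Fin d) => chartRep d (Φ p.1) x (Φ t₀ x) p.2)
      (continuousAt_chartRep hΦ t₀ x) hφ
  have h2 : ContinuousAt (extChartAt (𝓡 d) (Φ t₀ x)).symm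
      (chartRep d (Φ t₀) x (Φ t₀ x) (extChartAt (𝓡 d) x x)) := by
    have : chartRep d (Φ t₀) x (Φ t₀ x) (extChartAt (𝓡 d) x x) =
        extChartAt (𝓡 d) (Φ t₀ x) (Φ t₀ x) := by
      simp only [chartRep, Function.comp, extChartAt_to_inv]
    rw [this]
    exact continuousAt_extChartAt_symm _
  refine (ContinuousAt.comp (f := fun p : T × M =>
      chartRep d (Φ p.1) x (Φ t₀ x) (extChartAt (𝓡 d) x p.2)) (x := (t₀, x)) h2 h1).congr ?_
  filter_upwards [eventually_mem_charts hΦ t₀ x] with p hp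
  simp only [chartRep, Function.comp, (extChartAt (𝓡 d) x).left_inv hp.1,
    (extChartAt (𝓡 d) (Φ t₀ x)).left_inv hp.2]

end C2Family

/-! ### The norm of the inverse of the derivative -/

/-- A nonnegative function whose square is the supremum over a compact set of a continuous family
of functions is continuous. -/
lemma continuousAt_of_sq_eq_sup {X Y : Type*} [TopologicalSpace X] [TopologicalSpace Y] {S : Set Y}
    (hS : IsCompact S) {q : X → Y → ℝ} {l : X → ℝ} {x₀ : X} (hl0 : ∀ x, 0 ≤ l x)
    (hq : ∀ v ∈ S, ContinuousAt (fun p : X × Y => q p.1 p.2) (x₀, v))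
    (hl : ∀ᶠ x in 𝓝 x₀, ∀ c, 0 ≤ c → (l x ≤ c ↔ ∀ v ∈ S, q x v ≤ c ^ 2)) :
    ContinuousAt l x₀ := by
  have hsq : ContinuousAt (fun x => l x ^ 2) x₀ := by
    rw [ContinuousAt, Metric.tendsto_nhds]
    intro ε hε
    have h1 : ∀ᶠ x in 𝓝 x₀, ∀ v ∈ S, |q x v - q x₀ v| < ε / 2 := by
      refine hS.eventually_forall_of_forall_eventually fun v hv => ?_
      have h2 : ∀ᶠ p : X × Y in 𝓝 (x₀, v), |q p.1 p.2 - q x₀ v| < ε / 4 :=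
        (hq v hv) (Metric.ball_mem_nhds _ (by positivity))
      have hc : ContinuousAt (fun p : X × Y => (x₀, p.2)) (x₀, v) := by fun_prop
      have h3 : ∀ᶠ p : X × Y in 𝓝 (x₀, v), |q x₀ p.2 - q x₀ v| < ε / 4 := hc.eventually h2
      filter_upwards [h2, h3] with p hp hp'
      rw [abs_lt] at *
      constructor <;> linarith
    have bound : ∀ x y, (∀ v ∈ S, |q x v - q y v| < ε / 2) →
        (∀ c, 0 ≤ c → (l x ≤ c ↔ ∀ v ∈ S, q x v ≤ c ^ 2)) →
        (∀ c, 0 ≤ c → (l y ≤ c ↔ ∀ v ∈ S, q y v ≤ c ^ 2)) → l x ^ 2 ≤ l y ^ 2 + ε / 2 := by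
      intro x y hxy hx hy
      have hnn : 0 ≤ l y ^ 2 + ε / 2 := by positivity
      rw [← Real.le_sqrt (hl0 x) hnn, hx _ (Real.sqrt_nonneg _), Real.sq_sqrt hnn]
      intro v hv
      have := (hy _ (hl0 y)).1 le_rfl v hv
      linarith [(abs_lt.1 (hxy v hv)).2]
    filter_upwards [h1, hl] with x hx hlx
    have b1 := bound x x₀ hx hlx hl.self_of_nhds
    have b2 := bound x₀ x (fun v hv => by rw [abs_sub_comm]; exact hx v hv) hl.self_of_nhds hlx
    rw [Real.dist_eq, abs_lt]
    constructor <;> linarith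
  have := hsq.sqrt
  simpa [Real.sqrt_sq (hl0 _)] using this

lemma isInvertible_iff_injective {E : Type*} [NormedAddCommGroup E] [NormedSpace ℝ E]
    [FiniteDimensional ℝ E] (L : E →L[ℝ] E) : L.IsInvertible ↔ Function.Injective L := by
  refine ⟨fun h => h.injective, fun h => ?_⟩
  exact ⟨(LinearEquiv.ofInjectiveEndo L.toLinearMap h).toContinuousLinearEquiv, by ext v; rfl⟩

lemma det_ne_zero_iff_injective {E : Type*} [NormedAddCommGroup E] [NormedSpace ℝ E]
    [FiniteDimensional ℝ E] (L : E →L[ℝ] E) : L.det ≠ 0 ↔ Function.Injective L := by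
  have h : L.det = LinearMap.det L.toLinearMap := rfl
  rw [h, ← isUnit_iff_ne_zero, ← LinearMap.isUnit_iff_isUnit_det, LinearMap.isUnit_iff_ker_eq_bot,
    LinearMap.ker_eq_bot]
  rfl

lemma norm_symm_le_iff {V W : Type*} [NormedAddCommGroup V] [NormedSpace ℝ V]
    [NormedAddCommGroup W] [NormedSpace ℝ W] (e : V ≃L[ℝ] W) {c : ℝ} (hc : 0 ≤ c) :
    ‖(e.symm : W →L[ℝ] V)‖ ≤ c ↔ ∀ v, ‖v‖ ^ 2 ≤ c ^ 2 * ‖e v‖ ^ 2 := by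
  rw [ContinuousLinearMap.opNorm_le_iff hc, e.surjective.forall]
  refine forall_congr' fun v => ?_
  rw [← mul_pow, pow_le_pow_iff_left₀ (norm_nonneg _) (by positivity) two_ne_zero]
  simp

section InverseNorm

variable {d : ℕ} {M : Type*} [EMetricSpace M] [ChartedSpace (EuclideanSpace ℝ (Fin d)) M]
  [IsManifold (𝓡 d) ∞ M]

lemma mdifferentiableAt_c2 (g : C^2⟮𝓡 d, M; 𝓡 d, M⟯) (a : M) :
    MDifferentiableAt (𝓡 d) (𝓡 d) g a := g.contMDiff.mdifferentiable two_ne_zero a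

lemma modelDeriv_chart {g : M → M} {x y a : M}
    (ha : a ∈ (extChartAt (𝓡 d) x).source) (hg : MDifferentiableAt (𝓡 d) (𝓡 d) g a)
    (hga : g a ∈ (extChartAt (𝓡 d) y).source) (v : EuclideanSpace ℝ (Fin d)) :
    modelDeriv d g a (chartDeriv d x (extChartAt (𝓡 d) x a) v) =
      chartDeriv d y (extChartAt (𝓡 d) y (g a))
        (fderiv ℝ (chartRep d g x y) (extChartAt (𝓡 d) x a) v) := by
  have hs := (extChartAt (𝓡 d) x).left_inv ha
  have h := DFunLike.congr_fun (modelDeriv_comp_chartDeriv (g := g) (y := y)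
    ((extChartAt (𝓡 d) x).map_source ha) (by rwa [hs]) (by rwa [hs])) v
  have hrep : chartRep d g x y (extChartAt (𝓡 d) x a) = extChartAt (𝓡 d) y (g a) := by
    simp only [chartRep, Function.comp, hs]
  rw [hrep, hs] at h
  exact h

lemma chartDeriv_surjective {x : M} {y : EuclideanSpace ℝ (Fin d)}
    (hy : y ∈ (extChartAt (𝓡 d) x).target) : Function.Surjective (chartDeriv d x y) :=
  LinearMap.injective_iff_surjective (f := (chartDeriv d x y).toLinearMap).1
    (chartDeriv_injective hy)

lemma isInvertible_modelDeriv_iff {g : M → M} {x y a : M}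
    (ha : a ∈ (extChartAt (𝓡 d) x).source) (hg : MDifferentiableAt (𝓡 d) (𝓡 d) g a)
    (hga : g a ∈ (extChartAt (𝓡 d) y).source) :
    (modelDeriv d g a).IsInvertible ↔
      (fderiv ℝ (chartRep d g x y) (extChartAt (𝓡 d) x a)).det ≠ 0 := by
  rw [isInvertible_iff_injective, det_ne_zero_iff_injective]
  have h1 := chartDeriv_injective ((extChartAt (𝓡 d) x).map_source ha)
  have h2 := chartDeriv_surjective ((extChartAt (𝓡 d) x).map_source ha)
  have h3 := chartDeriv_injective ((extChartAt (𝓡 d) y).map_source hga)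
  constructor
  · intro h u v huv
    refine h1 (h ?_)
    rw [modelDeriv_chart ha hg hga, modelDeriv_chart ha hg hga, huv]
  · intro h u v huv
    obtain ⟨u, rfl⟩ := h2 u
    obtain ⟨v, rfl⟩ := h2 v
    rw [modelDeriv_chart ha hg hga, modelDeriv_chart ha hg hga] at huv
    rw [h (h3 huv)]

variable [RiemannianBundle (fun x : M => TangentSpace (𝓡 d) x)]

lemma normInvDeriv_le_iff {g : M → M} {x : M} (h : (modelDeriv d g x).IsInvertible) {c : ℝ}
    (hc : 0 ≤ c) : normInvDeriv d g x ≤ c ↔ ∀ v, riemForm d x v v ≤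
      c ^ 2 * riemForm d (g x) (modelDeriv d g x v) (modelDeriv d g x v) := by
  obtain ⟨e, he⟩ : (tangentDeriv d g x).IsInvertible := h
  have hL : ∀ v : EuclideanSpace ℝ (Fin d), modelDeriv d g x v = e v := fun v =>
    (DFunLike.congr_fun he v).symm
  rw [normInvDeriv, ← he, ContinuousLinearMap.inverse_equiv, norm_symm_le_iff e hc]
  refine forall_congr' fun v => ?_
  have h1 : riemForm d x v v = ‖v‖ ^ 2 := riemForm_self x v
  have h2 : riemForm d (g x) (modelDeriv d g x v) (modelDeriv d g x v) = ‖e v‖ ^ 2 :=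
    (congrArg (fun w => riemForm d (g x) w w) (hL v)).trans (riemForm_self (g x) (e v))
  exact ⟨fun H => h1.trans_le (H.trans_eq (congrArg (c ^ 2 * ·) h2.symm)),
    fun H => h1.symm.trans_le (H.trans_eq (congrArg (c ^ 2 * ·) h2))⟩

lemma normInvDeriv_le_iff_chart {g : M → M} {x y a : M}
    (ha : a ∈ (extChartAt (𝓡 d) x).source) (hg : MDifferentiableAt (𝓡 d) (𝓡 d) g a)
    (hga : g a ∈ (extChartAt (𝓡 d) y).source) (h : (modelDeriv d g a).IsInvertible) {c : ℝ}
    (hc : 0 ≤ c) : normInvDeriv d g a ≤ c ↔ ∀ v, chartForm d x (extChartAt (𝓡 d) x a) v v ≤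
      c ^ 2 * chartForm d y (extChartAt (𝓡 d) y (g a))
        (fderiv ℝ (chartRep d g x y) (extChartAt (𝓡 d) x a) v)
        (fderiv ℝ (chartRep d g x y) (extChartAt (𝓡 d) x a) v) := by
  rw [normInvDeriv_le_iff h hc,
    (chartDeriv_surjective ((extChartAt (𝓡 d) x).map_source ha)).forall]
  refine forall_congr' fun v => ?_
  rw [modelDeriv_chart ha hg hga, chartForm, chartForm, (extChartAt (𝓡 d) x).left_inv ha,
    (extChartAt (𝓡 d) y).left_inv hga]

lemma normInvDeriv_nonneg (g : M → M) (x : M) : 0 ≤ normInvDeriv d g x := by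
  exact norm_nonneg (tangentDeriv d g x).inverse

lemma normInvDeriv_pos (hd : d ≠ 0) {g : M → M} {x : M} (h : (modelDeriv d g x).IsInvertible) :
    0 < normInvDeriv d g x := by
  by_contra hle
  have := NeZero.mk hd
  have hv : (EuclideanSpace.single (0 : Fin d) (1 : ℝ) : EuclideanSpace ℝ (Fin d)) ≠ 0 := by simp
  have h1 := (normInvDeriv_le_iff h le_rfl).1 (not_lt.1 hle) (EuclideanSpace.single 0 1)
  have h2 := riemForm_self_pos x hv
  simp only [ne_eq, OfNat.ofNat_ne_zero, not_false_eq_true, zero_pow, zero_mul] at h1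
  linarith

variable [IsContMDiffRiemannianBundle (𝓡 d) ∞ (EuclideanSpace ℝ (Fin d))
    (fun x : M => TangentSpace (𝓡 d) x)] [CompactSpace M] {T : Type*} [TopologicalSpace T]
  {Φ : T → C^2⟮𝓡 d, M; 𝓡 d, M⟯}

lemma continuousAt_fderiv_chartRep_comp (hΦ : Continuous[inferInstance, c2Topology d M] Φ) (t₀ : T)
    (x : M) : ContinuousAt (fun p : T × M =>
      fderiv ℝ (chartRep d (Φ p.1) x (Φ t₀ x)) (extChartAt (𝓡 d) x p.2)) (t₀, x) :=
  ContinuousAt.comp (f := fun p : T × M => (p.1, extChartAt (𝓡 d) x p.2))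
    (g := fun p : T × EuclideanSpace ℝ (Fin d) => fderiv ℝ (chartRep d (Φ p.1) x (Φ t₀ x)) p.2)
    (continuousAt_fderiv_chartRep hΦ t₀ x) (continuousAt_fst.prodMk
      (ContinuousAt.comp (f := Prod.snd) (continuousAt_extChartAt x) continuousAt_snd))

lemma eventually_isInvertible_modelDeriv (hΦ : Continuous[inferInstance, c2Topology d M] Φ)
    {t₀ : T} {x : M} (h : (modelDeriv d (Φ t₀) x).IsInvertible) :
    ∀ᶠ p : T × M in 𝓝 (t₀, x), (modelDeriv d (Φ p.1) p.2).IsInvertible := by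
  rw [isInvertible_modelDeriv_iff (mem_extChartAt_source x) (mdifferentiableAt_c2 _ _)
    (mem_extChartAt_source (Φ t₀ x))] at h
  have hdet : ContinuousAt (fun p : T × M =>
      (fderiv ℝ (chartRep d (Φ p.1) x (Φ t₀ x)) (extChartAt (𝓡 d) x p.2)).det) (t₀, x) :=
    ContinuousLinearMap.continuous_det.continuousAt.comp
      (continuousAt_fderiv_chartRep_comp hΦ t₀ x)
  filter_upwards [hdet.eventually_ne h, eventually_mem_charts hΦ t₀ x] with p hp hp'
  exact (isInvertible_modelDeriv_iff hp'.1 (mdifferentiableAt_c2 _ _) hp'.2).2 hp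

/-- In charts the square of the norm is the supremum, over the Euclidean unit sphere, of the
quotient `a p v / b p v` of the metric at the point by the metric at the image applied to the
derivative. This quotient is jointly continuous and the sphere is compact and does not depend on
`p`. -/
lemma continuousAt_normInvDeriv (hΦ : Continuous[inferInstance, c2Topology d M] Φ)
    {t₀ : T} {x : M} (h : (modelDeriv d (Φ t₀) x).IsInvertible) :
    ContinuousAt (fun p : T × M => normInvDeriv d (Φ p.1) p.2) (t₀, x) := by
  set y := Φ t₀ x with hy
  set D : T × M → EuclideanSpace ℝ (Fin d) →L[ℝ] EuclideanSpace ℝ (Fin d) := fun p =>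
    fderiv ℝ (chartRep d (Φ p.1) x y) (extChartAt (𝓡 d) x p.2) with hD
  have hDc : ContinuousAt D (t₀, x) := continuousAt_fderiv_chartRep_comp hΦ t₀ x
  set a : T × M → EuclideanSpace ℝ (Fin d) → ℝ := fun p v =>
    chartForm d x (extChartAt (𝓡 d) x p.2) v v with ha
  set b : T × M → EuclideanSpace ℝ (Fin d) → ℝ := fun p v =>
    chartForm d y (extChartAt (𝓡 d) y (Φ p.1 p.2)) (D p v) (D p v) with hb
  have hac : ∀ v, ContinuousAt (fun p : (T × M) × EuclideanSpace ℝ (Fin d) => a p.1 p.2)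
      ((t₀, x), v) := by
    intro v
    refine ContinuousAt.comp (f := fun p : (T × M) × EuclideanSpace ℝ (Fin d) =>
      (extChartAt (𝓡 d) x p.1.2, p.2)) (g := fun p : EuclideanSpace ℝ (Fin d) ×
        EuclideanSpace ℝ (Fin d) => chartForm d x p.1 p.2 p.2) ?_ ?_
    · exact (continuousOn_chartForm x).continuousAt
        (((isOpen_extChartAt_target x).prod isOpen_univ).mem_nhds ⟨mem_extChartAt_target x, trivial⟩)
    · refine ContinuousAt.prodMk ?_ continuousAt_snd
      exact ContinuousAt.comp (f := fun p : (T × M) × EuclideanSpace ℝ (Fin d) => p.1.2)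
        (continuousAt_extChartAt x) (by fun_prop)
  have hbc : ∀ v, ContinuousAt (fun p : (T × M) × EuclideanSpace ℝ (Fin d) => b p.1 p.2)
      ((t₀, x), v) := by
    intro v
    refine ContinuousAt.comp (f := fun p : (T × M) × EuclideanSpace ℝ (Fin d) =>
      (extChartAt (𝓡 d) y (Φ p.1.1 p.1.2), D p.1 p.2)) (g := fun p : EuclideanSpace ℝ (Fin d) ×
        EuclideanSpace ℝ (Fin d) => chartForm d y p.1 p.2 p.2) ?_ ?_
    · exact (continuousOn_chartForm y).continuousAt
        (((isOpen_extChartAt_target y).prod isOpen_univ).mem_nhds ⟨mem_extChartAt_target y, trivial⟩)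
    · refine ContinuousAt.prodMk ?_ ?_
      · refine ContinuousAt.comp (f := fun p : (T × M) × EuclideanSpace ℝ (Fin d) =>
          Φ p.1.1 p.1.2) (continuousAt_extChartAt y) ?_
        exact ((continuous_eval_of_c2 hΦ).comp continuous_fst).continuousAt
      · exact ContinuousAt.clm_apply (ContinuousAt.comp (f := Prod.fst) (g := D) hDc continuousAt_fst)
          continuousAt_snd
  have hev := (eventually_isInvertible_modelDeriv hΦ h).and (eventually_mem_charts hΦ t₀ x)
  have hbpos : ∀ p : T × M, (modelDeriv d (Φ p.1) p.2).IsInvertible →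
      p.2 ∈ (extChartAt (𝓡 d) x).source ∧ Φ p.1 p.2 ∈ (extChartAt (𝓡 d) y).source →
      ∀ v ≠ 0, 0 < b p v := by
    intro p hp hp' v hv
    refine chartForm_self_pos ((extChartAt (𝓡 d) y).map_source hp'.2) fun h0 => hv ?_
    rw [isInvertible_modelDeriv_iff hp'.1 (mdifferentiableAt_c2 _ _) hp'.2,
      det_ne_zero_iff_injective] at hp
    exact hp (by rw [map_zero]; exact h0)
  refine continuousAt_of_sq_eq_sup (isCompact_sphere (0 : EuclideanSpace ℝ (Fin d)) 1)
    (q := fun p v => a p v / b p v) (fun p => normInvDeriv_nonneg _ _) (fun v hv => ?_) ?_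
  · have hv0 : v ≠ 0 := by
      rintro rfl; simp at hv
    exact (hac v).div (hbc v)
      (hbpos _ hev.self_of_nhds.1 hev.self_of_nhds.2 v hv0).ne'
  · filter_upwards [hev] with p hp c hc
    rw [normInvDeriv_le_iff_chart hp.2.1 (mdifferentiableAt_c2 _ _) hp.2.2 hp.1 hc]
    constructor
    · intro H v hv
      have hv0 : v ≠ 0 := by
        rintro rfl; simp at hv
      rw [div_le_iff₀ (hbpos p hp.1 hp.2 v hv0)]
      exact H v
    -- Both forms are homogeneous of degree two, so the inequality on the unit sphere extends to all
    -- vectors.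
    · intro H v
      rcases eq_or_ne v 0 with rfl | hv0
      · have h0 : chartForm d x (extChartAt (𝓡 d) x p.2) 0 0 = 0 := by
          simpa using chartForm_smul_left x 0 (extChartAt (𝓡 d) x p.2) 0 0
        rw [h0]
        exact mul_nonneg (sq_nonneg c) (chartForm_self_nonneg _ _ _)
      · have hn : 0 < ‖v‖ := norm_pos_iff.2 hv0
        obtain ⟨r, u, hu1, rfl⟩ : ∃ (r : ℝ) (u : EuclideanSpace ℝ (Fin d)),
            u ∈ Metric.sphere (0 : EuclideanSpace ℝ (Fin d)) 1 ∧ v = r • u :=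
          ⟨‖v‖, ‖v‖⁻¹ • v, by simp [norm_smul, hn.ne'],
            by rw [smul_smul, mul_inv_cancel₀ hn.ne', one_smul]⟩
        have hu0 : u ≠ 0 := by
          rintro rfl; simp at hu1
        have h1 := H u hu1
        rw [div_le_iff₀ (hbpos p hp.1 hp.2 u hu0)] at h1
        have hsc : ∀ (z : M) (y w : EuclideanSpace ℝ (Fin d)) (r : ℝ),
            chartForm d z y (r • w) (r • w) = r ^ 2 * chartForm d z y w w := by
          intro z y w r
          rw [chartForm_smul_left, chartForm_comm, chartForm_smul_left]; ring
        rw [map_smul, hsc, hsc, mul_left_comm]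
        exact mul_le_mul_of_nonneg_left h1 (sq_nonneg r)

end InverseNorm

/-! ### Uniform local estimates -/

/-- On a compact space, a local estimate with locally uniform radius is uniform. -/
lemma exists_uniform_radius {T X : Type*} [TopologicalSpace T] [TopologicalSpace X]
    [CompactSpace X] {t₀ : T} {P : ℝ → T → X → Prop}
    (hmono : ∀ {ρ ρ' t x}, ρ' ≤ ρ → 0 < ρ' → P ρ t x → P ρ' t x)
    (hloc : ∀ x, ∃ ρ, 0 < ρ ∧ ∀ᶠ p : T × X in 𝓝 (t₀, x), P ρ p.1 p.2) :
    ∃ ρ, 0 < ρ ∧ ∀ᶠ t in 𝓝 t₀, ∀ x, P ρ t x := by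
  suffices h : ∃ ρ, 0 < ρ ∧ ∀ᶠ t in 𝓝 t₀, ∀ x ∈ (univ : Set X), P ρ t x by simpa using h
  refine isCompact_univ.induction_on (p := fun s => ∃ ρ, 0 < ρ ∧ ∀ᶠ t in 𝓝 t₀, ∀ x ∈ s, P ρ t x)
    ⟨1, one_pos, by simp⟩ ?_ ?_ ?_
  · rintro s s' hs ⟨ρ, hρ, h⟩
    exact ⟨ρ, hρ, h.mono fun t ht x hx => ht x (hs hx)⟩
  · rintro s s' ⟨ρ, hρ, h⟩ ⟨ρ', hρ', h'⟩
    refine ⟨min ρ ρ', lt_min hρ hρ', ?_⟩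
    filter_upwards [h, h'] with t ht ht' x hx
    rcases hx with hx | hx
    · exact hmono (min_le_left _ _) (lt_min hρ hρ') (ht x hx)
    · exact hmono (min_le_right _ _) (lt_min hρ hρ') (ht' x hx)
  · intro x _
    obtain ⟨ρ, hρ, h⟩ := hloc x
    rw [nhds_prod_eq] at h
    obtain ⟨pa, hpa, pb, hpb, hab⟩ := eventually_prod_iff.1 h
    refine ⟨{y | pb y}, mem_nhdsWithin_of_mem_nhds hpb, ρ, hρ, ?_⟩
    filter_upwards [hpa] with t ht y hy using hab ht hy

lemma exists_closedBall_of_eventually {T E : Type*} [TopologicalSpace T] [PseudoMetricSpace E]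
    {t₀ : T} {z : E} {Q : T → E → Prop} (h : ∀ᶠ p : T × E in 𝓝 (t₀, z), Q p.1 p.2) :
    ∃ r₀, 0 < r₀ ∧ ∀ r ≤ r₀, ∀ᶠ t in 𝓝 t₀, ∀ y ∈ Metric.closedBall z r, Q t y := by
  rw [nhds_prod_eq] at h
  obtain ⟨pa, hpa, pb, hpb, hab⟩ := eventually_prod_iff.1 h
  obtain ⟨r, hr, hrb⟩ := Metric.nhds_basis_closedBall.eventually_iff.1 hpb
  refine ⟨r, hr, fun r' hr' => ?_⟩
  filter_upwards [hpa] with t ht y hy using hab ht (hrb (Metric.closedBall_subset_closedBall hr' hy))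

lemma contDiff_det {d : ℕ} : ContDiff ℝ 1
    (fun L : EuclideanSpace ℝ (Fin d) →L[ℝ] EuclideanSpace ℝ (Fin d) => L.det) := by
  have h : (fun L : EuclideanSpace ℝ (Fin d) →L[ℝ] EuclideanSpace ℝ (Fin d) => L.det) = fun L =>
      (Matrix.of fun i j : Fin d => L (EuclideanSpace.single j 1) i).det := by
    ext1 L
    have : (Matrix.of fun i j : Fin d => L (EuclideanSpace.single j 1) i) =
        LinearMap.toMatrix (EuclideanSpace.basisFun (Fin d) ℝ).toBasis
        (EuclideanSpace.basisFun (Fin d) ℝ).toBasis L.toLinearMap := by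
      ext i j
      simp [LinearMap.toMatrix_apply]
    rw [this, LinearMap.det_toMatrix]
  rw [h]
  simp only [Matrix.det_apply, Matrix.of_apply]
  refine ContDiff.sum fun σ _ => ContDiff.const_smul _ (contDiff_prod fun i _ => ?_)
  have h1 : ContDiff ℝ 1 (fun L : EuclideanSpace ℝ (Fin d) →L[ℝ] EuclideanSpace ℝ (Fin d) =>
      L (EuclideanSpace.single i 1)) := contDiff_id.clm_apply contDiff_const
  exact (contDiff_euclidean.1 h1) _

section LocalEstimates

variable {d : ℕ} {M : Type*} [EMetricSpace M] [ChartedSpace (EuclideanSpace ℝ (Fin d)) M]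
  [IsManifold (𝓡 d) ∞ M] [CompactSpace M] {T : Type*} [TopologicalSpace T]
  {Φ : T → C^2⟮𝓡 d, M; 𝓡 d, M⟯}

/-- The representatives in charts are uniformly close to a linear isomorphism. -/
lemma exists_approximatesLinearOn (hd : d ≠ 0) (hΦ : Continuous[inferInstance, c2Topology d M] Φ)
    {t₀ : T} {x : M} (h : (modelDeriv d (Φ t₀) x).IsInvertible) :
    ∃ (e : EuclideanSpace ℝ (Fin d) ≃L[ℝ] EuclideanSpace ℝ (Fin d)) (c : NNReal),
      c < ‖(e.symm : EuclideanSpace ℝ (Fin d) →L[ℝ] EuclideanSpace ℝ (Fin d))‖₊⁻¹ ∧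
      ∃ r₀, 0 < r₀ ∧ ∀ r ≤ r₀, ∀ᶠ t in 𝓝 t₀,
        (∀ z ∈ Metric.closedBall (extChartAt (𝓡 d) x x) r, z ∈ (extChartAt (𝓡 d) x).target ∧
          Φ t ((extChartAt (𝓡 d) x).symm z) ∈ (extChartAt (𝓡 d) (Φ t₀ x)).source) ∧
        ApproximatesLinearOn (chartRep d (Φ t) x (Φ t₀ x))
          (e : EuclideanSpace ℝ (Fin d) →L[ℝ] EuclideanSpace ℝ (Fin d))
          (Metric.closedBall (extChartAt (𝓡 d) x x) r) c := by
  have : NeZero d := ⟨hd⟩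
  have : Nontrivial (EuclideanSpace ℝ (Fin d)) :=
    ⟨EuclideanSpace.single 0 1, 0, by simp⟩
  rw [isInvertible_modelDeriv_iff (mem_extChartAt_source x) (mdifferentiableAt_c2 _ _)
    (mem_extChartAt_source (Φ t₀ x)), det_ne_zero_iff_injective, ← isInvertible_iff_injective] at h
  obtain ⟨e, he⟩ := h
  set N := ‖(e.symm : EuclideanSpace ℝ (Fin d) →L[ℝ] EuclideanSpace ℝ (Fin d))‖₊⁻¹ with hN
  have hNpos : 0 < N := by
    rw [hN, inv_pos]
    exact e.nnnorm_symm_pos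
  refine ⟨e, N / 2, half_lt_self hNpos, ?_⟩
  have h1 := (continuousAt_fderiv_chartRep hΦ t₀ x) (Metric.ball_mem_nhds _
    (show (0 : ℝ) < (N / 2 : NNReal) by exact_mod_cast half_pos hNpos))
  have h2 := (eventually_chartRep_close hΦ t₀ x one_pos)
  obtain ⟨r₀, hr₀, hr⟩ := exists_closedBall_of_eventually (Q := fun t z =>
    (z ∈ (extChartAt (𝓡 d) x).target ∧
      Φ t ((extChartAt (𝓡 d) x).symm z) ∈ (extChartAt (𝓡 d) (Φ t₀ x)).source) ∧
    ‖fderiv ℝ (chartRep d (Φ t) x (Φ t₀ x)) z - e‖ ≤ (N / 2 : NNReal)) (by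
      filter_upwards [h1, h2] with p hp1 hp2
      refine ⟨⟨hp2.1, hp2.2.1⟩, ?_⟩
      have := (Metric.mem_ball.1 hp1).le
      rw [dist_eq_norm] at this
      rwa [he])
  refine ⟨r₀, hr₀, fun r hrr => (hr r hrr).mono fun t ht => ⟨fun z hz => (ht z hz).1, ?_⟩⟩
  intro u hu v hv
  refine (convex_closedBall _ r).norm_image_sub_le_of_norm_fderiv_le' (𝕜 := ℝ) (fun z hz => ?_)
    (fun z hz => (ht z hz).2) hv hu
  exact (contDiffAt_chartRep (n := 2) (ht z hz).1.1 (Φ t).contMDiff.contMDiffAt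
    (ht z hz).1.2).differentiableAt two_ne_zero

lemma exists_injOn_eball (hd : d ≠ 0) (hΦ : Continuous[inferInstance, c2Topology d M] Φ)
    {t₀ : T} {x : M} (h : (modelDeriv d (Φ t₀) x).IsInvertible) :
    ∃ ρ, 0 < ρ ∧ ∀ᶠ p : T × M in 𝓝 (t₀, x),
      InjOn (Φ p.1) (Metric.eball p.2 (ENNReal.ofReal ρ)) := by
  obtain ⟨e, c, hc, r, hr, hev⟩ := exists_approximatesLinearOn hd hΦ h
  have hW : (extChartAt (𝓡 d) x).source ∩
      extChartAt (𝓡 d) x ⁻¹' Metric.closedBall (extChartAt (𝓡 d) x x) r ∈ 𝓝 x :=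
    inter_mem (extChartAt_source_mem_nhds x)
      ((continuousAt_extChartAt x) (Metric.closedBall_mem_nhds _ hr))
  obtain ⟨ρ, hρ, hsub⟩ := exists_eball_subset hW
  have hρ2 : 0 < ρ / 2 := half_pos hρ
  refine ⟨ρ / 2, hρ2, ?_⟩
  rw [nhds_prod_eq]
  filter_upwards [(hev r le_rfl).prod_mk
    (Metric.eball_mem_nhds x (ENNReal.ofReal_pos.2 hρ2))] with p hp u hu v hv huv
  have hmem : ∀ u ∈ Metric.eball p.2 (ENNReal.ofReal (ρ / 2)), u ∈ (extChartAt (𝓡 d) x).source ∧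
      extChartAt (𝓡 d) x u ∈ Metric.closedBall (extChartAt (𝓡 d) x x) r := by
    intro u hu
    refine hsub ?_
    have : ENNReal.ofReal ρ = ENNReal.ofReal (ρ / 2) + ENNReal.ofReal (ρ / 2) := by
      rw [← ENNReal.ofReal_add hρ2.le hρ2.le, add_halves]
    rw [Metric.mem_eball, this]
    exact (edist_triangle u p.2 x).trans_lt (ENNReal.add_lt_add hu hp.2)
  have hu' := hmem u hu
  have hv' := hmem v hv
  refine (extChartAt (𝓡 d) x).injOn hu'.1 hv'.1 ?_
  refine (hp.1.2.injOn (Or.inr hc)) hu'.2 hv'.2 ?_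
  simp only [chartRep, Function.comp, (extChartAt (𝓡 d) x).left_inv hu'.1,
    (extChartAt (𝓡 d) x).left_inv hv'.1, huv]

/-- The quantitative inverse function theorem for the representatives: a map that is `c`-close to
`e` on a ball of radius `r / 2` covers a ball of radius `s`. As `e` and `c` do not depend on the
parameter or the base point, neither does the radius. -/
lemma exists_surjOn_eball (hd : d ≠ 0) (hΦ : Continuous[inferInstance, c2Topology d M] Φ)
    {t₀ : T} {x : M} (h : (modelDeriv d (Φ t₀) x).IsInvertible) {R : ℝ} (hR : 0 < R) :
    ∃ ρ, 0 < ρ ∧ ∀ᶠ p : T × M in 𝓝 (t₀, x), ∀ y ∈ Metric.eball (Φ p.1 p.2) (ENNReal.ofReal ρ),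
      ∃ u ∈ Metric.eball p.2 (ENNReal.ofReal R), Φ p.1 u = y := by
  obtain ⟨e, c, hc, r₀, hr₀, hev⟩ := exists_approximatesLinearOn hd hΦ h
  have hR2 : 0 < R / 2 := half_pos hR
  have hRR : ENNReal.ofReal R = ENNReal.ofReal (R / 2) + ENNReal.ofReal (R / 2) := by
    rw [← ENNReal.ofReal_add hR2.le hR2.le, add_halves]
  obtain ⟨r₁, hr₁, hsymm⟩ := Metric.nhds_basis_closedBall.mem_iff.1
    ((continuousAt_extChartAt_symm (I := 𝓡 d) x) (by
      rw [extChartAt_to_inv]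
      exact Metric.eball_mem_nhds x (ENNReal.ofReal_pos.2 hR2)))
  set r := min r₀ r₁ with hr
  have hrpos : 0 < r := lt_min hr₀ hr₁
  set N := ‖(e.symm : EuclideanSpace ℝ (Fin d) →L[ℝ] EuclideanSpace ℝ (Fin d))‖₊⁻¹ with hN
  have hNc : (0 : ℝ) < (N : ℝ) - c := sub_pos.2 (by exact_mod_cast hc)
  set s := ((N : ℝ) - c) * (r / 2) with hs
  have hspos : 0 < s := by positivity
  set y₀ := Φ t₀ x with hy₀
  have hW : (extChartAt (𝓡 d) y₀).source ∩
      extChartAt (𝓡 d) y₀ ⁻¹' Metric.ball (extChartAt (𝓡 d) y₀ y₀) (s / 2) ∈ 𝓝 y₀ :=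
    inter_mem (extChartAt_source_mem_nhds y₀)
      ((continuousAt_extChartAt y₀) (Metric.ball_mem_nhds _ (by positivity)))
  obtain ⟨ρ, hρ, hsub⟩ := exists_eball_subset hW
  have hρ2 : 0 < ρ / 2 := half_pos hρ
  have hρρ : ENNReal.ofReal ρ = ENNReal.ofReal (ρ / 2) + ENNReal.ofReal (ρ / 2) := by
    rw [← ENNReal.ofReal_add hρ2.le hρ2.le, add_halves]
  refine ⟨ρ / 2, hρ2, ?_⟩
  have hcont : ∀ᶠ p : T × M in 𝓝 (t₀, x), Φ p.1 p.2 ∈ Metric.eball y₀ (ENNReal.ofReal (ρ / 2)) :=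
    (continuous_eval_of_c2 hΦ).continuousAt
      (Metric.eball_mem_nhds _ (ENNReal.ofReal_pos.2 hρ2))
  have hx : ∀ᶠ a in 𝓝 x, a ∈ Metric.eball x (ENNReal.ofReal (R / 2)) ∧
      a ∈ (extChartAt (𝓡 d) x).source ∧
      extChartAt (𝓡 d) x a ∈ Metric.closedBall (extChartAt (𝓡 d) x x) (r / 2) :=
    Filter.Eventually.and (Metric.eball_mem_nhds x (ENNReal.ofReal_pos.2 hR2))
      (Filter.Eventually.and (extChartAt_source_mem_nhds x)
        ((continuousAt_extChartAt x) (Metric.closedBall_mem_nhds _ (half_pos hrpos))))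
  have hprod := (hev r (min_le_left _ _)).prod_mk hx
  rw [← nhds_prod_eq] at hprod
  filter_upwards [hcont, hprod] with p hpc hp y hy
  obtain ⟨⟨hmem, happ⟩, hpx, hps, hpr⟩ := hp
  have hΦp := hsub (Metric.eball_subset_eball (ENNReal.ofReal_le_ofReal (by linarith)) hpc)
  have hyW := hsub (show y ∈ Metric.eball y₀ (ENNReal.ofReal ρ) by
    rw [Metric.mem_eball, hρρ]
    exact (edist_triangle y (Φ p.1 p.2) y₀).trans_lt (ENNReal.add_lt_add hy hpc))
  have hball : Metric.closedBall (extChartAt (𝓡 d) x p.2) (r / 2) ⊆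
      Metric.closedBall (extChartAt (𝓡 d) x x) r := by
    refine Metric.closedBall_subset_closedBall' ?_
    linarith [Metric.mem_closedBall.1 hpr]
  have hsurj := happ.surjOn_closedBall_of_nonlinearRightInverse e.toNonlinearRightInverse
    (half_pos hrpos).le hball
  have hrep : chartRep d (Φ p.1) x y₀ (extChartAt (𝓡 d) x p.2) =
      extChartAt (𝓡 d) y₀ (Φ p.1 p.2) := by
    simp only [chartRep, Function.comp, (extChartAt (𝓡 d) x).left_inv hps]
  obtain ⟨z, hz, hzy⟩ := hsurj (show extChartAt (𝓡 d) y₀ y ∈ _ by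
    rw [hrep, Metric.mem_closedBall]
    have h1 := Metric.mem_ball.1 hyW.2
    have h2 := Metric.mem_ball'.1 hΦp.2
    have h3 := dist_triangle (extChartAt (𝓡 d) y₀ y) (extChartAt (𝓡 d) y₀ y₀)
      (extChartAt (𝓡 d) y₀ (Φ p.1 p.2))
    have h4 : dist (extChartAt (𝓡 d) y₀ y) (extChartAt (𝓡 d) y₀ (Φ p.1 p.2)) ≤ s := by linarith
    exact h4)
  refine ⟨(extChartAt (𝓡 d) x).symm z, ?_, ?_⟩
  · have h1 : (extChartAt (𝓡 d) x).symm z ∈ Metric.eball x (ENNReal.ofReal (R / 2)) :=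
      hsymm (Metric.closedBall_subset_closedBall (min_le_right _ _) (hball hz))
    rw [Metric.mem_eball, hRR]
    exact (edist_triangle_right _ _ x).trans_lt (ENNReal.add_lt_add h1 hpx)
  · exact (extChartAt (𝓡 d) y₀).injOn (hmem z (hball hz)).2 hyW.1 hzy

end LocalEstimates

/-! ### Uniform Lipschitz bounds for the logarithm of the Jacobian -/

section LogJacobian

variable {d : ℕ} {M : Type*} [EMetricSpace M] [ChartedSpace (EuclideanSpace ℝ (Fin d)) M]
  [IsManifold (𝓡 d) ∞ M] [CompactSpace M] {T : Type*} [TopologicalSpace T]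
  {Φ : T → C^2⟮𝓡 d, M; 𝓡 d, M⟯}
  [RiemannianBundle (fun x : M => TangentSpace (𝓡 d) x)]
  [IsContMDiffRiemannianBundle (𝓡 d) ∞ (EuclideanSpace ℝ (Fin d))
    (fun x : M => TangentSpace (𝓡 d) x)] [IsRiemannianManifold (𝓡 d) M]

variable (d) in
/-- The logarithm of the Jacobian in coordinates, in terms of the derivative, the image and the
point. -/
noncomputable def chartLogJacobian (x y : M) (q : (EuclideanSpace ℝ (Fin d) →L[ℝ]
    EuclideanSpace ℝ (Fin d)) × EuclideanSpace ℝ (Fin d) × EuclideanSpace ℝ (Fin d)) : ℝ :=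
  Real.log q.1.det + Real.log (chartDensity d y q.2.1) - Real.log (chartDensity d x q.2.2)

lemma log_jacobian_eq {g : M → M} {x y a : M} (ha : a ∈ (extChartAt (𝓡 d) x).source)
    (hg : MDifferentiableAt (𝓡 d) (𝓡 d) g a) (hga : g a ∈ (extChartAt (𝓡 d) y).source)
    (h : (modelDeriv d g a).IsInvertible) :
    Real.log (jacobian d g a) = chartLogJacobian d x y
      (fderiv ℝ (chartRep d g x y) (extChartAt (𝓡 d) x a),
        chartRep d g x y (extChartAt (𝓡 d) x a), extChartAt (𝓡 d) x a) := by
  have hdet := (isInvertible_modelDeriv_iff ha hg hga).1 h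
  have hrep : chartRep d g x y (extChartAt (𝓡 d) x a) = extChartAt (𝓡 d) y (g a) := by
    simp only [chartRep, Function.comp, (extChartAt (𝓡 d) x).left_inv ha]
  have h1 := (chartDensity_pos ((extChartAt (𝓡 d) x).map_source ha)).ne'
  have h2 := (chartDensity_pos ((extChartAt (𝓡 d) y).map_source hga)).ne'
  rw [jacobian_eq_chart ha hg hga, Real.log_div (mul_ne_zero (abs_ne_zero.2 hdet) h2) h1,
    Real.log_mul (abs_ne_zero.2 hdet) h2, Real.log_abs, chartLogJacobian, hrep]

lemma jacobian_pos {g : M → M} {a : M} (hg : MDifferentiableAt (𝓡 d) (𝓡 d) g a)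
    (h : (modelDeriv d g a).IsInvertible) : 0 < jacobian d g a := by
  have ha := mem_extChartAt_source (I := 𝓡 d) a
  have hga := mem_extChartAt_source (I := 𝓡 d) (g a)
  rw [jacobian_eq_chart ha hg hga]
  have hdet := (isInvertible_modelDeriv_iff ha hg hga).1 h
  have h1 := chartDensity_pos ((extChartAt (𝓡 d) a).map_source ha)
  have h2 := chartDensity_pos ((extChartAt (𝓡 d) (g a)).map_source hga)
  have h3 := abs_pos.2 hdet
  positivity

lemma contDiffAt_chartLogJacobian {x y : M} {L : EuclideanSpace ℝ (Fin d) →L[ℝ]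
    EuclideanSpace ℝ (Fin d)} {w z : EuclideanSpace ℝ (Fin d)} (hL : L.det ≠ 0)
    (hw : w ∈ (extChartAt (𝓡 d) y).target) (hz : z ∈ (extChartAt (𝓡 d) x).target) :
    ContDiffAt ℝ 1 (chartLogJacobian d x y) (L, w, z) := by
  have hdens : ∀ (x : M) (z : EuclideanSpace ℝ (Fin d)), z ∈ (extChartAt (𝓡 d) x).target →
      ContDiffAt ℝ 1 (fun z => Real.log (chartDensity d x z)) z := fun x z hz =>
    ((contDiffOn_chartDensity x).contDiffAt ((isOpen_extChartAt_target x).mem_nhds hz)).log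
      (chartDensity_pos hz).ne'
  refine ContDiffAt.sub (ContDiffAt.add ?_ ?_) ?_
  · exact (contDiff_det.contDiffAt.comp (L, w, z) contDiffAt_fst).log hL
  · exact ContDiffAt.comp (f := fun q : (EuclideanSpace ℝ (Fin d) →L[ℝ]
      EuclideanSpace ℝ (Fin d)) × EuclideanSpace ℝ (Fin d) × EuclideanSpace ℝ (Fin d) => q.2.1)
      (L, w, z) (hdens y w hw) (by fun_prop)
  · exact ContDiffAt.comp (f := fun q : (EuclideanSpace ℝ (Fin d) →L[ℝ]
      EuclideanSpace ℝ (Fin d)) × EuclideanSpace ℝ (Fin d) × EuclideanSpace ℝ (Fin d) => q.2.2)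
      (L, w, z) (hdens x z hz) (by fun_prop)

/-- In charts the logarithm is a `C¹` function of the derivative, the image and the point; this
triple is Lipschitz in the point with constants uniform in the parameter. For the derivative, this
uses the uniform bound on second derivatives, the place where closeness in `C²` is needed. The
constant is written `1 / ρ`, so that a single parameter measures radius and constant. -/
lemma exists_lipschitz_logJacobian (hΦ : Continuous[inferInstance, c2Topology d M] Φ)
    {t₀ : T} {x : M} (h : (modelDeriv d (Φ t₀) x).IsInvertible) :
    ∃ ρ, 0 < ρ ∧ ∀ᶠ p : T × M in 𝓝 (t₀, x), ∀ u ∈ Metric.eball p.2 (ENNReal.ofReal ρ),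
      |Real.log (jacobian d (Φ p.1) u) - Real.log (jacobian d (Φ p.1) p.2)| ≤
        1 / ρ * (edist u p.2).toReal := by
  set y := Φ t₀ x with hy
  set z₀ := extChartAt (𝓡 d) x x with hz₀
  set Ψ : T → EuclideanSpace ℝ (Fin d) → (EuclideanSpace ℝ (Fin d) →L[ℝ]
    EuclideanSpace ℝ (Fin d)) × EuclideanSpace ℝ (Fin d) × EuclideanSpace ℝ (Fin d) := fun t z =>
    (fderiv ℝ (chartRep d (Φ t) x y) z, chartRep d (Φ t) x y z, z) with hΨ
  have hΨc : ContinuousAt (fun p : T × EuclideanSpace ℝ (Fin d) => Ψ p.1 p.2) (t₀, z₀) :=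
    (continuousAt_fderiv_chartRep hΦ t₀ x).prodMk
      ((continuousAt_chartRep hΦ t₀ x).prodMk continuousAt_snd)
  have hrep0 : chartRep d (Φ t₀) x y z₀ = extChartAt (𝓡 d) y y := by
    simp only [chartRep, Function.comp, hz₀, extChartAt_to_inv, hy]
  have hdet0 := (isInvertible_modelDeriv_iff (mem_extChartAt_source x) (mdifferentiableAt_c2 _ _)
    (mem_extChartAt_source (Φ t₀ x))).1 h
  obtain ⟨K, s, hs, hlip⟩ := (contDiffAt_chartLogJacobian (x := x) (y := y) hdet0
    (w := chartRep d (Φ t₀) x y z₀) (z := z₀) (by rw [hrep0]; exact mem_extChartAt_target y)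
    (mem_extChartAt_target x)).exists_lipschitzOnWith
  set C₁ := ‖fderiv ℝ (chartRep d (Φ t₀) x y) z₀‖ + 1 with hC₁
  obtain ⟨C₂, hC₂⟩ := eventually_norm_fderiv_fderiv_chartRep_le hΦ t₀ x
  obtain ⟨r, hr, hball⟩ := exists_closedBall_of_eventually (t₀ := t₀) (z := z₀) (Q := fun t z =>
    (z ∈ (extChartAt (𝓡 d) x).target ∧
      Φ t ((extChartAt (𝓡 d) x).symm z) ∈ (extChartAt (𝓡 d) y).source) ∧ Ψ t z ∈ s ∧
    ‖fderiv ℝ (chartRep d (Φ t) x y) z‖ ≤ C₁ ∧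
    ‖fderiv ℝ (fderiv ℝ (chartRep d (Φ t) x y)) z‖ ≤ C₂ ∧
    (fderiv ℝ (chartRep d (Φ t) x y) z).det ≠ 0) (by
      filter_upwards [eventually_chartRep_close hΦ t₀ x one_pos, hΨc hs,
        (continuousAt_fderiv_chartRep hΦ t₀ x).norm.eventually_lt_const (lt_add_one _),
        hC₂,
        (ContinuousLinearMap.continuous_det.continuousAt.comp
          (continuousAt_fderiv_chartRep hΦ t₀ x)).eventually_ne hdet0] with p h1 h2 h3 h4 h5
      exact ⟨⟨h1.1, h1.2.1⟩, h2, h3.le, h4, h5⟩)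
  obtain ⟨C, hCtop, ρ₁, hρ₁, hchart⟩ := exists_lipschitz_extChartAt (d := d) x
  have hW : Metric.eball x (ENNReal.ofReal ρ₁) ∩ ((extChartAt (𝓡 d) x).source ∩
      extChartAt (𝓡 d) x ⁻¹' Metric.closedBall z₀ r) ∈ 𝓝 x :=
    inter_mem (Metric.eball_mem_nhds x (ENNReal.ofReal_pos.2 hρ₁))
      (inter_mem (extChartAt_source_mem_nhds x)
        ((continuousAt_extChartAt x) (Metric.closedBall_mem_nhds _ hr)))
  obtain ⟨ρ₂, hρ₂, hsub⟩ := exists_eball_subset hW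
  set C₃ := max C₂ (max C₁ 1) with hC₃
  have hC₃0 : 0 ≤ C₃ := le_max_of_le_right (le_max_of_le_right zero_le_one)
  set B := (K : ℝ) * (C₃ * C.toReal) with hB
  have hB0 : 0 ≤ B := by positivity
  set ρ := min (ρ₂ / 2) (1 / (B + 1)) with hρ
  have hρpos : 0 < ρ := lt_min (half_pos hρ₂) (by positivity)
  have hBρ : B ≤ 1 / ρ := by
    have : ρ ≤ 1 / (B + 1) := min_le_right _ _
    have h2 := one_div_le_one_div_of_le hρpos this
    rw [one_div_one_div] at h2
    linarith
  refine ⟨ρ, hρpos, ?_⟩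
  rw [nhds_prod_eq]
  filter_upwards [(hball r le_rfl).prod_mk
    (Metric.eball_mem_nhds x (ENNReal.ofReal_pos.2 (half_pos hρ₂)))] with p hp u hu
  obtain ⟨hpt, hpx⟩ := hp
  have hmem : ∀ a ∈ Metric.eball x (ENNReal.ofReal ρ₂),
      a ∈ Metric.eball x (ENNReal.ofReal ρ₁) ∧ a ∈ (extChartAt (𝓡 d) x).source ∧
      extChartAt (𝓡 d) x a ∈ Metric.closedBall z₀ r := fun a ha => hsub ha
  have hp2 := hmem p.2 (Metric.eball_subset_eball (ENNReal.ofReal_le_ofReal (by linarith)) hpx)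
  have hu2 := hmem u (by
    have : ENNReal.ofReal ρ₂ = ENNReal.ofReal (ρ₂ / 2) + ENNReal.ofReal (ρ₂ / 2) := by
      rw [← ENNReal.ofReal_add (by linarith) (by linarith), add_halves]
    rw [Metric.mem_eball, this]
    refine (edist_triangle u p.2 x).trans_lt (ENNReal.add_lt_add (lt_of_lt_of_le hu ?_) hpx)
    exact ENNReal.ofReal_le_ofReal (min_le_left _ _))
  have hcd : ∀ z ∈ Metric.closedBall z₀ r, ContDiffAt ℝ 2 (chartRep d (Φ p.1) x y) z := fun z hz =>
    contDiffAt_chartRep (n := 2) (hpt z hz).1.1 (Φ p.1).contMDiff.contMDiffAt (hpt z hz).1.2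
  have hlog : ∀ a, a ∈ (extChartAt (𝓡 d) x).source →
      extChartAt (𝓡 d) x a ∈ Metric.closedBall z₀ r → Real.log (jacobian d (Φ p.1) a) =
        chartLogJacobian d x y (Ψ p.1 (extChartAt (𝓡 d) x a)) := by
    intro a ha har
    have hga := (hpt _ har).1.2
    rw [(extChartAt (𝓡 d) x).left_inv ha] at hga
    exact log_jacobian_eq ha (mdifferentiableAt_c2 _ _) hga
      ((isInvertible_modelDeriv_iff ha (mdifferentiableAt_c2 _ _) hga).2 (hpt _ har).2.2.2.2)
  have hΨlip : ∀ z ∈ Metric.closedBall z₀ r, ∀ z' ∈ Metric.closedBall z₀ r,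
      dist (Ψ p.1 z) (Ψ p.1 z') ≤ C₃ * dist z z' := by
    intro z hz z' hz'
    have b1 : dist (fderiv ℝ (chartRep d (Φ p.1) x y) z) (fderiv ℝ (chartRep d (Φ p.1) x y) z') ≤
        C₂ * dist z z' := by
      rw [dist_eq_norm, dist_eq_norm]
      exact (convex_closedBall z₀ r).norm_image_sub_le_of_norm_fderiv_le (𝕜 := ℝ)
        (fun w hw => ((hcd w hw).fderiv_right (m := 1) (by norm_num)).differentiableAt one_ne_zero)
        (fun w hw => (hpt w hw).2.2.2.1) hz' hz
    have b2 : dist (chartRep d (Φ p.1) x y z) (chartRep d (Φ p.1) x y z') ≤ C₁ * dist z z' := by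
      rw [dist_eq_norm, dist_eq_norm]
      exact (convex_closedBall z₀ r).norm_image_sub_le_of_norm_fderiv_le (𝕜 := ℝ)
        (fun w hw => (hcd w hw).differentiableAt two_ne_zero)
        (fun w hw => (hpt w hw).2.2.1) hz' hz
    have d0 : 0 ≤ dist z z' := dist_nonneg
    rw [Prod.dist_eq, Prod.dist_eq]
    refine max_le (b1.trans ?_) (max_le (b2.trans ?_) ?_)
    · exact mul_le_mul_of_nonneg_right (le_max_left _ _) d0
    · exact mul_le_mul_of_nonneg_right (le_max_of_le_right (le_max_left _ _)) d0
    · exact le_mul_of_one_le_left d0 (le_max_of_le_right (le_max_right _ _))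
  rw [hlog u hu2.2.1 hu2.2.2, hlog p.2 hp2.2.1 hp2.2.2, ← Real.dist_eq]
  have e1 := hlip.dist_le_mul _ (hpt _ hu2.2.2).2.1 _ (hpt _ hp2.2.2).2.1
  have e2 := hΨlip _ hu2.2.2 _ hp2.2.2
  have hfin : edist u p.2 ≠ ⊤ := (lt_of_lt_of_le hu le_top).ne
  have e3 : dist (extChartAt (𝓡 d) x u) (extChartAt (𝓡 d) x p.2) ≤
      C.toReal * (edist u p.2).toReal := by
    rw [dist_edist, ← ENNReal.toReal_mul]
    exact ENNReal.toReal_mono (ENNReal.mul_ne_top hCtop hfin) (hchart u hu2.1 p.2 hp2.1)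
  calc _ ≤ _ := e1
    _ ≤ K * (C₃ * (C.toReal * (edist u p.2).toReal)) := by gcongr; exact e2.trans (by gcongr)
    _ = B * (edist u p.2).toReal := by rw [hB]; ring
    _ ≤ _ := by gcongr

end LogJacobian

/-! ### Inverse branches -/

section InverseBranch

variable {d : ℕ} {M : Type*} [EMetricSpace M] [ChartedSpace (EuclideanSpace ℝ (Fin d)) M]
  [IsManifold (𝓡 d) ∞ M]

/-- The inverse function theorem on a manifold. -/
lemma exists_local_inverse {g : M → M} {u : M} (hg : ContMDiffAt (𝓡 d) (𝓡 d) 2 g u)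
    (hinv : (modelDeriv d g u).IsInvertible) : ∃ k : M → M,
      ContMDiffAt (𝓡 d) (𝓡 d) 2 k (g u) ∧ k (g u) = u ∧ ∀ᶠ y in 𝓝 (g u), g (k y) = y := by
  set φ := extChartAt (𝓡 d) u with hφ
  set ψ := extChartAt (𝓡 d) (g u) with hψ
  have hu : φ.symm (φ u) = u := extChartAt_to_inv u
  have hcd : ContDiffAt ℝ 2 (chartRep d g u (g u)) (φ u) :=
    contDiffAt_chartRep (n := 2) (mem_extChartAt_target u) (by rw [← hφ, hu]; exact hg)
      (by rw [← hφ, hu]; exact mem_extChartAt_source _)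
  have hdet := (isInvertible_modelDeriv_iff (mem_extChartAt_source u)
    (hg.mdifferentiableAt two_ne_zero) (mem_extChartAt_source (g u))).1 hinv
  rw [det_ne_zero_iff_injective, ← isInvertible_iff_injective] at hdet
  obtain ⟨e, he⟩ := hdet
  have hfd : HasFDerivAt (chartRep d g u (g u))
      (e : EuclideanSpace ℝ (Fin d) →L[ℝ] EuclideanSpace ℝ (Fin d)) (φ u) := by
    rw [he]; exact (hcd.differentiableAt two_ne_zero).hasFDerivAt
  set j := hcd.localInverse hfd two_ne_zero with hj
  have hrep : chartRep d g u (g u) (φ u) = ψ (g u) := by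
    simp only [chartRep, Function.comp, ← hφ, hu, ← hψ]
  have hj0 : j (ψ (g u)) = φ u := by
    rw [← hrep]; exact hcd.localInverse_apply_image hfd two_ne_zero
  have hjc : ContDiffAt ℝ 2 j (ψ (g u)) := by
    rw [← hrep]; exact hcd.to_localInverse hfd two_ne_zero
  have hjr : ∀ᶠ z in 𝓝 (ψ (g u)), chartRep d g u (g u) (j z) = z := by
    rw [← hrep]
    exact (hcd.hasStrictFDerivAt' hfd two_ne_zero).eventually_right_inverse
  have hkc : ContMDiffAt (𝓡 d) (𝓡 d) 2 (fun y => φ.symm (j (ψ y))) (g u) := by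
    have h1 : ContMDiffAt (𝓡 d) (𝓡 d) 2 ψ (g u) := contMDiffAt_extChartAt
    have h2 : ContMDiffAt (𝓡 d) (𝓡 d) 2 j (ψ (g u)) := hjc.contMDiffAt
    have h3 : ContMDiffAt (𝓡 d) (𝓡 d) 2 φ.symm (j (ψ (g u))) := by
      rw [hj0]
      exact (contMDiffOn_extChartAt_symm u).contMDiffAt (extChartAt_target_mem_nhds u)
    exact h3.comp (g u) (h2.comp (g u) h1)
  have hk0 : φ.symm (j (ψ (g u))) = u := by rw [hj0, hu]
  refine ⟨fun y => φ.symm (j (ψ y)), hkc, hk0, ?_⟩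
  have hgk : ContinuousAt (fun y => g (φ.symm (j (ψ y)))) (g u) := by
    refine ContinuousAt.comp (f := fun y => φ.symm (j (ψ y))) (g := g) ?_ hkc.continuousAt
    simp only [hk0]
    exact hg.continuousAt
  have hsrc : ∀ᶠ y in 𝓝 (g u), g (φ.symm (j (ψ y))) ∈ ψ.source := by
    refine hgk ?_
    simp only [hk0]
    exact extChartAt_source_mem_nhds (g u)
  filter_upwards [hsrc, extChartAt_source_mem_nhds (I := 𝓡 d) (g u),
    (continuousAt_extChartAt (g u)).eventually hjr] with y h1 h2 h3
  exact ψ.injOn h1 h2 h3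

/-- A set-theoretic section with values in a set on which `g` is injective must agree near each
point with the local inverse given by the inverse function theorem; so it is `C²`, although no
continuity is assumed. -/
lemma contMDiffAt_inverse_branch {g k : M → M} {s V : Set M}
    (hg : ∀ u ∈ s, ContMDiffAt (𝓡 d) (𝓡 d) 2 g u)
    (hinv : ∀ u ∈ s, (modelDeriv d g u).IsInvertible) (hs : IsOpen s) (hinj : InjOn g s)
    (hV : IsOpen V) (hks : ∀ y ∈ V, k y ∈ s) (hgk : ∀ y ∈ V, g (k y) = y) {y : M} (hy : y ∈ V) :
    ContMDiffAt (𝓡 d) (𝓡 d) 2 k y := by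
  obtain ⟨j, hj, hj0, hjr⟩ := exists_local_inverse (hg _ (hks y hy)) (hinv _ (hks y hy))
  rw [hgk y hy] at hj hj0 hjr
  refine hj.congr_of_eventuallyEq ?_
  have : ∀ᶠ z in 𝓝 y, j z ∈ s := hj.continuousAt (hs.mem_nhds (by rw [hj0]; exact hks y hy))
  filter_upwards [this, hjr, hV.mem_nhds hy] with z h1 h2 h3
  exact hinj (hks z h3) h1 (by rw [hgk z h3, h2])

lemma isC2DiffeoOnto_of_bijOn {g : M → M} {U V : Set M} (hU : IsOpen U) (hV : IsOpen V)
    (hg : ∀ u ∈ U, ContMDiffAt (𝓡 d) (𝓡 d) 2 g u)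
    (hinv : ∀ u ∈ U, (modelDeriv d g u).IsInvertible) (hbij : BijOn g U V) :
    IsC2DiffeoOnto d g U V := by
  rcases U.eq_empty_or_nonempty with rfl | ⟨u₀, hu₀⟩
  · have hVe : V = ∅ := by rw [← hbij.image_eq, image_empty]
    subst hVe
    exact ⟨hbij, fun _ h => h.elim, id, fun _ h => h.elim, fun _ h => h.elim, fun _ h => h.elim⟩
  have : Nonempty M := ⟨u₀⟩
  refine ⟨hbij, fun u hu => (hg u hu).contMDiffWithinAt, Function.invFunOn g U, fun y hy => ?_,
    hbij.invOn_invFunOn⟩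
  exact (contMDiffAt_inverse_branch hg hinv hU hbij.injOn hV
    (fun y hy => hbij.surjOn.mapsTo_invFunOn hy)
    (fun y hy => hbij.surjOn.rightInvOn_invFunOn hy) hy).contMDiffWithinAt

variable [RiemannianBundle (fun x : M => TangentSpace (𝓡 d) x)] [IsRiemannianManifold (𝓡 d) M]

/-- The derivative of `g` undoes that of `k`, so the bound for the inverse derivative of `g` at `k
y` is a bound for the derivative of `k` at `y`. -/
lemma enorm_mfderiv_right_inverse_le {g k : M → M} {y : M} {C : ℝ}
    (hg : MDifferentiableAt (𝓡 d) (𝓡 d) g (k y)) (hk : MDifferentiableAt (𝓡 d) (𝓡 d) k y)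
    (hinv : (modelDeriv d g (k y)).IsInvertible) (hgk : ∀ᶠ z in 𝓝 y, g (k z) = z)
    (hC : normInvDeriv d g (k y) ≤ C) (v : TangentSpace (𝓡 d) y) :
    ‖mfderiv (𝓡 d) (𝓡 d) k y v‖ₑ ≤ ENNReal.ofReal C * ‖v‖ₑ := by
  have hC0 : 0 ≤ C := (normInvDeriv_nonneg _ _).trans hC
  have h1 : modelDeriv d g (k y) (modelDeriv d k y v) = v := by
    have e1 : mfderiv (𝓡 d) (𝓡 d) (g ∘ k) y = (mfderiv (𝓡 d) (𝓡 d) g (k y)).comp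
      (mfderiv (𝓡 d) (𝓡 d) k y) := mfderiv_comp y hg hk
    have e2 : mfderiv (𝓡 d) (𝓡 d) (g ∘ k) y = mfderiv (𝓡 d) (𝓡 d) id y :=
      (show g ∘ k =ᶠ[𝓝 y] id from hgk).mfderiv_eq
    have e3 := DFunLike.congr_fun (e1.symm.trans e2) v
    rw [mfderiv_id] at e3
    exact e3
  have h2 := (normInvDeriv_le_iff hinv hC0).1 hC (modelDeriv d k y v)
  rw [h1, hgk.self_of_nhds] at h2
  have h3 : riemForm d (k y) (modelDeriv d k y v) (modelDeriv d k y v) =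
    ‖mfderiv (𝓡 d) (𝓡 d) k y v‖ ^ 2 := riemForm_self _ _
  have h4 : riemForm d y v v = ‖v‖ ^ 2 := riemForm_self _ _
  have h5 : ‖mfderiv (𝓡 d) (𝓡 d) k y v‖ ^ 2 ≤ (C * ‖v‖) ^ 2 := by
    rw [mul_pow]
    exact h3.symm.trans_le (h2.trans_eq (congrArg (C ^ 2 * ·) h4))
  have h6 := le_of_sq_le_sq h5 (by positivity)
  rw [← ofReal_norm, ← ofReal_norm, ← ENNReal.ofReal_mul hC0]
  exact ENNReal.ofReal_le_ofReal h6

/-- Expansion along inverse branches. -/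
lemma edist_le_of_inverse_branch {g : M → M} (hg : ContMDiff (𝓡 d) (𝓡 d) 2 g) {x : M}
    {R ρ : ℝ≥0∞} {C : ℝ} (hinv : ∀ u, (modelDeriv d g u).IsInvertible)
    (hinj : InjOn g (Metric.eball x R))
    (hC : ∀ u ∈ Metric.eball x R, normInvDeriv d g u ≤ C)
    (hsurj : ∀ y ∈ Metric.eball (g x) (3 * ρ), ∃ u ∈ Metric.eball x R, g u = y) {u u' : M}
    (hu : u ∈ Metric.eball x R) (hu' : u' ∈ Metric.eball x R)
    (hgu : g u ∈ Metric.eball (g x) ρ) (hgu' : g u' ∈ Metric.eball (g x) ρ) :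
    edist u u' ≤ ENNReal.ofReal C * edist (g u) (g u') := by
  classical
  have hsurj' : ∀ y, ∃ v, y ∈ Metric.eball (g x) (3 * ρ) → v ∈ Metric.eball x R ∧ g v = y := by
    intro y
    by_cases hy : y ∈ Metric.eball (g x) (3 * ρ)
    · obtain ⟨v, h1, h2⟩ := hsurj y hy
      exact ⟨v, fun _ => ⟨h1, h2⟩⟩
    · exact ⟨x, fun h => (hy h).elim⟩
  choose k hk using hsurj'
  have hsub : Metric.eball (g x) ρ ⊆ Metric.eball (g x) (3 * ρ) :=
    Metric.eball_subset_eball (le_mul_of_one_le_left' (by norm_num))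
  have hkc : ∀ y ∈ Metric.eball (g x) (3 * ρ), ContMDiffAt (𝓡 d) (𝓡 d) 2 k y := fun y hy =>
    contMDiffAt_inverse_branch (fun u _ => hg u) (fun u _ => hinv u) Metric.isOpen_eball hinj
      Metric.isOpen_eball (fun y hy => (hk y hy).1) (fun y hy => (hk y hy).2) hy
  -- The branch has to exist on the ball of radius `3 * ρ`, since the paths joining two points of
  -- the `ρ`-ball may leave that ball.
  have h := edist_le_of_mfderiv_le (I₁ := 𝓡 d) (I₂ := 𝓡 d) (h := k) (x₀ := g x) (R := ρ)
    (ENNReal.ofReal_ne_top (r := C)) (fun y hy => (hkc y hy).of_le one_le_two)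
    (fun y hy v => enorm_mfderiv_right_inverse_le (hg.mdifferentiable two_ne_zero _)
      ((hkc y hy).mdifferentiableAt two_ne_zero) (hinv _)
      (by filter_upwards [Metric.isOpen_eball.mem_nhds hy] with z hz using (hk z hz).2)
      (hC _ (hk y hy).1) v) hgu hgu'
  have e1 : k (g u) = u := hinj (hk _ (hsub hgu)).1 hu (hk _ (hsub hgu)).2
  have e2 : k (g u') = u' := hinj (hk _ (hsub hgu')).1 hu' (hk _ (hsub hgu')).2
  rwa [e1, e2] at h

end InverseBranch

/-! ### The truncated distance -/

section TruncDist

variable {X : Type*} [EMetricSpace X]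

/-- The distance truncated at `1`; it is finite also if the space is not connected. -/
noncomputable def truncDist (x y : X) : ℝ := (min (edist x y) 1).toReal

lemma truncDist_lt_iff {x y : X} {ρ : ℝ} (hρ1 : ρ ≤ 1) :
    truncDist x y < ρ ↔ edist x y < ENNReal.ofReal ρ := by
  have hfin : min (edist x y) 1 ≠ ⊤ := (min_le_right _ _).trans_lt ENNReal.one_lt_top |>.ne
  rw [truncDist, ← ENNReal.lt_ofReal_iff_toReal_lt hfin, min_lt_iff]
  refine ⟨fun h => h.resolve_right fun h1 => ?_, Or.inl⟩
  have := ENNReal.ofReal_le_ofReal hρ1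
  rw [ENNReal.ofReal_one] at this
  exact (h1.trans_le this).false

lemma truncDist_eq_toReal {x y : X} (h : edist x y ≤ 1) : truncDist x y = (edist x y).toReal := by
  rw [truncDist, min_eq_left h]

lemma truncDist_le_toReal {x y : X} (h : edist x y ≠ ⊤) : truncDist x y ≤ (edist x y).toReal :=
  ENNReal.toReal_mono h (min_le_left _ _)

lemma truncDist_le_of_edist_le {x y x' y' : X} {C : ℝ} (hC : 0 ≤ C)
    (h : edist x y ≤ ENNReal.ofReal C * edist x' y') (h' : edist x' y' ≤ 1) :
    truncDist x y ≤ C * truncDist x' y' := by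
  have hfin : ENNReal.ofReal C * edist x' y' ≠ ⊤ :=
    ENNReal.mul_ne_top ENNReal.ofReal_ne_top (h'.trans_lt ENNReal.one_lt_top).ne
  rw [truncDist_eq_toReal h']
  refine (truncDist_le_toReal (h.trans_lt hfin.lt_top).ne).trans ?_
  refine (ENNReal.toReal_mono hfin h).trans_eq ?_
  rw [ENNReal.toReal_mul, ENNReal.toReal_ofReal hC]

variable (X) in
/-- The truncated distance as a metric, which induces the given uniform structure. -/
@[reducible] noncomputable def truncMetric : MetricSpace X where
  dist := truncDist
  dist_self x := by simp [truncDist]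
  dist_comm x y := by simp [truncDist, edist_comm]
  dist_triangle x y z := by
    have hfin : ∀ a b : X, min (edist a b) 1 ≠ ⊤ := fun a b =>
      ((min_le_right _ _).trans_lt ENNReal.one_lt_top).ne
    change truncDist x z ≤ truncDist x y + truncDist y z
    rw [truncDist, truncDist, truncDist, ← ENNReal.toReal_add (hfin _ _) (hfin _ _)]
    refine ENNReal.toReal_mono (ENNReal.add_ne_top.2 ⟨hfin _ _, hfin _ _⟩) ?_
    rcases le_total 1 (edist x y) with h1 | h1
    · rw [min_eq_right h1]
      exact (min_le_right _ _).trans le_self_add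
    · rcases le_total 1 (edist y z) with h2 | h2
      · rw [min_eq_right h2]
        exact (min_le_right _ _).trans le_add_self
      · rw [min_eq_left h1, min_eq_left h2]
        exact (min_le_left _ _).trans (edist_triangle x y z)
  -- Keeping the given uniform structure leaves the topology unchanged, so statements about
  -- continuity and Borel sets transfer without conversion.
  toUniformSpace := PseudoEMetricSpace.toUniformSpace
  uniformity_dist := by
    have h1 : (uniformity X).HasBasis (fun ε : ℝ => 0 < ε)
        fun ε => {p : X × X | truncDist p.1 p.2 < ε} := by
      refine uniformity_basis_edist.to_hasBasis (fun ε hε => ?_) fun ε hε => ?_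
      · obtain ⟨r, hr0, hr⟩ := ENNReal.lt_iff_exists_nnreal_btwn.1 hε
        have hr0' : (0 : ℝ) < r := by exact_mod_cast hr0
        refine ⟨min r 1, lt_min hr0' one_pos, fun p hp => ?_⟩
        have hp' := (truncDist_lt_iff (min_le_right (r : ℝ) 1)).1 hp
        refine lt_trans (lt_of_lt_of_le hp' (ENNReal.ofReal_le_ofReal (min_le_left _ _))) ?_
        simpa using hr
      · refine ⟨ENNReal.ofReal (min ε 1), ENNReal.ofReal_pos.2 (lt_min hε one_pos), fun p hp => ?_⟩
        exact lt_of_lt_of_le ((truncDist_lt_iff (min_le_right ε 1)).2 hp) (min_le_left _ _)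
    exact h1.eq_biInf
  eq_of_dist_eq_zero {x y} h := by
    change truncDist x y = 0 at h
    rw [truncDist, ENNReal.toReal_eq_zero_iff] at h
    rcases h with h | h
    · rcases min_eq_iff.1 h with h | h
      · exact edist_eq_zero.1 h.1
      · exact absurd h.1 one_ne_zero
    · exact absurd h ((min_le_right _ _).trans_lt ENNReal.one_lt_top).ne

end TruncDist

/-- Only the rates for parameters in `N` matter. Elsewhere they may be redefined to obtain a
function that is jointly measurable on the whole product. -/
lemma LocalControl.congr_lam {T X : Type*} [MetricSpace X] [MeasurableSpace X] {μ : Measure X}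
    {F : T → X → X} {lam lam' J : T → X → ℝ} {N : Set T} {η ρ Λ Jm L : ℝ}
    (h : LocalControl μ F lam J N η ρ Λ Jm L) (hl : ∀ t ∈ N, lam' t = lam t) :
    LocalControl μ F lam' J N η ρ Λ Jm L :=
  ⟨h.η_pos, h.ρ_pos, h.L_nonneg, h.one_le_Λ, h.one_le_Jm, h.cont,
    fun t ht => by rw [hl t ht]; exact h.lam_pos t ht,
    fun t ht => by rw [hl t ht]; exact h.lam_le t ht,
    fun t ht => by rw [hl t ht]; exact h.lam_cont t ht,
    fun t ht => by rw [hl t ht]; exact h.lam_near t ht, h.J_pos, h.J_le, h.J_meas, h.logJ_lip,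
    h.image, fun t ht => by rw [hl t ht]; exact h.surj t ht,
    fun t ht => by rw [hl t ht]; exact h.expand t ht⟩

/-! ### Uniform local control near a local diffeomorphism -/

section Uniform

variable {d : ℕ} {M : Type*} [EMetricSpace M] [ChartedSpace (EuclideanSpace ℝ (Fin d)) M]
  [IsManifold (𝓡 d) ∞ M] [CompactSpace M] {T : Type*} [TopologicalSpace T]
  {Φ : T → C^2⟮𝓡 d, M; 𝓡 d, M⟯}
  [RiemannianBundle (fun x : M => TangentSpace (𝓡 d) x)]
  [IsContMDiffRiemannianBundle (𝓡 d) ∞ (EuclideanSpace ℝ (Fin d))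
    (fun x : M => TangentSpace (𝓡 d) x)] [IsRiemannianManifold (𝓡 d) M]

lemma eventually_forall_isInvertible (hΦ : Continuous[inferInstance, c2Topology d M] Φ)
    {t₀ : T} (h : ∀ x, (modelDeriv d (Φ t₀) x).IsInvertible) :
    ∀ᶠ t in 𝓝 t₀, ∀ x, (modelDeriv d (Φ t) x).IsInvertible := by
  obtain ⟨_, -, h⟩ := exists_uniform_radius
    (P := fun _ t x => (modelDeriv d (Φ t) x).IsInvertible) (fun _ _ h => h)
    fun x => ⟨1, one_pos, eventually_isInvertible_modelDeriv hΦ (h x)⟩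
  exact h

lemma exists_normInvDeriv_near (hd : d ≠ 0) (hΦ : Continuous[inferInstance, c2Topology d M] Φ)
    {t₀ : T} {x : M} (h : (modelDeriv d (Φ t₀) x).IsInvertible) {η : ℝ} (hη : 0 < η) :
    ∃ ρ, 0 < ρ ∧ ∀ᶠ p : T × M in 𝓝 (t₀, x), ∀ u ∈ Metric.eball p.2 (ENNReal.ofReal ρ),
      normInvDeriv d (Φ p.1) u ≤ Real.exp η * normInvDeriv d (Φ p.1) p.2 := by
  set l := normInvDeriv d (Φ t₀) x with hl
  have hl0 : 0 < l := normInvDeriv_pos hd h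
  have hc := continuousAt_normInvDeriv hΦ h
  have h1 : ∀ᶠ p : T × M in 𝓝 (t₀, x), l * Real.exp (-(η / 2)) < normInvDeriv d (Φ p.1) p.2 ∧
      normInvDeriv d (Φ p.1) p.2 < l * Real.exp (η / 2) := by
    refine (hc.eventually_const_lt ?_).and (hc.eventually_lt_const ?_)
    · exact mul_lt_of_lt_one_right hl0 (by rw [Real.exp_lt_one_iff]; linarith)
    · exact lt_mul_of_one_lt_right hl0 (by rw [Real.one_lt_exp_iff]; linarith)
  rw [nhds_prod_eq] at h1
  obtain ⟨pa, hpa, pb, hpb, hab⟩ := eventually_prod_iff.1 h1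
  obtain ⟨ρ, hρ, hsub⟩ := exists_eball_subset hpb
  refine ⟨ρ / 2, half_pos hρ, ?_⟩
  rw [nhds_prod_eq]
  filter_upwards [hpa.prod_mk (Metric.eball_mem_nhds x (ENNReal.ofReal_pos.2 (half_pos hρ)))] with
    p hp u hu
  have hρρ : ENNReal.ofReal ρ = ENNReal.ofReal (ρ / 2) + ENNReal.ofReal (ρ / 2) := by
    rw [← ENNReal.ofReal_add (by linarith) (by linarith), add_halves]
  have hu' := hab hp.1 (hsub (show u ∈ Metric.eball x (ENNReal.ofReal ρ) by
    rw [Metric.mem_eball, hρρ]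
    exact (edist_triangle u p.2 x).trans_lt (ENNReal.add_lt_add hu hp.2)))
  have hp' := hab hp.1 (hsub
    (Metric.eball_subset_eball (ENNReal.ofReal_le_ofReal (by linarith)) hp.2))
  calc _ ≤ l * Real.exp (η / 2) := hu'.2.le
    _ = Real.exp η * (l * Real.exp (-(η / 2))) := by
      rw [mul_left_comm, ← Real.exp_add]; congr 2; ring
    _ ≤ _ := by gcongr; exact hp'.1.le

lemma exists_jacobian_le (hΦ : Continuous[inferInstance, c2Topology d M] Φ)
    {t₀ : T} {x : M} (h : (modelDeriv d (Φ t₀) x).IsInvertible) :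
    ∃ C, 0 < C ∧ ∀ᶠ p : T × M in 𝓝 (t₀, x), jacobian d (Φ p.1) p.2 ≤ C := by
  set y := Φ t₀ x with hy
  set Ψ : T × EuclideanSpace ℝ (Fin d) → (EuclideanSpace ℝ (Fin d) →L[ℝ]
    EuclideanSpace ℝ (Fin d)) × EuclideanSpace ℝ (Fin d) × EuclideanSpace ℝ (Fin d) := fun p =>
    (fderiv ℝ (chartRep d (Φ p.1) x y) p.2, chartRep d (Φ p.1) x y p.2, p.2) with hΨ
  have hΨc : ContinuousAt Ψ (t₀, extChartAt (𝓡 d) x x) :=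
    (continuousAt_fderiv_chartRep hΦ t₀ x).prodMk
      ((continuousAt_chartRep hΦ t₀ x).prodMk continuousAt_snd)
  have hrep0 : chartRep d (Φ t₀) x y (extChartAt (𝓡 d) x x) = extChartAt (𝓡 d) y y := by
    simp only [chartRep, Function.comp, extChartAt_to_inv, hy]
  have hdet0 := (isInvertible_modelDeriv_iff (mem_extChartAt_source x) (mdifferentiableAt_c2 _ _)
    (mem_extChartAt_source (Φ t₀ x))).1 h
  have hG : ContinuousAt (chartLogJacobian d x y) (Ψ (t₀, extChartAt (𝓡 d) x x)) :=
    (contDiffAt_chartLogJacobian hdet0 (by rw [hrep0]; exact mem_extChartAt_target y)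
      (mem_extChartAt_target x)).continuousAt
  have hφ : ContinuousAt (fun p : T × M => (p.1, extChartAt (𝓡 d) x p.2)) (t₀, x) :=
    continuousAt_fst.prodMk (ContinuousAt.comp (f := Prod.snd) (continuousAt_extChartAt x)
      continuousAt_snd)
  have hcomp : ContinuousAt (fun p : T × M =>
      chartLogJacobian d x y (Ψ (p.1, extChartAt (𝓡 d) x p.2))) (t₀, x) :=
    ContinuousAt.comp (g := fun q => chartLogJacobian d x y (Ψ q))
      (f := fun p : T × M => (p.1, extChartAt (𝓡 d) x p.2)) (ContinuousAt.comp hG hΨc) hφ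
  refine ⟨Real.exp (chartLogJacobian d x y (Ψ (t₀, extChartAt (𝓡 d) x x)) + 1),
    Real.exp_pos _, ?_⟩
  filter_upwards [hcomp.eventually_lt_const (lt_add_one _), eventually_mem_charts hΦ t₀ x,
    eventually_isInvertible_modelDeriv hΦ h] with p h1 h2 h3
  rw [← log_jacobian_eq h2.1 (mdifferentiableAt_c2 _ _) h2.2 h3] at h1
  rw [← Real.exp_log (jacobian_pos (mdifferentiableAt_c2 _ _) h3)]
  exact Real.exp_le_exp.2 h1.le

variable [MeasurableSpace M] [BorelSpace M]

/-- A family of maps that is continuous for the `C²` topology has uniform local control near a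
local diffeomorphism. -/
theorem exists_localControl (hd : d ≠ 0) (hΦ : Continuous[inferInstance, c2Topology d M] Φ)
    {t₀ : T} (h : ∀ x, (modelDeriv d (Φ t₀) x).IsInvertible) {η : ℝ} (hη : 0 < η) :
    ∃ N : Set T, IsOpen N ∧ t₀ ∈ N ∧ (∀ t ∈ N, ∀ x, (modelDeriv d (Φ t) x).IsInvertible) ∧
      ∃ ρ Λ Jm L : ℝ, @LocalControl T M (truncMetric M) _ (leb d M) (fun t => Φ t)
        (fun t => normInvDeriv d (Φ t)) (fun t => jacobian d (Φ t)) N η ρ Λ Jm L := by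
  have hanti : ∀ {ρ ρ' : ℝ} {x : M}, ρ' ≤ ρ →
      Metric.eball x (ENNReal.ofReal ρ') ⊆ Metric.eball x (ENNReal.ofReal ρ) := fun h =>
    Metric.eball_subset_eball (ENNReal.ofReal_le_ofReal h)
  obtain ⟨R₁, hR₁, hinj⟩ := exists_uniform_radius
    (P := fun ρ t x => InjOn (Φ t) (Metric.eball x (ENNReal.ofReal ρ)))
    (fun h _ hP => hP.mono (hanti h)) fun x => exists_injOn_eball hd hΦ (h x)
  obtain ⟨R₂, hR₂, hnear⟩ := exists_uniform_radius
    (P := fun ρ t x => ∀ u ∈ Metric.eball x (ENNReal.ofReal ρ),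
      normInvDeriv d (Φ t) u ≤ Real.exp η * normInvDeriv d (Φ t) x)
    (fun h _ hP u hu => hP u (hanti h hu)) fun x => exists_normInvDeriv_near hd hΦ (h x) hη
  set R := min R₁ R₂ with hR
  have hRpos : 0 < R := lt_min hR₁ hR₂
  obtain ⟨R₃, hR₃, hsurj⟩ := exists_uniform_radius
    (P := fun ρ t x => ∀ y ∈ Metric.eball (Φ t x) (ENNReal.ofReal ρ),
      ∃ u ∈ Metric.eball x (ENNReal.ofReal R), Φ t u = y)
    (fun h _ hP u hu => hP u (hanti h hu)) fun x => exists_surjOn_eball hd hΦ (h x) hRpos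
  obtain ⟨R₄, hR₄, hbd⟩ := exists_uniform_radius
    (P := fun ρ t x => normInvDeriv d (Φ t) x ≤ 1 / ρ ∧ jacobian d (Φ t) x ≤ 1 / ρ)
    (fun h h0 hP => ⟨hP.1.trans (one_div_le_one_div_of_le h0 h),
      hP.2.trans (one_div_le_one_div_of_le h0 h)⟩) (fun x => by
        obtain ⟨C, hC, hJ⟩ := exists_jacobian_le hΦ (h x)
        have hl := (continuousAt_normInvDeriv hΦ (h x)).eventually_lt_const (lt_add_one _)
        refine ⟨1 / max C (normInvDeriv d (Φ t₀) x + 1),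
          one_div_pos.2 (hC.trans_le (le_max_left _ _)), ?_⟩
        filter_upwards [hJ, hl] with p h1 h2
        rw [one_div_one_div]
        exact ⟨h2.le.trans (le_max_right _ _), h1.trans (le_max_left _ _)⟩)
  obtain ⟨R₅, hR₅, hlip⟩ := exists_uniform_radius
    (P := fun ρ t x => ∀ u ∈ Metric.eball x (ENNReal.ofReal ρ),
      |Real.log (jacobian d (Φ t) u) - Real.log (jacobian d (Φ t) x)| ≤
        1 / ρ * (edist u x).toReal)
    (fun h h0 hP u hu => (hP u (hanti h hu)).trans (by gcongr)) fun x =>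
      exists_lipschitz_logJacobian hΦ (h x)
  have hall := ((eventually_forall_isInvertible hΦ h).and (hinj.and (hnear.and
    (hsurj.and (hbd.and hlip)))))
  obtain ⟨N, hN, hNo, hN0⟩ := eventually_nhds_iff.1 hall
  -- Below `R` the maps are injective and the inverse norm nearly constant; `R₃ / 3` provides the
  -- branch on the threefold ball; `R₅` is for the Jacobian; and with `1 / 2`, two points of a
  -- `ρ`-ball are at distance at most one, where truncation has no effect.
  set ρ := min (min R (R₃ / 3)) (min R₅ (1 / 2)) with hρ
  have hρpos : 0 < ρ := lt_min (lt_min hRpos (by positivity)) (lt_min hR₅ (by norm_num))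
  have hρ2 : ρ ≤ 1 / 2 := (min_le_right _ _).trans (min_le_right _ _)
  have hρ1 : ρ ≤ 1 := hρ2.trans (by norm_num)
  have hρR : ρ ≤ R := (min_le_left _ _).trans (min_le_left _ _)
  have hρ3 : 3 * ρ ≤ R₃ := by
    have : ρ ≤ R₃ / 3 := (min_le_left _ _).trans (min_le_right _ _)
    linarith
  have hρ5 : ρ ≤ R₅ := (min_le_right _ _).trans (min_le_left _ _)
  have hlt : ∀ {x y : M}, truncDist x y < ρ → x ∈ Metric.eball y (ENNReal.ofReal ρ) := fun h =>
    (truncDist_lt_iff hρ1).1 h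
  have hle1 : ∀ {x y : M}, x ∈ Metric.eball y (ENNReal.ofReal ρ) → edist x y ≤ 1 := fun h => by
    refine (le_of_lt h).trans ?_
    rw [← ENNReal.ofReal_one]
    exact ENNReal.ofReal_le_ofReal hρ1
  have h3ρ : 3 * ENNReal.ofReal ρ = ENNReal.ofReal (3 * ρ) := by
    rw [ENNReal.ofReal_mul (by norm_num), ENNReal.ofReal_ofNat]
  have hbranch : ∀ t ∈ N, ∀ x u u', u ∈ Metric.eball x (ENNReal.ofReal R) →
      u' ∈ Metric.eball x (ENNReal.ofReal R) →
      Φ t u ∈ Metric.eball (Φ t x) (ENNReal.ofReal ρ) →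
      Φ t u' ∈ Metric.eball (Φ t x) (ENNReal.ofReal ρ) →
      edist u u' ≤ ENNReal.ofReal (Real.exp η * normInvDeriv d (Φ t) x) *
        edist (Φ t u) (Φ t u') := by
    intro t ht x u u' hu hu' hgu hgu'
    obtain ⟨hi, hj, hn, hs, -, -⟩ := hN t ht
    refine edist_le_of_inverse_branch (Φ t).contMDiff hi ((hj x).mono (hanti (min_le_left _ _)))
      (fun v hv => hn x v (hanti (min_le_right _ _) hv)) (fun y hy => ?_) hu hu' hgu hgu'
    rw [h3ρ] at hy
    exact hs x y (hanti hρ3 hy)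
  have hC0 : ∀ t x, 0 ≤ Real.exp η * normInvDeriv d (Φ t) x := fun t x =>
    mul_nonneg (Real.exp_pos _).le (normInvDeriv_nonneg _ _)
  refine ⟨N, hNo, hN0, fun t ht => (hN t ht).1, ρ, max 1 (1 / R₄), max 1 (1 / R₄), 1 / R₅,
    @LocalControl.mk T M (truncMetric M) _ _ _ _ _ _ _ _ _ _ _ hη hρpos (by positivity)
      (le_max_left _ _) (le_max_left _ _) (fun t _ => (Φ t).contMDiff.continuous)
      (fun t ht x => normInvDeriv_pos hd ((hN t ht).1 x))
      (fun t ht x => ((hN t ht).2.2.2.2.1 x).1.trans (le_max_right _ _)) (fun t ht => ?_)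
      (fun t ht x y hxy => ?_)
      (fun t ht x => jacobian_pos (mdifferentiableAt_c2 _ _) ((hN t ht).1 x))
      (fun t ht x => ((hN t ht).2.2.2.2.1 x).2.trans (le_max_right _ _))
      (fun t _ => (continuous_jacobian ((Φ t).contMDiff.of_le one_le_two)).measurable)
      (fun t ht x y hxy => ?_)
      (fun t _ E hE hi => leb_image ((Φ t).contMDiff.of_le one_le_two) hE hi)
      (fun t ht x y hxy => ?_) (fun t ht x u u' hu hu' hgu hgu' => ?_)⟩
  · refine continuous_iff_continuousAt.2 fun x => ?_
    exact ContinuousAt.comp (f := fun a : M => (t, a))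
      (g := fun p : T × M => normInvDeriv d (Φ p.1) p.2)
      (continuousAt_normInvDeriv hΦ ((hN t ht).1 x)) (by fun_prop)
  · have hyx : y ∈ Metric.eball x (ENNReal.ofReal ρ) := by
      have := hlt hxy
      rwa [Metric.mem_eball, edist_comm] at this
    exact (hN t ht).2.2.1 x y (hanti (hρR.trans (min_le_right _ _)) hyx)
  · have hxy' := hlt hxy
    have := (hN t ht).2.2.2.2.2 y x (hanti hρ5 hxy')
    rwa [← truncDist_eq_toReal (hle1 hxy')] at this
  · have hy := hlt hxy
    obtain ⟨u, hu, rfl⟩ := (hN t ht).2.2.2.1 x y (hanti (by linarith) hy)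
    refine ⟨u, rfl, truncDist_le_of_edist_le (hC0 t x) ?_ (hle1 hy)⟩
    exact hbranch t ht x u x hu (Metric.mem_eball_self (ENNReal.ofReal_pos.2 hRpos)) hy
      (Metric.mem_eball_self (ENNReal.ofReal_pos.2 hρpos))
  · have hb := hbranch t ht x u u' (hanti hρR (hlt hu)) (hanti hρR (hlt hu')) (hlt hgu) (hlt hgu')
    refine truncDist_le_of_edist_le (hC0 t x) hb ?_
    refine (edist_triangle_right _ _ (Φ t x)).trans
      ((add_le_add (le_of_lt (hlt hgu)) (le_of_lt (hlt hgu'))).trans ?_)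
    rw [← ENNReal.ofReal_add hρpos.le hρpos.le, ← ENNReal.ofReal_one]
    exact ENNReal.ofReal_le_ofReal (by linarith)

end Uniform

/-! ### Derivatives of random iterates -/

section ChainRule

variable {d : ℕ} {M : Type*} [EMetricSpace M] [ChartedSpace (EuclideanSpace ℝ (Fin d)) M]

lemma modelDeriv_comp {g h : M → M} {x : M} (hg : MDifferentiableAt (𝓡 d) (𝓡 d) g (h x))
    (hh : MDifferentiableAt (𝓡 d) (𝓡 d) h x) :
    modelDeriv d (g ∘ h) x = modelDeriv d g (h x) ∘L modelDeriv d h x :=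
  mfderiv_comp x hg hh

lemma modelDeriv_congr {g g' : M → M} {x : M} (h : g =ᶠ[𝓝 x] g') :
    modelDeriv d g x = modelDeriv d g' x :=
  h.mfderiv_eq

lemma modelDeriv_id (x : M) : modelDeriv d (id : M → M) x = .id ℝ _ := mfderiv_id

lemma isInvertible_modelDeriv_comp {g h : M → M} {x : M}
    (hg : MDifferentiableAt (𝓡 d) (𝓡 d) g (h x)) (hh : MDifferentiableAt (𝓡 d) (𝓡 d) h x)
    (hgi : (modelDeriv d g (h x)).IsInvertible) (hhi : (modelDeriv d h x).IsInvertible) :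
    (modelDeriv d (g ∘ h) x).IsInvertible := by
  rw [modelDeriv_comp hg hh]
  exact hgi.comp hhi

variable [IsManifold (𝓡 d) ∞ M] [RiemannianBundle (fun x : M => TangentSpace (𝓡 d) x)]

lemma normInvDeriv_comp_le {g h : M → M} {x : M} (hg : MDifferentiableAt (𝓡 d) (𝓡 d) g (h x))
    (hh : MDifferentiableAt (𝓡 d) (𝓡 d) h x) (hgi : (modelDeriv d g (h x)).IsInvertible)
    (hhi : (modelDeriv d h x).IsInvertible) :
    normInvDeriv d (g ∘ h) x ≤ normInvDeriv d h x * normInvDeriv d g (h x) := by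
  have h0 := normInvDeriv_nonneg (d := d) g (h x)
  have h1 := normInvDeriv_nonneg (d := d) h x
  rw [normInvDeriv_le_iff (isInvertible_modelDeriv_comp hg hh hgi hhi) (mul_nonneg h1 h0)]
  intro v
  rw [modelDeriv_comp hg hh]
  refine ((normInvDeriv_le_iff hhi h1).1 le_rfl v).trans ?_
  rw [mul_pow, mul_assoc]
  exact mul_le_mul_of_nonneg_left ((normInvDeriv_le_iff hgi h0).1 le_rfl _) (sq_nonneg _)

lemma normInvDeriv_id_le (x : M) : normInvDeriv d (id : M → M) x ≤ 1 := by
  have hi : (modelDeriv d (id : M → M) x).IsInvertible := by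
    rw [modelDeriv_id]; exact ⟨.refl ℝ _, rfl⟩
  rw [normInvDeriv_le_iff hi zero_le_one]
  intro v
  rw [modelDeriv_id]
  simp

lemma normInvDeriv_congr {g g' : M → M} {x : M} (h : g =ᶠ[𝓝 x] g')
    (hi : (modelDeriv d g' x).IsInvertible) : normInvDeriv d g x = normInvDeriv d g' x := by
  have hi' : (modelDeriv d g x).IsInvertible := by rwa [modelDeriv_congr h]
  have key : ∀ c, 0 ≤ c → (normInvDeriv d g x ≤ c ↔ normInvDeriv d g' x ≤ c) := by
    intro c hc
    rw [normInvDeriv_le_iff hi hc, normInvDeriv_le_iff hi' hc, modelDeriv_congr h, h.self_of_nhds]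
  exact le_antisymm ((key _ (normInvDeriv_nonneg _ _)).2 le_rfl)
    ((key _ (normInvDeriv_nonneg _ _)).1 le_rfl)

lemma jacobian_congr {g g' : M → M} {x : M} (h : g =ᶠ[𝓝 x] g') :
    jacobian d g x = jacobian d g' x := by
  have : FiniteDimensional ℝ (TangentSpace (𝓡 d) x) :=
    inferInstanceAs (FiniteDimensional ℝ (EuclideanSpace ℝ (Fin d)))
  -- The target tangent space depends on the map, so the determinant is written with forms on the
  -- model space before the maps are exchanged.
  have key : ∀ g : M → M, jacobian d g x = Real.sqrt (Matrix.of fun i j =>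
      riemForm d (g x) (modelDeriv d g x (stdOrthonormalBasis ℝ (TangentSpace (𝓡 d) x) i))
        (modelDeriv d g x (stdOrthonormalBasis ℝ (TangentSpace (𝓡 d) x) j))).det := fun g => rfl
  rw [key, key, modelDeriv_congr h, h.self_of_nhds]

lemma jacobian_comp {g h : M → M} {x : M} (hg : MDifferentiableAt (𝓡 d) (𝓡 d) g (h x))
    (hh : MDifferentiableAt (𝓡 d) (𝓡 d) h x) :
    jacobian d (g ∘ h) x = jacobian d g (h x) * jacobian d h x := by
  have hfin : ∀ a : M, FiniteDimensional ℝ (TangentSpace (𝓡 d) a) := fun a =>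
    inferInstanceAs (FiniteDimensional ℝ (EuclideanSpace ℝ (Fin d)))
  have e : tangentDeriv d (g ∘ h) x = (tangentDeriv d g (h x)).comp (tangentDeriv d h x) :=
    mfderiv_comp x hg hh
  have h1 := sqrt_det_gram_map (d := Module.finrank ℝ (TangentSpace (𝓡 d) x))
    (rfl : Module.finrank ℝ (TangentSpace (𝓡 d) (h x)) = _) (tangentDeriv d g (h x))
    (fun i => tangentDeriv d h x (stdOrthonormalBasis ℝ (TangentSpace (𝓡 d) x) i))
  rw [jacobian, e]
  exact h1

variable [IsContMDiffRiemannianBundle (𝓡 d) ∞ (EuclideanSpace ℝ (Fin d))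
    (fun x : M => TangentSpace (𝓡 d) x)] {T : Type*} {Φ : T → C^2⟮𝓡 d, M; 𝓡 d, M⟯} {w : ℕ → T}

lemma contMDiff_randIter (Φ : T → C^2⟮𝓡 d, M; 𝓡 d, M⟯) (w : ℕ → T) (n : ℕ) :
    ContMDiff (𝓡 d) (𝓡 d) 2 (randIter (fun t => Φ t) w n) := by
  induction n with
  | zero => exact contMDiff_id
  | succ n ih => exact (Φ (w n)).contMDiff.comp ih

lemma isInvertible_modelDeriv_randIter (hi : ∀ i x, (modelDeriv d (Φ (w i)) x).IsInvertible)
    (n : ℕ) (x : M) : (modelDeriv d (randIter (fun t => Φ t) w n) x).IsInvertible := by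
  induction n with
  | zero => exact (modelDeriv_id (d := d) x) ▸ ⟨.refl ℝ _, rfl⟩
  | succ n ih =>
    exact isInvertible_modelDeriv_comp (mdifferentiableAt_c2 _ _)
      ((contMDiff_randIter Φ w n).mdifferentiable two_ne_zero x) (hi n _) ih

lemma normInvDeriv_randIter_le (hi : ∀ i x, (modelDeriv d (Φ (w i)) x).IsInvertible)
    (n : ℕ) (x : M) : normInvDeriv d (randIter (fun t => Φ t) w n) x ≤
      ∏ i ∈ Finset.range n, normInvDeriv d (Φ (w i)) (randIter (fun t => Φ t) w i x) := by
  induction n with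
  | zero =>
    rw [Finset.prod_range_zero]
    exact normInvDeriv_id_le x
  | succ n ih =>
    rw [Finset.prod_range_succ]
    refine (normInvDeriv_comp_le (mdifferentiableAt_c2 _ _)
      ((contMDiff_randIter Φ w n).mdifferentiable two_ne_zero x) (hi n _)
      (isInvertible_modelDeriv_randIter hi n x)).trans ?_
    exact mul_le_mul_of_nonneg_right ih (normInvDeriv_nonneg _ _)

lemma log_jacobian_randIter [CompactSpace M] [MeasurableSpace M] [BorelSpace M]
    [IsRiemannianManifold (𝓡 d) M] (hi : ∀ i x, (modelDeriv d (Φ (w i)) x).IsInvertible)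
    (n : ℕ) (x : M) : Real.log (jacobian d (randIter (fun t => Φ t) w n) x) =
      ∑ i ∈ Finset.range n,
        Real.log (jacobian d (Φ (w i)) (randIter (fun t => Φ t) w i x)) := by
  induction n with
  | zero =>
    rw [Finset.sum_range_zero]
    exact (congrArg Real.log (jacobian_id (d := d) x)).trans Real.log_one
  | succ n ih =>
    have hd := (contMDiff_randIter Φ w n).mdifferentiable two_ne_zero x
    rw [Finset.sum_range_succ, ← ih, show randIter (fun t => (Φ t : M → M)) w (n + 1) =
      Φ (w n) ∘ randIter (fun t => (Φ t : M → M)) w n from rfl,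
      jacobian_comp (mdifferentiableAt_c2 _ _) hd, Real.log_mul, add_comm]
    · exact (jacobian_pos (mdifferentiableAt_c2 _ _) (hi n _)).ne'
    · exact (jacobian_pos hd (isInvertible_modelDeriv_randIter hi n x)).ne'

end ChainRule

/-! ### The main theorem -/

section Main

variable {d : ℕ} {M : Type*} [EMetricSpace M] [CompactSpace M]
  [ChartedSpace (EuclideanSpace ℝ (Fin d)) M] [IsManifold (𝓡 d) ∞ M]
  [RiemannianBundle (fun x : M => TangentSpace (𝓡 d) x)]
  [IsContMDiffRiemannianBundle (𝓡 d) ∞ (EuclideanSpace ℝ (Fin d))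
    (fun x : M => TangentSpace (𝓡 d) x)]
  [IsRiemannianManifold (𝓡 d) M] [MeasurableSpace M] [BorelSpace M]

lemma isInvertible_modelDeriv_of_isLocalDiffeomorph {f : M → M}
    (hf : IsLocalDiffeomorph (𝓡 d) (𝓡 d) 2 f) (x : M) : (modelDeriv d f x).IsInvertible :=
  ⟨(hf x).mfderivToContinuousLinearEquiv two_ne_zero,
    (hf x).mfderivToContinuousLinearEquiv_coe two_ne_zero⟩

/-- There is no expansion in dimension zero. -/
lemma dim_ne_zero_of_NUERO {T : Type*} [MeasurableSpace T] {F : T → M → M} {θ : ℝ → Measure T}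
    [∀ ε, IsProbabilityMeasure (θ ε)] {A : Set M} (hA : 0 < leb d M A) (h : NUERO d F θ A) :
    d ≠ 0 := by
  rintro rfl
  obtain ⟨a₀, ha₀, h⟩ := h
  obtain ⟨ε, hε⟩ := h.exists
  have := isFiniteMeasure_leb hA
  have hzero : ∀ (g : M → M) (x : M), normInvDeriv 0 g x = 0 := by
    intro g x
    have hs : Subsingleton (TangentSpace (𝓡 0) (g x)) :=
      inferInstanceAs (Subsingleton (EuclideanSpace ℝ (Fin 0)))
    exact ContinuousLinearMap.opNorm_subsingleton _
  have hfalse : ∀ᵐ _p ∂((Measure.infinitePi fun _ : ℕ => θ ε).prod ((leb 0 M).restrict A)),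
      False := by
    filter_upwards [hε] with p hp
    -- In dimension zero the inverse norm is `0` and `Real.log 0 = 0`, so the lower limit is zero
    -- and cannot be negative.
    simp only [hzero, Real.log_zero, Finset.sum_const_zero, mul_zero, EReal.coe_zero,
      liminf_const] at hp
    have : (0 : ℝ) < -a₀ := by exact_mod_cast hp
    linarith
  have h0 : ((Measure.infinitePi fun _ : ℕ => θ ε).prod ((leb 0 M).restrict A)) univ = 0 := by
    simpa [ae_iff] using hfalse
  rw [← univ_prod_univ, Measure.prod_prod] at h0
  simp at h0
  exact hA.ne' h0

lemma truncMetric_ball {p : M} {r : ℝ} (hr : r ≤ 1) :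
    @Metric.ball M (truncMetric M).toPseudoMetricSpace p r =
      Metric.eball p (ENNReal.ofReal r) := by
  ext x
  exact truncDist_lt_iff hr

end Main

theorem mainTheorem6 {d : ℕ} {M : Type*} [EMetricSpace M] [CompactSpace M]
    [ChartedSpace (EuclideanSpace ℝ (Fin d)) M] [IsManifold (𝓡 d) ∞ M]
    [RiemannianBundle (fun x : M => TangentSpace (𝓡 d) x)]
    [IsContMDiffRiemannianBundle (𝓡 d) ∞ (EuclideanSpace ℝ (Fin d))
      (fun x : M => TangentSpace (𝓡 d) x)]
    [IsRiemannianManifold (𝓡 d) M] [MeasurableSpace M] [BorelSpace M]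
    {T : Type*} [MetricSpace T] [MeasurableSpace T] [BorelSpace T]
    (Φ : T → C^2⟮𝓡 d, M; 𝓡 d, M⟯) (hΦ : Continuous[inferInstance, c2Topology d M] Φ)
    (f : C^2⟮𝓡 d, M; 𝓡 d, M⟯) (tstar : T) (hf : Φ tstar = f)
    (hdiffeo : IsLocalDiffeomorph (𝓡 d) (𝓡 d) 2 f)
    (θ : ℝ → Measure T) [∀ ε, IsProbabilityMeasure (θ ε)] (hθ : SupportsTendTo θ tstar)
    (A : Set M) (hAmeas : MeasurableSet A) (hApos : 0 < leb d M A)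
    (hAinv : ∀ᶠ ε in 𝓝[>] (0 : ℝ), RandomInvariant (fun t => ⇑(Φ t)) (θ ε) (leb d M) A)
    (htrans : TopTransitiveIn f A)
    (hNUERO : NUERO d (fun t => ⇑(Φ t)) θ A) :
    ∃ (p : M) (r : ℝ), 0 < r ∧ leb d M (Metric.eball p (ENNReal.ofReal r) \ A) = 0 ∧
      ∀ᶠ ε in 𝓝[>] (0 : ℝ),
        InducesRandomGMY d (fun t => ⇑(Φ t)) (θ ε) (Metric.eball p (ENNReal.ofReal r)) := by
  classical
  have hd := dim_ne_zero_of_NUERO hApos hNUERO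
  have hfin := isFiniteMeasure_leb hApos
  have hopen := isOpenPosMeasure_leb hApos
  obtain ⟨a₀, ha₀, hNU⟩ := hNUERO
  subst hf
  -- The expansion rate is split into four parts: two are spent on the definition of hyperbolic
  -- times, one on inverse branches, and one remains as contraction.
  obtain ⟨N, hNo, hN0, hNinv, ρ, Λ, Jm, L, hLC⟩ := exists_localControl hd hΦ
    (isInvertible_modelDeriv_of_isLocalDiffeomorph hdiffeo) (η := a₀ / 4) (by positivity)
  -- Continuity of the inverse norm is known only where the derivative is invertible; the constant
  -- outside `N` makes the rate measurable everywhere.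
  set lam : T → M → ℝ := fun t x => if t ∈ N then normInvDeriv d (Φ t) x else 1 with hlam
  have hlamN : ∀ t ∈ N, lam t = normInvDeriv d (Φ t) := fun t ht => by
    ext x; simp [hlam, ht]
  have hlamm : Measurable (Function.uncurry lam) := by
    have hpw : Function.uncurry lam = (N ×ˢ (univ : Set M)).piecewise
        (fun p : T × M => normInvDeriv d (Φ p.1) p.2) (fun _ => 1) := by
      ext ⟨t, x⟩
      by_cases ht : t ∈ N <;> simp [hlam, Set.piecewise, ht]
    rw [hpw]
    refine ContinuousOn.measurable_piecewise (fun p hp => ?_) continuousOn_const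
      (hNo.measurableSet.prod MeasurableSet.univ)
    exact (continuousAt_normInvDeriv hΦ (hNinv p.1 hp.1 p.2)).continuousWithinAt
  have hFc : Continuous (Function.uncurry fun t => (Φ t : M → M)) := continuous_eval_of_c2 hΦ
  have hLC' := @LocalControl.congr_lam T M (truncMetric M) _ _ _ _ lam _ _ _ _ _ _ _ hLC hlamN
  obtain ⟨p, r, hr, hr1, hpA, hev⟩ := @LocalControl.exists_ball_induced T M (truncMetric M)
    _ _ _ _ _ _ _ _ _ _ _ _ inferInstance inferInstance _ _ hfin hopen hLC' hNo hFc
    hFc.measurable hlamm _ hN0 _ _ hθ _ hAmeas hApos.ne' (by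
      filter_upwards [hAinv] with ε hε
      filter_upwards [hε] with x hx using hx.1) htrans (by
      filter_upwards [hNU] with ε hε
      filter_upwards [hε] with a ha haN
      -- A lower limit below `-a₀` gives averages below `-a₀` infinitely often, which is all that
      -- the record argument uses.
      refine (frequently_lt_of_liminf_lt (by isBoundedDefault) ha).mono fun n hn => ?_
      rw [EReal.coe_lt_coe_iff] at hn
      rw [show 4 * (a₀ / 4) = a₀ by ring]
      simpa only [hlamN _ (haN _)] using hn)
  rw [truncMetric_ball hr1.le] at hpA hev
  refine ⟨p, r, hr, hpA, ?_⟩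
  filter_upwards [hev] with ε hε
  obtain ⟨R, hRm, hR1, κ, K, hκ0, hκ1, hK, hw⟩ := hε
  refine ⟨R, hRm.comp (measurable_fst.prodMk (measurable_subtype_coe.comp measurable_snd)),
    fun w x _ => hR1 w x, κ, K, hκ0, hκ1, hK, ?_⟩
  filter_upwards [hw] with w hw
  obtain ⟨hwN, Q, hQc, hQd, hQ0, hQ⟩ := hw
  have hi : ∀ i x, (modelDeriv d (Φ (w i)) x).IsInvertible := fun i => hNinv _ (hwN i)
  refine ⟨Q, hQc, hQd, hQ0, fun U hU => ?_⟩
  obtain ⟨hUo, hUne, hUs, n, hRn, hbij, hκ, hdist⟩ := hQ U hU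
  -- The inducing time is constant on the open set `U`, so the induced map has the germ of a fixed
  -- iterate, and all derivatives may be computed from that iterate.
  have heq : ∀ x ∈ U, (fun x => randIter (fun t => (Φ t : M → M)) w (R w x) x) =ᶠ[𝓝 x]
      randIter (fun t => (Φ t : M → M)) w n := fun x hx => by
    filter_upwards [hUo.mem_nhds hx] with y hy
    rw [hRn y hy]
  have hinv := isInvertible_modelDeriv_randIter (Φ := Φ) hi n
  refine ⟨hUo, hUne, hUs, fun x hx y hy => by rw [hRn x hx, hRn y hy], ?_, fun x hx => ?_,
    fun x hx y hy => ?_⟩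
  · refine isC2DiffeoOnto_of_bijOn hUo Metric.isOpen_eball
      (fun x hx => (contMDiff_randIter Φ w n x).congr_of_eventuallyEq (heq x hx))
      (fun x hx => by rw [modelDeriv_congr (heq x hx)]; exact hinv x)
      (hbij.congr fun x hx => (heq x hx).self_of_nhds.symm)
  · rw [normInvDeriv_congr (heq x hx) (hinv x)]
    refine (normInvDeriv_randIter_le hi n x).trans_lt ?_
    simpa only [hlamN _ (hwN _)] using hκ x hx
  · have hpos : ∀ x, 0 < jacobian d (randIter (fun t => (Φ t : M → M)) w n) x := fun x =>
      jacobian_pos ((contMDiff_randIter Φ w n).mdifferentiable two_ne_zero x) (hinv x)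
    rw [jacobian_congr (heq x hx), jacobian_congr (heq y hy),
      Real.log_div (hpos x).ne' (hpos y).ne', log_jacobian_randIter hi, log_jacobian_randIter hi,
      ← Finset.sum_sub_distrib, hRn x hx, hRn y hy]
    -- Returning to the original distance needs it to be finite, as `toReal` sends `⊤` to `0`; both
    -- images lie in the ball of radius `r`.
    refine (hdist x hx y hy).trans (mul_le_mul_of_nonneg_left (truncDist_le_toReal ?_) hK.le)
    have h1 : edist (randIter (fun t => (Φ t : M → M)) w n x) p < ENNReal.ofReal r :=
      hbij.mapsTo hx
    have h2 : edist (randIter (fun t => (Φ t : M → M)) w n y) p < ENNReal.ofReal r :=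
      hbij.mapsTo hy
    exact ((edist_triangle_right _ _ p).trans_lt (ENNReal.add_lt_add h1 h2)).trans_le le_top |>.ne
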